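/- **Setting.** Let $\gamma\ge 0$, $c_0\ge 0$, $\alpha,c_1,c_2,c_3>0$ and consider, for $\varepsilon>0$, the general Degasperis–Procesi equation $$\partial_t\{u-\alpha^2\varepsilon^2u_{xx}\}+\partial_x\{c_0u+c_1u^2-c_2\varepsilon^2u_x^2+\varepsilon^2(\gamma-c_3u)u_{xx}\}=0 .\tag{1}$$ Put $\beta=\sqrt{c_1/c_3}$, $r=c_3/(c_2+c_3)$, $q(V)=\frac{c_3(V-c_0)}{c_1(\gamma+\alpha^2V)}$ and $F_V(g)=g^2-2\frac{2-q}{2-r}g^{2-r}+\frac{1-q}{1-r}g^{2-2r}-C$ with $q=q(V)$ and $C$ such that $F_V(1)=0$. Let $0<A_1<A_2$ and, for $i=1,2$, let $V_i\in\mathbb R$, $g_i\in(0,1)$ satisfy $F_{V_i}(g_i)=0$, $V_i=\alpha^{-2}\big(\frac{c_3}{1-g_i^r}A_i-\gamma\big)$ and $c_3-A_i^{-1}(\gamma+c_0\alpha^2)(1-g_i^r)<c_1r\alpha^2$. Let $\omega_i$ be the soliton profile of amplitude $A_i$: a smooth even function with $\omega_i(0)=1$, $\omega_i(\pm\infty)=0$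 and $$\Big\{1-\tfrac{c_3A_i}{\gamma+\alpha^2V_i}\omega_i\Big\}\omega_i''=\tfrac{c_2A_i}{\gamma+\alpha^2V_i}(\omega_i')^2+\tfrac{(V_i-c_0)\omega_i-c_1A_i\omega_i^2}{\beta^2(\gamma+\alpha^2V_i)} .$$ Let $x_1^0>x_2^0$, let $\varphi_{i0}(t)=V_it+x_i^0$, and let the two trajectories meet at a point $x^*$ at an instant $t^*>0$. For functions $S_i(\tau)$, $\varphi_{i1}(\tau)$ on $\mathbb R$ put $$u(t,x,\varepsilon)=\sum_{i=1}^2G_i\,\omega_i\big(\beta(x-\varphi_i)/\varepsilon\big),\quad G_i=A_i+S_i(\tau),\quad \varphi_i=\varphi_{i0}(t)+\varepsilon\varphi_{i1}(\tau),\quad \tau=\beta\big(\varphi_{20}(t)-\varphi_{10}(t)\big)/\varepsilon .\tag{2}$$ **The system for the corrections.** Put $\dot\psi_0=\beta(V_2-V_1)$, $\chi_i=V_i\tau/\dot\psi_0+\varphi_{i1}$, $\sigma=\beta(\chi_1-\chi_2)$, $\dot\varphi_i=V_i+\dot\psi_0\varphi_{i1}'(\tau)$, $\eta_{12}=\eta-\sigma$,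 $\eta_{22}=\eta$, $a_{1,i}=\int\omega_i\,d\eta$, $a_{2,i}'=\int(\omega_i')^2d\eta$. For $H=H(u,w)$ put $a_{H,i}=\int H(A_i\omega_i,\beta A_i\omega_i')\,d\eta$ and $$R_H^{(n)}(\tau)=\int\eta^n\Big\{H\Big(\sum_iG_i\omega_i(\eta_{i2}),\beta\sum_jG_j\omega_j'(\eta_{j2})\Big)-\sum_iH\big(A_i\omega_i(\eta_{i2}),\beta A_i\omega_i'(\eta_{i2})\big)\Big\}d\eta .$$ With $w=\varepsilon u_x$ let $P_1=c_0u+c_1u^2-(c_2-c_3)w^2$, $Q_2=u^2+\alpha^2w^2$, $\mathbb P_2=c_0u^2+\frac43c_1u^3-(3\gamma+(2c_2-5c_3)u)w^2$, $K_2=(2c_2-c_3)w^3$, and put $$L=\beta\sum_ia_{2,i}'\big(G_i^2\dot\varphi_i-A_i^2V_i\big)-\dot\psi_0\big(G_1S_2'-G_2S_1'\big)\int\omega_1'(\eta-\sigma)\omega_2(\eta)\,d\eta+\beta G_1G_2(\dot\varphi_1+\dot\varphi_2)\int\omega_1'(\eta-\sigma)\omega_2'(\eta)\,d\eta .$$ The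 system is $$\sum_ia_{1,i}S_i=0,\qquad \dot\psi_0\tfrac{d}{d\tau}R_{Q_2}^{(0)}+R_{K_2}^{(0)}=0,\qquad \dot\psi_0\tfrac{d}{d\tau}\sum_ia_{1,i}\{A_i\varphi_{i1}+\chi_iS_i\}=R_{P_1}^{(0)},$$ $$\dot\psi_0\tfrac{d}{d\tau}\Big\{\sum_ia_{Q_2,i}\varphi_{i1}+\chi_2R_{Q_2}^{(0)}+\beta^{-1}R_{Q_2}^{(1)}\Big\}=R_{\mathbb P_2}^{(0)}-2\alpha^2\beta L-\chi_2R_{K_2}^{(0)}-\beta^{-1}R_{K_2}^{(1)} .\tag{3}$$ **Weak asymptotic solutions.** Let $T>0$. A family $v(t,x,\varepsilon)$ is $O_{\mathcal D'}(\varepsilon^\varkappa)$ if for each real $\psi\in C_c^\infty(\mathbb R)$ the function $\int v\psi\,dx$ is $C^\infty$ in $t\in(0,T)$ for each $\varepsilon>0$, is $O(\varepsilon^\varkappa)$ as $\varepsilon\to0$ uniformly in $t\in(0,T)$, and is piecewise continuous in $t$ uniformly in small $\varepsilon$. A family $u$ is a weak asymptotic mod $O_{\mathcal D'}(\varepsilon^2)$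 solution of (1) if it is $C^\infty$ on $(0,T)\times\mathbb R$ for each $\varepsilon>0$, belongs to $C(0,T;\mathcal D'(\mathbb R))$ uniformly in $\varepsilon\ge0$, and $$\partial_tu+\partial_xP_1=O_{\mathcal D'}(\varepsilon^2),\qquad \partial_tQ_2+\partial_x\{\mathbb P_2+2\alpha^2\varepsilon^2u_xu_t\}+\varepsilon^{-1}K_2=O_{\mathcal D'}(\varepsilon^2).$$ **Theorem.** Assume that the system (3) has a smooth solution $S_i,\varphi_{i1}$ on $\mathbb R$ with $S_i\to0$ as $\tau\to\pm\infty$, $\varphi_{i1}\to0$ as $\tau\to-\infty$, $\varphi_{i1}\to\varphi_{i1}^\infty=\mathrm{const}$ as $\tau\to+\infty$, the limits being attained rapidly ($S_i'$ and $\varphi_{i1}'$ decay faster than every power of $|\tau|$). Then, for every $T>0$, the function (2) is a weak asymptotic mod $O_{\mathcal D'}(\varepsilon^2)$ solution of (1) on $(0,T)$, and it has the initial data $\sum_iA_i\omega_i(\beta(x-x_i^0)/\varepsilon)$ up to $O(\varepsilon^2)$, uniformly in $x$ (hence also in the sense of $O_{\mathcal D'}(\varepsilon^2)$). The collision is elastic: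 for each $\delta>0$, up to $O(\varepsilon^2)$ uniformly in $x$ and $t$, the function (2) equals $\sum_iA_i\omega_i(\beta(x-\varphi_{i0}(t))/\varepsilon)$ for $0\le t\le t^*-\delta$, $t\le T$, and $\sum_iA_i\omega_i(\beta(x-\varphi_{i0}(t)-\varepsilon\varphi_{i1}^\infty)/\varepsilon)$ for $t^*+\delta\le t\le T$. -/

import Mathlib

open Set Filter Topology MeasureTheory
open scoped ContDiff

noncomputable section

namespace DP

/-! ### The model and its solitary waves -/

/-- The real coefficients of the general Degasperis-Procesi equation
`∂ₜ(u - α²ε²uₓₓ) + ∂ₓ(c₀u + c₁u² - c₂ε²uₓ² + ε²(γ - c₃u)uₓₓ) = 0`. -/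
structure Params where
  α : ℝ
  γ : ℝ
  c0 : ℝ
  c1 : ℝ
  c2 : ℝ
  c3 : ℝ

/-- Sign conditions on the coefficients. -/
def Params.Admissible (P : Params) : Prop :=
  0 ≤ P.γ ∧ 0 ≤ P.c0 ∧ 0 < P.α ∧ 0 < P.c1 ∧ 0 < P.c2 ∧ 0 < P.c3

/-- `β = √(c₁ / c₃)`. -/
def Params.β (P : Params) : ℝ := Real.sqrt (P.c1 / P.c3)

/-- `r = c₃ / (c₂ + c₃)`. -/
def Params.r (P : Params) : ℝ := P.c3 / (P.c2 + P.c3)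

/-- `q = c₃ (V - c₀) / (c₁ (γ + α² V))`. -/
def Params.q (P : Params) (V : ℝ) : ℝ := P.c3 * (V - P.c0) / (P.c1 * (P.γ + P.α ^ 2 * V))

/-- The potential
`F(g) = g² - 2 (2-q)/(2-r) g^(2-r) + (1-q)/(1-r) g^(2-2r) - C`, with `C` such that `F(1) = 0`. -/
def Params.potential (P : Params) (V g : ℝ) : ℝ :=
  g ^ 2 - 2 * ((2 - P.q V) / (2 - P.r)) * g ^ (2 - P.r)
    + (1 - P.q V) / (1 - P.r) * g ^ (2 - 2 * P.r)
    - (1 - 2 * ((2 - P.q V) / (2 - P.r)) + (1 - P.q V) / (1 - P.r))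

/-- The relation between the amplitude `A`, the velocity `V` and the root `g ∈ (0,1)` of the
potential: `F(g) = 0` and `V = (c₃ A / (1 - g^r) - γ) / α²`. -/
def Params.IsVelocity (P : Params) (A V g : ℝ) : Prop :=
  g ∈ Ioo (0 : ℝ) 1 ∧ P.potential V g = 0 ∧
    V = 1 / P.α ^ 2 * (P.c3 / (1 - g ^ P.r) * A - P.γ)

/-- The criterion of existence of a smooth solitary wave of amplitude `A`. -/
def Params.SolitonCriterion (P : Params) (A g : ℝ) : Prop :=
  P.c3 - A⁻¹ * (P.γ + P.c0 * P.α ^ 2) * (1 - g ^ P.r) < P.c1 * P.r * P.α ^ 2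

/-- `w` is the profile of the soliton `A w(β (x - V t) / ε)` of amplitude `A` and velocity `V`:
smooth, even, vanishing at infinity, `w(0) = 1`, and a solution of the profile equation. -/
structure Params.IsProfile (P : Params) (A V : ℝ) (w : ℝ → ℝ) : Prop where
  smooth : ContDiff ℝ ∞ w
  even : ∀ η, w (-η) = w η
  top : Tendsto w atTop (𝓝 0)
  bot : Tendsto w atBot (𝓝 0)
  zero : w 0 = 1
  ode : ∀ η, (1 - P.c3 * A / (P.γ + P.α ^ 2 * V) * w η) * deriv (deriv w) η =
    P.c2 * A / (P.γ + P.α ^ 2 * V) * deriv w η ^ 2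
      + 1 / (P.β ^ 2 * (P.γ + P.α ^ 2 * V)) * ((V - P.c0) * w η - P.c1 * A * w η ^ 2)

/-! ### Densities of the conservation law and of the balance law

The arguments of the densities are the values `u` and `w = ε uₓ`. -/

/-- `c₀u + c₁u² - (c₂ - c₃)(εuₓ)²` -/
def Params.p1 (P : Params) (u w : ℝ) : ℝ := P.c0 * u + P.c1 * u ^ 2 - (P.c2 - P.c3) * w ^ 2

/-- `u² + α²(εuₓ)²` -/
def Params.q2 (P : Params) (u w : ℝ) : ℝ := u ^ 2 + P.α ^ 2 * w ^ 2

/-- `c₀u² + (4/3)c₁u³ - (3γ + (2c₂ - 5c₃)u)(εuₓ)²` -/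
def Params.pp2 (P : Params) (u w : ℝ) : ℝ :=
  P.c0 * u ^ 2 + 4 / 3 * P.c1 * u ^ 3 - (3 * P.γ + (2 * P.c2 - 5 * P.c3) * u) * w ^ 2

/-- `(2c₂ - c₃)(εuₓ)³` -/
def Params.k2 (P : Params) (_u w : ℝ) : ℝ := (2 * P.c2 - P.c3) * w ^ 3

/-! ### Weak asymptotic solutions

A family `u ε t x` depends on the small parameter `ε > 0`, on `t ∈ (0,T)` and on `x ∈ ℝ`. -/

/-- Real test functions on the line. -/
def IsTest (ψ : ℝ → ℝ) : Prop := ContDiff ℝ ∞ ψ ∧ HasCompactSupport ψ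

/-- `f ε t` is piecewise continuous in `t ∈ (0,T)`, uniformly in `ε ∈ (0,ε₀]`: away from finitely
many points that do not depend on `ε`, the family is equicontinuous. -/
def PiecewiseContUnif (T ε₀ : ℝ) (f : ℝ → ℝ → ℝ) : Prop :=
  ∃ B : Finset ℝ, ∀ δ > 0, ∃ h > 0, ∀ ε ∈ Ioc 0 ε₀, ∀ t ∈ Ioo 0 T, ∀ t' ∈ Ioo 0 T,
    |t - t'| < h → (∀ b ∈ B, b ∉ uIcc t t') → |f ε t - f ε t'| < δ

/-- `v` is of the value `O_{D'}(ε^κ)`, uniformly in `t ∈ (0,T)`. -/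
def IsOD (T κ : ℝ) (v : ℝ → ℝ → ℝ → ℝ) : Prop :=
  ∀ ψ, IsTest ψ →
    (∀ ε > 0, ContDiffOn ℝ ∞ (fun t => ∫ x, v ε t x * ψ x) (Ioo 0 T)) ∧
    ∃ ε₀ > 0,
      (∃ C, ∀ ε ∈ Ioc 0 ε₀, ∀ t ∈ Ioo 0 T, |∫ x, v ε t x * ψ x| ≤ C * ε ^ κ) ∧
      PiecewiseContUnif T ε₀ (fun ε t => ∫ x, v ε t x * ψ x)

/-- `u` belongs to `C(0,T; D'(ℝ))` uniformly in `ε ≥ 0`: all pairings with test functions are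
continuous in `t` uniformly in `ε`, and converge as `ε → 0`, uniformly in `t`. -/
def ContInDistribUnif (T : ℝ) (u : ℝ → ℝ → ℝ → ℝ) : Prop :=
  ∀ ψ, IsTest ψ → ∃ ε₀ > 0,
    (∀ t ∈ Ioo 0 T, ∀ δ > 0, ∃ h > 0, ∀ ε ∈ Ioc 0 ε₀, ∀ t' ∈ Ioo 0 T,
      |t - t'| < h → |(∫ x, u ε t x * ψ x) - ∫ x, u ε t' x * ψ x| < δ) ∧
    ∃ l : ℝ → ℝ,
      TendstoUniformlyOn (fun ε t => ∫ x, u ε t x * ψ x) l (𝓝[>] 0) (Ioo 0 T)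

/-- `uₓ` for a function `u t x` -/
def dx (u : ℝ → ℝ → ℝ) (t x : ℝ) : ℝ := deriv (fun y => u t y) x

/-- `uₜ` for a function `u t x` -/
def dt (u : ℝ → ℝ → ℝ) (t x : ℝ) : ℝ := deriv (fun s => u s x) t

/-- Left-hand side `∂ₜQ₁ + ∂ₓP₁` of the conservation law, `Q₁ = u`,
`P₁ = c₀u + c₁u² - (c₂ - c₃)(εuₓ)²`. -/
def Params.law1 (P : Params) (ε : ℝ) (u : ℝ → ℝ → ℝ) : ℝ → ℝ → ℝ := fun t x =>
  dt u t x + dx (fun t x => P.p1 (u t x) (ε * dx u t x)) t x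

/-- Left-hand side `∂ₜQ₂ + ∂ₓP₂ + ε⁻¹K₂` of the balance law, `Q₂ = u² + α²(εuₓ)²`,
`P₂ = c₀u² + (4/3)c₁u³ - (3γ + (2c₂ - 5c₃)u)(εuₓ)² + 2α²ε²uₓuₜ`, `K₂ = (2c₂ - c₃)(εuₓ)³`. -/
def Params.law2 (P : Params) (ε : ℝ) (u : ℝ → ℝ → ℝ) : ℝ → ℝ → ℝ := fun t x =>
  dt (fun t x => P.q2 (u t x) (ε * dx u t x)) t x
    + dx (fun t x => P.pp2 (u t x) (ε * dx u t x)
        + 2 * P.α ^ 2 * ε ^ 2 * dx u t x * dt u t x) t x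
    + ε⁻¹ * P.k2 (u t x) (ε * dx u t x)

/-- `u` is a weak asymptotic mod `O_{D'}(ε²)` solution of the model on `(0,T)`. -/
structure Params.IsWeakAsymptoticSolution (P : Params) (T : ℝ) (u : ℝ → ℝ → ℝ → ℝ) : Prop where
  smooth : ∀ ε > 0, ContDiffOn ℝ ∞ (fun z : ℝ × ℝ => u ε z.1 z.2) (Ioo 0 T ×ˢ univ)
  cont : ContInDistribUnif T u
  law1 : IsOD T 2 (fun ε t x => P.law1 ε (u ε) t x)
  law2 : IsOD T 2 (fun ε t x => P.law2 ε (u ε) t x)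

/-! ### The two-soliton ansatz

The index `0` is the first soliton, the index `1` is the second one. -/

/-- Amplitudes, velocities, initial positions and profiles of two solitons. -/
structure Pair where
  A : Fin 2 → ℝ
  V : Fin 2 → ℝ
  x0 : Fin 2 → ℝ
  w : Fin 2 → ℝ → ℝ

/-- The interaction corrections `Sᵢ(τ)` of the amplitudes and `φᵢ₁(τ)` of the phases. -/
structure Corr where
  S : Fin 2 → ℝ → ℝ
  φ : Fin 2 → ℝ → ℝ

/-- Trajectory `φᵢ₀(t) = Vᵢ t + xᵢ⁰` of the noninteracting wave. -/
def Pair.traj (D : Pair) (i : Fin 2) (t : ℝ) : ℝ := D.V i * t + D.x0 i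

/-- Fast time `τ = β (φ₂₀(t) - φ₁₀(t)) / ε`. -/
def Pair.tau (D : Pair) (P : Params) (ε t : ℝ) : ℝ := P.β * (D.traj 1 t - D.traj 0 t) / ε

/-- The sum of two solitons without interaction, with the phases shifted by `ε sᵢ`. -/
def Pair.free (D : Pair) (P : Params) (s : Fin 2 → ℝ) (ε t x : ℝ) : ℝ :=
  ∑ i, D.A i * D.w i (P.β * (x - (D.traj i t + ε * s i)) / ε)

/-- The initial data `∑ Aᵢ wᵢ(β (x - xᵢ⁰) / ε)`. -/
def Pair.initial (D : Pair) (P : Params) (ε x : ℝ) : ℝ :=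
  ∑ i, D.A i * D.w i (P.β * (x - D.x0 i) / ε)

/-- The ansatz `u = ∑ Gᵢ wᵢ(β (x - φᵢ) / ε)`, `Gᵢ = Aᵢ + Sᵢ(τ)`, `φᵢ = φᵢ₀(t) + ε φᵢ₁(τ)`. -/
def Pair.ansatz (D : Pair) (P : Params) (c : Corr) (ε t x : ℝ) : ℝ :=
  ∑ i, (D.A i + c.S i (D.tau P ε t)) *
    D.w i (P.β * (x - (D.traj i t + ε * c.φ i (D.tau P ε t))) / ε)

/-! ### The system for the interaction corrections -/

/-- `ψ̇₀ = β (V₂ - V₁)`, so that `dτ/dt = ψ̇₀ / ε`. -/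
def Pair.psiDot (D : Pair) (P : Params) : ℝ := P.β * (D.V 1 - D.V 0)

/-- `Gᵢ(τ) = Aᵢ + Sᵢ(τ)` -/
def Pair.G (D : Pair) (c : Corr) (i : Fin 2) (τ : ℝ) : ℝ := D.A i + c.S i τ

/-- `χᵢ(τ) = Vᵢ τ / ψ̇₀ + φᵢ₁(τ)`, so that `φᵢ = x* + ε χᵢ`. -/
def Pair.χ (D : Pair) (P : Params) (c : Corr) (i : Fin 2) (τ : ℝ) : ℝ :=
  D.V i * τ / D.psiDot P + c.φ i τ

/-- `σ = β (φ₁ - φ₂) / ε = β (χ₁ - χ₂)` -/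
def Pair.σ (D : Pair) (P : Params) (c : Corr) (τ : ℝ) : ℝ :=
  P.β * (D.χ P c 0 τ - D.χ P c 1 τ)

/-- `φ̇ᵢ = dφᵢ/dt = Vᵢ + ψ̇₀ dφᵢ₁/dτ` -/
def Pair.phiDot (D : Pair) (P : Params) (c : Corr) (i : Fin 2) (τ : ℝ) : ℝ :=
  D.V i + D.psiDot P * deriv (c.φ i) τ

/-- `η₁₂ = η - σ`, `η₂₂ = η` -/
def Pair.arg (D : Pair) (P : Params) (c : Corr) (τ η : ℝ) (i : Fin 2) : ℝ :=
  if i = 0 then η - D.σ P c τ else η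

/-- `a_{1,i} = ∫ wᵢ dη` -/
def Pair.a1 (D : Pair) (i : Fin 2) : ℝ := ∫ η, D.w i η

/-- `a'_{2,i} = ∫ (wᵢ')² dη` -/
def Pair.a2' (D : Pair) (i : Fin 2) : ℝ := ∫ η, deriv (D.w i) η ^ 2

/-- `a_{F,i} = ∫ F(Aᵢ wᵢ, β Aᵢ wᵢ') dη` -/
def Pair.a (D : Pair) (P : Params) (F : ℝ → ℝ → ℝ) (i : Fin 2) : ℝ :=
  ∫ η, F (D.A i * D.w i η) (P.β * (D.A i * deriv (D.w i) η))

/-- `R_F^{(n)}(τ) = ∫ ηⁿ {F(∑ Gᵢwᵢ(ηᵢ₂), β ∑ Gⱼwⱼ'(ηⱼ₂)) - ∑ F(Aᵢwᵢ(ηᵢ₂), β Aᵢwᵢ'(ηᵢ₂))} dη` -/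
def Pair.R (D : Pair) (P : Params) (c : Corr) (F : ℝ → ℝ → ℝ) (n : ℕ) (τ : ℝ) : ℝ :=
  ∫ η, η ^ n *
    (F (∑ i, D.G c i τ * D.w i (D.arg P c τ η i))
        (P.β * ∑ j, D.G c j τ * deriv (D.w j) (D.arg P c τ η j))
      - ∑ i, F (D.A i * D.w i (D.arg P c τ η i))
          (P.β * (D.A i * deriv (D.w i) (D.arg P c τ η i))))

/-- `Λ₁₀(τ) = ∫ w₁'(η - σ) w₂(η) dη` -/
def Pair.Λ10 (D : Pair) (P : Params) (c : Corr) (τ : ℝ) : ℝ :=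
  ∫ η, deriv (D.w 0) (η - D.σ P c τ) * D.w 1 η

/-- `Λ₁₁(τ) = ∫ w₁'(η - σ) w₂'(η) dη` -/
def Pair.Λ11 (D : Pair) (P : Params) (c : Corr) (τ : ℝ) : ℝ :=
  ∫ η, deriv (D.w 0) (η - D.σ P c τ) * deriv (D.w 1) η

/-- The interaction term of `uₓuₜ`, in the weak expansion
`ε² uₓuₜ = -εβ ∑ a'_{2,i} Vᵢ Aᵢ² δ(x - φᵢ) - ε L δ(x - x*)` with an error that is small
in the weak sense. -/
def Pair.L (D : Pair) (P : Params) (c : Corr) (τ : ℝ) : ℝ :=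
  P.β * ∑ i, D.a2' i * (D.G c i τ ^ 2 * D.phiDot P c i τ - D.A i ^ 2 * D.V i)
    - D.psiDot P * (D.G c 0 τ * deriv (c.S 1) τ - D.G c 1 τ * deriv (c.S 0) τ) * D.Λ10 P c τ
    + P.β * D.G c 0 τ * D.G c 1 τ * (D.phiDot P c 0 τ + D.phiDot P c 1 τ) * D.Λ11 P c τ

/-- The system of equations for the interaction corrections. -/
structure Pair.SolvesSystem (D : Pair) (P : Params) (c : Corr) : Prop where
  mass : ∀ τ, ∑ i, D.a1 i * c.S i τ = 0
  energy : ∀ τ, D.psiDot P * deriv (D.R P c P.q2 0) τ + D.R P c P.k2 0 τ = 0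
  phase1 : ∀ τ,
    D.psiDot P * deriv (fun s => ∑ i, D.a1 i * (D.A i * c.φ i s + D.χ P c i s * c.S i s)) τ
      = D.R P c P.p1 0 τ
  phase2 : ∀ τ,
    D.psiDot P * deriv (fun s => (∑ i, D.a P P.q2 i * c.φ i s)
        + D.χ P c 1 s * D.R P c P.q2 0 s + (P.β)⁻¹ * D.R P c P.q2 1 s) τ
      = D.R P c P.pp2 0 τ - 2 * P.α ^ 2 * P.β * D.L P c τ
        - D.χ P c 1 τ * D.R P c P.k2 0 τ - (P.β)⁻¹ * D.R P c P.k2 1 τ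

/-- `f` decays at infinity faster than every power. -/
def RapidDecay (f : ℝ → ℝ) : Prop := ∀ n : ℕ, ∃ C, ∀ τ, |τ| ^ n * |f τ| ≤ C

/-- Smoothness and behaviour at infinity of the corrections: `Sᵢ → 0` as `τ → ±∞`, `φᵢ₁ → 0` as
`τ → -∞`, `φᵢ₁ → φᵢ₁^∞` as `τ → +∞`, the limits being attained rapidly. -/
structure Corr.HasLimits (c : Corr) (φlim : Fin 2 → ℝ) : Prop where
  smooth_S : ∀ i, ContDiff ℝ ∞ (c.S i)
  smooth_φ : ∀ i, ContDiff ℝ ∞ (c.φ i)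
  S_bot : ∀ i, Tendsto (c.S i) atBot (𝓝 0)
  S_top : ∀ i, Tendsto (c.S i) atTop (𝓝 0)
  φ_bot : ∀ i, Tendsto (c.φ i) atBot (𝓝 0)
  φ_top : ∀ i, Tendsto (c.φ i) atTop (𝓝 (φlim i))
  rapid_S : ∀ i, RapidDecay (deriv (c.S i))
  rapid_φ : ∀ i, RapidDecay (deriv (c.φ i))

/-- Elastic scenario on `[0,T]` with the collision at the instant `t*`: outside every neighbourhood
of `t*`, `u` is, up to `O(ε²)` uniformly in `t` and `x`, the sum of the two given solitons, with
unchanged amplitudes, profiles and velocities, before the collision with the given phases and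
after the collision with the phases shifted by the constants `ε φᵢ₁^∞`. -/
def Pair.Elastic (D : Pair) (P : Params) (T tstar : ℝ) (φlim : Fin 2 → ℝ)
    (u : ℝ → ℝ → ℝ → ℝ) : Prop :=
  ∀ δ > 0, ∃ C, ∃ ε₀ > 0, ∀ ε ∈ Ioc 0 ε₀, ∀ t ∈ Icc 0 T, ∀ x,
    (t ≤ tstar - δ → |u ε t x - D.free P 0 ε t x| ≤ C * ε ^ 2) ∧
    (tstar + δ ≤ t → |u ε t x - D.free P φlim ε t x| ≤ C * ε ^ 2)

end DP

end

/-!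
In the fast variables `τ` and `ζ = β (x - x*) / ε` the ansatz does not depend on `ε`, and `ε` times
the left-hand side of each law becomes a function `f(τ, ζ) = l₁(ζ - β χ₁) + l₂(ζ - β χ₂) + r(τ, ζ)`,
where `lᵢ` belongs to the `i`-th soliton alone. The interaction `r` decays rapidly in both
variables, because the two centres `β χᵢ(τ)` move apart linearly in `|τ|`. Integrating the profile
equation shows that the moments of `lᵢ` of orders `0` and `1` vanish, and system (3) says precisely
that the same moments of `f` vanish, hence those of `r`. In the Taylor expansion of a test function
around the centre of each wave, and around `x*` for `r`, the terms of orders `0` and `1` thus drop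
out, and the remainder is `O(ε²)`. Away from the collision `|τ|` is of order `1 / ε`, so the rapid
limits of the corrections make the ansatz `O(ε²)`-close to a sum of free solitons.
-/

noncomputable section

namespace DP

/-! ### Rapid decay with respect to a weight -/

section Decay

variable {X Y : Type*} {ρ ρ₁ ρ₂ σ f g : X → ℝ}

/-- `f` decays faster than every power of the weight `ρ`. The weight `id` on `ℝ` gives
`RapidDecay`; the weights `ζ - c τ` and `ζ` on the plane of the fast variables `(τ, ζ)` describe
waves travelling along `c` and interactions of waves. -/
def DecaysIn (ρ f : X → ℝ) : Prop := ∀ n : ℕ, ∃ C, ∀ z, |ρ z| ^ n * |f z| ≤ C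

/-- The weight `ρ` is bounded by a power of the product of `1 + |ρ₁|` and `1 + |ρ₂|`. This makes
the product of a function decaying in `ρ₁` and a function decaying in `ρ₂` decay in `ρ`. -/
def PolyDominated (ρ ρ₁ ρ₂ : X → ℝ) : Prop :=
  ∃ K, ∃ m : ℕ, ∀ z, |ρ z| ≤ K * ((1 + |ρ₁ z|) * (1 + |ρ₂ z|)) ^ m

lemma DecaysIn.bounded (hf : DecaysIn ρ f) : ∃ C, ∀ z, |f z| ≤ C := by
  simpa using hf 0

lemma DecaysIn.one_add_pow (hf : DecaysIn ρ f) (n : ℕ) :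
    ∃ C, ∀ z, (1 + |ρ z|) ^ n * |f z| ≤ C := by
  obtain ⟨C, hC⟩ := hf 0
  obtain ⟨D, hD⟩ := hf n
  refine ⟨2 ^ (n - 1) * (C + D), fun z => ?_⟩
  calc (1 + |ρ z|) ^ n * |f z| ≤ 2 ^ (n - 1) * (1 ^ n + |ρ z| ^ n) * |f z| := by
        gcongr
        exact add_pow_le zero_le_one (abs_nonneg _) n
    _ = 2 ^ (n - 1) * (|ρ z| ^ 0 * |f z| + |ρ z| ^ n * |f z|) := by ring
    _ ≤ 2 ^ (n - 1) * (C + D) := by gcongr; exacts [hC z, hD z]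

lemma DecaysIn.comp (hf : DecaysIn ρ f) (e : Y → X) :
    DecaysIn (fun y => ρ (e y)) (fun y => f (e y)) :=
  fun n => (hf n).imp fun _ hC y => hC (e y)

lemma DecaysIn.add (hf : DecaysIn ρ f) (hg : DecaysIn ρ g) :
    DecaysIn ρ (fun z => f z + g z) := by
  intro n
  obtain ⟨C, hC⟩ := hf n
  obtain ⟨D, hD⟩ := hg n
  refine ⟨C + D, fun z => ?_⟩
  calc |ρ z| ^ n * |f z + g z| ≤ |ρ z| ^ n * (|f z| + |g z|) := by
        gcongr
        exact abs_add_le _ _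
    _ ≤ C + D := by rw [mul_add]; exact add_le_add (hC z) (hD z)

lemma DecaysIn.bdd_mul (hg : DecaysIn ρ g) (hf : ∃ C, ∀ z, |f z| ≤ C) :
    DecaysIn ρ (fun z => f z * g z) := by
  intro n
  obtain ⟨C, hC⟩ := hf
  obtain ⟨D, hD⟩ := hg n
  refine ⟨C * D, fun z => ?_⟩
  calc |ρ z| ^ n * |f z * g z| = |f z| * (|ρ z| ^ n * |g z|) := by rw [abs_mul]; ring
    _ ≤ C * D := mul_le_mul (hC z) (hD z) (by positivity) ((abs_nonneg _).trans (hC z))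

lemma DecaysIn.mul (hf : DecaysIn ρ f) (hg : DecaysIn ρ g) : DecaysIn ρ (fun z => f z * g z) :=
  hg.bdd_mul hf.bounded

lemma DecaysIn.const_mul (hf : DecaysIn ρ f) (k : ℝ) : DecaysIn ρ (fun z => k * f z) :=
  hf.bdd_mul ⟨|k|, fun _ => le_rfl⟩

lemma DecaysIn.sub (hf : DecaysIn ρ f) (hg : DecaysIn ρ g) :
    DecaysIn ρ (fun z => f z - g z) := by
  simpa [sub_eq_add_neg] using hf.add (hg.const_mul (-1))

lemma DecaysIn.pow_succ (hf : DecaysIn ρ f) (n : ℕ) : DecaysIn ρ (fun z => f z ^ (n + 1)) := by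
  induction n with
  | zero => simpa using hf
  | succ n ih => exact ih.mul hf

lemma DecaysIn.mul_of_polyDominated (hf : DecaysIn ρ₁ f) (hg : DecaysIn ρ₂ g)
    (h : PolyDominated ρ ρ₁ ρ₂) : DecaysIn ρ (fun z => f z * g z) := by
  intro n
  obtain ⟨K, m, hK⟩ := h
  obtain ⟨C, hC⟩ := hf.one_add_pow (m * n)
  obtain ⟨D, hD⟩ := hg.one_add_pow (m * n)
  refine ⟨|K| ^ n * (C * D), fun z => ?_⟩
  have hρ : |ρ z| ≤ |K| * ((1 + |ρ₁ z|) * (1 + |ρ₂ z|)) ^ m :=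
    (hK z).trans (by gcongr; exact le_abs_self K)
  calc |ρ z| ^ n * |f z * g z|
      ≤ (|K| * ((1 + |ρ₁ z|) * (1 + |ρ₂ z|)) ^ m) ^ n * |f z * g z| := by gcongr
    _ = |K| ^ n * ((1 + |ρ₁ z|) ^ (m * n) * |f z| * ((1 + |ρ₂ z|) ^ (m * n) * |g z|)) := by
        rw [abs_mul, mul_pow, ← pow_mul, mul_pow]; ring
    _ ≤ |K| ^ n * (C * D) := by
        gcongr
        · exact (by positivity : (0 : ℝ) ≤ _).trans (hC z)
        · exact hC z
        · exact hD z

lemma DecaysIn.exists_growth_le (hf : DecaysIn ρ₁ f) {K : ℝ}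
    (h : ∀ z, |ρ z| ≤ K * (1 + |σ z|) * (1 + |ρ₁ z|)) (n : ℕ) :
    ∃ C, ∀ z, |ρ z| ^ n * |f z| ≤ C * (1 + |σ z|) ^ n := by
  obtain ⟨C, hC⟩ := hf.one_add_pow n
  refine ⟨|K| ^ n * C, fun z => ?_⟩
  have hρ : |ρ z| ≤ |K| * (1 + |σ z|) * (1 + |ρ₁ z|) :=
    (h z).trans (by gcongr; exact le_abs_self K)
  calc |ρ z| ^ n * |f z| ≤ (|K| * (1 + |σ z|) * (1 + |ρ₁ z|)) ^ n * |f z| := by gcongr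
    _ = |K| ^ n * (1 + |σ z|) ^ n * ((1 + |ρ₁ z|) ^ n * |f z|) := by
        rw [mul_pow, mul_pow]; ring
    _ ≤ |K| ^ n * (1 + |σ z|) ^ n * C := by gcongr; exact hC z
    _ = |K| ^ n * C * (1 + |σ z|) ^ n := by ring

lemma DecaysIn.exists_abs_pow_mul_le (hf : DecaysIn ρ f) (n : ℕ) :
    ∃ C, ∀ z, |ρ z ^ n * f z| ≤ C * (1 + ρ z ^ 2)⁻¹ := by
  obtain ⟨C, hC⟩ := hf n
  obtain ⟨D, hD⟩ := hf (n + 2)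
  refine ⟨C + D, fun z => ?_⟩
  rw [← div_eq_mul_inv, le_div_iff₀ (by positivity), abs_mul, abs_pow]
  calc |ρ z| ^ n * |f z| * (1 + ρ z ^ 2) = |ρ z| ^ n * |f z| + |ρ z| ^ (n + 2) * |f z| := by
        rw [← sq_abs (ρ z)]; ring
    _ ≤ C + D := add_le_add (hC z) (hD z)

lemma DecaysIn.integrable_pow_mul {f : ℝ → ℝ} (hf : DecaysIn id f) (hc : Continuous f) (n : ℕ) :
    Integrable fun ζ => ζ ^ n * f ζ := by
  obtain ⟨C, hC⟩ := hf.exists_abs_pow_mul_le n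
  exact (integrable_inv_one_add_sq.const_mul C).mono' (by fun_prop) (ae_of_all _ hC)

lemma DecaysIn.integrable {f : ℝ → ℝ} (hf : DecaysIn id f) (hc : Continuous f) :
    Integrable f := by
  simpa using hf.integrable_pow_mul hc 0

lemma DecaysIn.section_right {f : ℝ × ℝ → ℝ} (hf : DecaysIn Prod.snd f) (τ : ℝ) :
    DecaysIn id fun ζ => f (τ, ζ) := hf.comp (Prod.mk τ)

lemma DecaysIn.exists_integral_abs_le {f : ℝ × ℝ → ℝ} (hf : DecaysIn Prod.snd f)
    (hc : ∀ τ, Continuous fun ζ => f (τ, ζ)) (n : ℕ) :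
    ∃ C, ∀ τ, ∫ ζ, |ζ ^ n * f (τ, ζ)| ≤ C := by
  obtain ⟨C, hC⟩ := hf.exists_abs_pow_mul_le n
  exact ⟨∫ ζ : ℝ, C * (1 + ζ ^ 2)⁻¹, fun τ => integral_mono
    ((hf.section_right τ).integrable_pow_mul (hc τ) n).abs
    (integrable_inv_one_add_sq.const_mul C) fun ζ => hC (τ, ζ)⟩

end Decay

/-! ### Sums of two waves up to an interaction -/

section Split

variable {X : Type*} {ρ₁ ρ₂ ρ σ f g a b a' b' : X → ℝ}

/-- `f` is the sum of two waves `a` and `b`, decaying in the weights `ρ₁` and `ρ₂`, up to an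
interaction, which decays in the weight `ρ`. -/
structure Split (ρ₁ ρ₂ ρ f a b : X → ℝ) : Prop where
  left : DecaysIn ρ₁ a
  right : DecaysIn ρ₂ b
  rest : DecaysIn ρ fun z => f z - a z - b z

lemma Split.bounded (hf : Split ρ₁ ρ₂ ρ f a b) : ∃ C, ∀ z, |f z| ≤ C := by
  obtain ⟨A, hA⟩ := hf.left.bounded
  obtain ⟨B, hB⟩ := hf.right.bounded
  obtain ⟨C, hC⟩ := hf.rest.bounded
  refine ⟨A + B + C, fun z => ?_⟩
  calc |f z| = |a z + b z + (f z - a z - b z)| := by ring_nf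
    _ ≤ |a z| + |b z| + |f z - a z - b z| := abs_add_three _ _ _
    _ ≤ A + B + C := by gcongr; exacts [hA z, hB z, hC z]

lemma Split.add (hf : Split ρ₁ ρ₂ ρ f a b) (hg : Split ρ₁ ρ₂ ρ g a' b') :
    Split ρ₁ ρ₂ ρ (fun z => f z + g z) (fun z => a z + a' z) (fun z => b z + b' z) := by
  refine ⟨hf.left.add hg.left, hf.right.add hg.right, ?_⟩
  convert hf.rest.add hg.rest using 2
  ring

lemma Split.const_mul (hf : Split ρ₁ ρ₂ ρ f a b) (k : ℝ) :
    Split ρ₁ ρ₂ ρ (fun z => k * f z) (fun z => k * a z) (fun z => k * b z) := by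
  refine ⟨hf.left.const_mul k, hf.right.const_mul k, ?_⟩
  convert hf.rest.const_mul k using 2
  ring

lemma Split.mul (h : PolyDominated ρ ρ₁ ρ₂) (hf : Split ρ₁ ρ₂ ρ f a b)
    (hg : Split ρ₁ ρ₂ ρ g a' b') :
    Split ρ₁ ρ₂ ρ (fun z => f z * g z) (fun z => a z * a' z) (fun z => b z * b' z) := by
  refine ⟨hf.left.mul hg.left, hf.right.mul hg.right, ?_⟩
  have cross := (hf.left.mul_of_polyDominated hg.right h).add
    (hg.left.mul_of_polyDominated hf.right h)
  have rests := (hf.rest.bdd_mul hg.bounded).add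
    ((hg.rest.bdd_mul hf.left.bounded).add (hg.rest.bdd_mul hf.right.bounded))
  convert cross.add rests using 2
  ring

lemma Split.exists_growth_le (hf : Split ρ₁ ρ₂ ρ f a b) {K₁ K₂ : ℝ}
    (h₁ : ∀ z, |ρ z| ≤ K₁ * (1 + |σ z|) * (1 + |ρ₁ z|))
    (h₂ : ∀ z, |ρ z| ≤ K₂ * (1 + |σ z|) * (1 + |ρ₂ z|)) (n : ℕ) :
    ∃ C, ∀ z, |ρ z| ^ n * |f z| ≤ C * (1 + |σ z|) ^ n := by
  obtain ⟨A, hA⟩ := hf.left.exists_growth_le h₁ n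
  obtain ⟨B, hB⟩ := hf.right.exists_growth_le h₂ n
  obtain ⟨C, hC⟩ := hf.rest n
  refine ⟨A + B + |C|, fun z => ?_⟩
  have hσ : |C| ≤ |C| * (1 + |σ z|) ^ n :=
    le_mul_of_one_le_right (abs_nonneg C) (one_le_pow₀ (by linarith [abs_nonneg (σ z)]))
  calc |ρ z| ^ n * |f z| = |ρ z| ^ n * |a z + b z + (f z - a z - b z)| := by ring_nf
    _ ≤ |ρ z| ^ n * (|a z| + |b z| + |f z - a z - b z|) := by
        gcongr
        exact abs_add_three _ _ _
    _ = |ρ z| ^ n * |a z| + |ρ z| ^ n * |b z| + |ρ z| ^ n * |f z - a z - b z| := by ring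
    _ ≤ A * (1 + |σ z|) ^ n + B * (1 + |σ z|) ^ n + |C| * (1 + |σ z|) ^ n := by
        exact add_le_add (add_le_add (hA z) (hB z)) ((hC z).trans ((le_abs_self C).trans hσ))
    _ = (A + B + |C|) * (1 + |σ z|) ^ n := by ring

end Split

/-! ### Trajectories that separate linearly -/

section Separating

variable {c c₁ c₂ : ℝ → ℝ}

/-- Two trajectories, in the fast variables, that grow at most linearly and separate linearly. -/
structure Separating (c₁ c₂ : ℝ → ℝ) : Prop where
  left : ∃ K, ∀ τ, 1 + |c₁ τ| ≤ K * (1 + |τ|)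
  right : ∃ K, ∀ τ, 1 + |c₂ τ| ≤ K * (1 + |τ|)
  sep : ∃ K, ∀ τ, |τ| ≤ K * (1 + |c₁ τ - c₂ τ|)

lemma one_add_abs_le_mul (x y : ℝ) : 1 + |x| ≤ (1 + |y|) * (1 + |x - y|) := by
  have h : |x| ≤ |y| + |x - y| := by simpa using abs_add_le y (x - y)
  nlinarith [mul_nonneg (abs_nonneg y) (abs_nonneg (x - y))]

lemma abs_le_of_linear_growth {K : ℝ} (hc : ∀ τ, 1 + |c τ| ≤ K * (1 + |τ|)) (z : ℝ × ℝ) :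
    |z.2| ≤ K * (1 + |z.1|) * (1 + |z.2 - c z.1|) :=
  calc |z.2| ≤ 1 + |z.2| := by linarith
    _ ≤ (1 + |c z.1|) * (1 + |z.2 - c z.1|) := one_add_abs_le_mul _ _
    _ ≤ K * (1 + |z.1|) * (1 + |z.2 - c z.1|) := by gcongr; exact hc z.1

lemma polyDominated_of_linear_growth (hc : ∃ K, ∀ τ, 1 + |c τ| ≤ K * (1 + |τ|)) :
    PolyDominated (X := ℝ × ℝ) Prod.snd Prod.fst (fun z => z.2 - c z.1) := by
  obtain ⟨K, hK⟩ := hc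
  exact ⟨K, 1, fun z => by simpa [mul_assoc] using abs_le_of_linear_growth hK z⟩

/-- With `x = 1 + |ζ - c₁|` and `y = 1 + |ζ - c₂|` one has `1 + |c₁ - c₂| ≤ x y`, hence
`|τ| ≲ x y` by separation and `|ζ| ≲ |τ| x ≲ x² y` by linear growth. -/
lemma Separating.polyDominated (h : Separating c₁ c₂) :
    PolyDominated (X := ℝ × ℝ) Prod.snd (fun z => z.2 - c₁ z.1) (fun z => z.2 - c₂ z.1) := by
  obtain ⟨K, hK⟩ := h.left
  obtain ⟨M, hM⟩ := h.sep
  have hK0 : 0 ≤ K := by have := hK 0; simp at this; linarith [abs_nonneg (c₁ 0)]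
  refine ⟨K * (1 + |M|), 2, fun z => ?_⟩
  set x := 1 + |z.2 - c₁ z.1|
  set y := 1 + |z.2 - c₂ z.1|
  have hx : 1 ≤ x := le_add_of_nonneg_right (abs_nonneg _)
  have hy : 1 ≤ y := le_add_of_nonneg_right (abs_nonneg _)
  have hsep : 1 + |c₁ z.1 - c₂ z.1| ≤ x * y := by
    have := one_add_abs_le_mul (c₁ z.1 - c₂ z.1) (z.2 - c₂ z.1)
    rwa [sub_sub_sub_cancel_right, abs_sub_comm (c₁ z.1) z.2, mul_comm] at this
  have hτ : 1 + |z.1| ≤ (1 + |M|) * (x * y) :=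
    calc 1 + |z.1| ≤ 1 + |M| * (1 + |c₁ z.1 - c₂ z.1|) := by
          gcongr
          exact (hM z.1).trans (by gcongr; exact le_abs_self M)
      _ ≤ x * y + |M| * (x * y) := by gcongr; nlinarith
      _ = (1 + |M|) * (x * y) := by ring
  calc |z.2| ≤ K * (1 + |z.1|) * x := abs_le_of_linear_growth hK z
    _ ≤ K * ((1 + |M|) * (x * y)) * x := by gcongr
    _ ≤ K * ((1 + |M|) * (x * y)) * (x * y) := by gcongr; nlinarith
    _ = K * (1 + |M|) * (x * y) ^ 2 := by ring

end Separating

/-! ### Exponential decay of the profile -/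

section ProfileDecay

open Asymptotics Real

variable {u : ℝ → ℝ} {k a m n μ N : ℝ}

lemma hasDerivAt_exp_neg_mul (μ x : ℝ) :
    HasDerivAt (fun x => exp (-μ * x)) (-μ * exp (-μ * x)) x := by
  simpa [mul_comm] using ((hasDerivAt_id x).const_mul (-μ)).exp

lemma deriv_deriv_nonpos_of_isLocalMax {z : ℝ → ℝ} {x : ℝ} (hz : IsLocalMax z x)
    (hc : ContinuousAt z x) : deriv (deriv z) x ≤ 0 := by
  by_contra! hpos
  have hmin := isLocalMin_of_deriv_deriv_pos hpos hz.deriv_eq_zero hc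
  have hconst : z =ᶠ[𝓝 x] fun _ => z x := by
    filter_upwards [hz, hmin] with y h₁ h₂ using le_antisymm h₁ h₂
  simp [hconst.deriv.deriv_eq] at hpos

lemma exists_isMaxOn_Ici_of_tendsto_zero {z : ℝ → ℝ} (hc : Continuous z)
    (hlim : Tendsto z atTop (𝓝 0)) {x : ℝ} (hx : N ≤ x) (hpos : 0 < z x) :
    ∃ y ∈ Ici N, IsMaxOn z (Ici N) y := by
  refine hc.continuousOn.exists_isMaxOn' isClosed_Ici (mem_Ici.2 hx) ?_
  rw [cocompact_eq_atBot_atTop, inf_sup_right, eventually_sup]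
  refine ⟨?_, (hlim.eventually (ge_mem_nhds hpos)).filter_mono inf_le_left⟩
  filter_upwards [mem_inf_of_left (Iio_mem_atBot N), mem_inf_of_right (mem_principal_self _)]
    with t ht ht'
  exact absurd (mem_Ici.1 ht') (not_le.2 ht)

lemma tendsto_exp_neg_mul_atTop (hμ : 0 < μ) : Tendsto (fun x => exp (-μ * x)) atTop (𝓝 0) :=
  tendsto_exp_atBot.comp (tendsto_id.const_mul_atTop_of_neg (neg_lt_zero.2 hμ))

/-- The difference of `u` and the barrier `|u N| exp (-μ (x - N))` cannot have a positive maximum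
inside the half-line: `u' = -μ |u N| exp (-μ (x - N))` there, so the hypothesis applies. -/
lemma le_exp_of_lt_deriv_deriv (hu : ContDiff ℝ 2 u) (hlim : Tendsto u atTop (𝓝 0)) (hμ : 0 < μ)
    (h : ∀ x > N, 0 < u x → |deriv u x| ≤ μ * u x → μ ^ 2 * u x < deriv (deriv u) x) {x : ℝ}
    (hx : N ≤ x) : u x ≤ |u N| * exp (μ * N) * exp (-μ * x) := by
  set B := |u N| * exp (μ * N)
  set z : ℝ → ℝ := fun x => u x - B * exp (-μ * x) with hz
  have hd : Differentiable ℝ u := hu.differentiable (by norm_num)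
  have hdd : Differentiable ℝ (deriv u) := (hu.deriv' (n := 1)).differentiable (by norm_num)
  have hz' : deriv z = fun x => deriv u x + μ * B * exp (-μ * x) := funext fun x =>
    (((hd x).hasDerivAt.sub ((hasDerivAt_exp_neg_mul μ x).const_mul B)).congr_deriv
      (by ring)).deriv
  have hz'' : ∀ x, deriv (deriv z) x = deriv (deriv u) x - μ ^ 2 * (B * exp (-μ * x)) := fun x => by
    rw [hz']
    exact (((hdd x).hasDerivAt.add ((hasDerivAt_exp_neg_mul μ x).const_mul (μ * B))).congr_deriv
      (by ring)).deriv
  have hzc : Continuous z := by have := hd.continuous; fun_prop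
  have hzlim : Tendsto z atTop (𝓝 0) := by
    simpa [hz] using hlim.sub ((tendsto_exp_neg_mul_atTop hμ).const_mul B)
  have hzN : z N ≤ 0 := by
    have : exp (μ * N) * exp (-μ * N) = 1 := by rw [← exp_add]; simp
    simp only [hz, B, mul_assoc, this, mul_one]
    linarith [le_abs_self (u N)]
  suffices z x ≤ 0 by simpa [hz] using this
  by_contra! hpos
  obtain ⟨y, hyN, hy⟩ := exists_isMaxOn_Ici_of_tendsto_zero hzc hzlim hx hpos
  have hypos : 0 < z y := hpos.trans_le (hy (mem_Ici.2 hx))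
  have hNy : N < y := lt_of_le_of_ne hyN fun e => by rw [← e] at hypos; linarith
  have hmax : IsLocalMax z y := hy.isLocalMax (Ici_mem_nhds hNy)
  have hcrit : deriv u y + μ * B * exp (-μ * y) = 0 := by rw [← hmax.deriv_eq_zero, hz']
  have hBy : 0 ≤ B * exp (-μ * y) := by positivity
  have huy : B * exp (-μ * y) < u y := sub_pos.1 hypos
  have hbarrier : |deriv u y| ≤ μ * u y := by
    rw [show deriv u y = -(μ * (B * exp (-μ * y))) by linarith, abs_neg,
      abs_of_nonneg (by positivity)]
    gcongr
  have hle := deriv_deriv_nonpos_of_isLocalMax hmax hzc.continuousAt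
  rw [hz''] at hle
  nlinarith [h y hNy (hBy.trans_lt huy) hbarrier, mul_lt_mul_of_pos_left huy (pow_pos hμ 2)]

/-- A solution of the profile equation `(1 - k u) u'' = a u'² + u (m - n u)` that vanishes at `+∞`.
No sign is prescribed to `k`, `a`, `n`, so that `u ↦ -u` is a symmetry of the class. -/
structure DecayingSolution (k a m n : ℝ) (u : ℝ → ℝ) : Prop where
  smooth : ContDiff ℝ 2 u
  top : Tendsto u atTop (𝓝 0)
  ode : ∀ x, (1 - k * u x) * deriv (deriv u) x = a * deriv u x ^ 2 + u x * (m - n * u x)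

lemma DecayingSolution.neg (hu : DecayingSolution k a m n u) :
    DecayingSolution (-k) (-a) m (-n) (-u) where
  smooth := hu.smooth.neg
  top := neg_zero (G := ℝ) ▸ hu.top.neg
  ode x := by
    have h' : deriv (-u) = -deriv u := deriv.neg'
    simp only [h', deriv.neg', Pi.neg_apply]
    linear_combination -hu.ode x

lemma DecayingSolution.tendsto_sub_mul (hu : DecayingSolution k a m n u) (c d : ℝ) :
    Tendsto (fun x => c - d * u x) atTop (𝓝 c) := by
  simpa using (hu.top.const_mul d).const_sub c

lemma DecayingSolution.eventually_lt_deriv_deriv (hu : DecayingSolution k a m n u)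
    (hμ : μ ^ 2 < m) :
    ∀ᶠ x in atTop, 0 < u x → |deriv u x| ≤ μ * u x → μ ^ 2 * u x < deriv (deriv u) x := by
  filter_upwards [(hu.tendsto_sub_mul 1 k).eventually (lt_mem_nhds one_pos),
    (hu.tendsto_sub_mul (m - μ ^ 2) (|a| * μ ^ 2 + n - k * μ ^ 2)).eventually
      (lt_mem_nhds (sub_pos.2 hμ))] with x hk hm hpos hslope
  have hsq : -(|a| * (μ * u x) ^ 2) ≤ a * deriv u x ^ 2 := by
    have h₁ : deriv u x ^ 2 ≤ (μ * u x) ^ 2 := sq_le_sq' (abs_le.1 hslope).1 (abs_le.1 hslope).2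
    nlinarith [neg_abs_le a, mul_le_mul_of_nonneg_left h₁ (abs_nonneg a), sq_nonneg (deriv u x)]
  have hprod : 0 < (1 - k * u x) * (deriv (deriv u) x - μ ^ 2 * u x) := by
    rw [mul_sub, hu.ode]
    nlinarith [mul_pos hpos hm]
  linarith [(pos_iff_pos_of_mul_pos hprod).1 hk]

lemma DecayingSolution.isBigO (hu : DecayingSolution k a m n u) (hμ : 0 < μ) (hm : μ ^ 2 < m) :
    u =O[atTop] fun x => exp (-μ * x) := by
  have upper : ∀ {k a n : ℝ} {u : ℝ → ℝ}, DecayingSolution k a m n u →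
      ∃ C, ∀ᶠ x in atTop, u x ≤ C * exp (-μ * x) := fun hu => by
    obtain ⟨N, hN⟩ := eventually_atTop.1 (hu.eventually_lt_deriv_deriv hm)
    exact ⟨_, (eventually_ge_atTop N).mono fun x hx =>
      le_exp_of_lt_deriv_deriv hu.smooth hu.top hμ (fun x hx => hN x hx.le) hx⟩
  obtain ⟨C, hC⟩ := upper hu
  obtain ⟨D, hD⟩ := upper hu.neg
  refine IsBigO.of_bound (max C D) ?_
  filter_upwards [hC, hD] with x h₁ h₂
  rw [norm_eq_abs, norm_eq_abs, abs_exp, abs_le]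
  have hE := exp_pos (-μ * x)
  exact ⟨by nlinarith [le_max_right C D, Pi.neg_apply u x], by nlinarith [le_max_left C D]⟩

lemma exp_neg_mul_add_isBigO (μ s : ℝ) :
    (fun x => exp (-μ * (x + s))) =O[atTop] fun x => exp (-μ * x) := by
  simpa only [mul_add, exp_add, mul_comm _ (exp (-μ * s))] using
    (isBigO_refl (fun x => exp (-μ * x)) atTop).const_mul_left (exp (-μ * s))

/-- The derivative of a convex function lies between two difference quotients. -/
lemma isBigO_deriv_of_convexOn {f : ℝ → ℝ} (hf : ConvexOn ℝ (Ici N) f) (hd : Differentiable ℝ f)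
    (hO : f =O[atTop] fun x => exp (-μ * x)) : deriv f =O[atTop] fun x => exp (-μ * x) := by
  have shift : ∀ s : ℝ, (fun x => f (x + s)) =O[atTop] fun x => exp (-μ * x) := fun s =>
    (hO.comp_tendsto (tendsto_atTop_add_const_right _ s tendsto_id)).trans
      (exp_neg_mul_add_isBigO μ s)
  refine IsBigO.trans (IsBigO.of_bound 1 ?_)
    (((shift 1).sub hO).norm_left.add (hO.sub (shift (-1))).norm_left)
  filter_upwards [eventually_ge_atTop (N + 1)] with x hx
  have hr := hf.deriv_le_slope (x := x) (y := x + 1) (mem_Ici.2 (by linarith))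
    (mem_Ici.2 (by linarith)) (by linarith) (hd x)
  have hl := hf.slope_le_deriv (x := x + -1) (y := x) (mem_Ici.2 (by linarith))
    (mem_Ici.2 (by linarith)) (by linarith) (hd x)
  simp only [slope_def_field, add_sub_cancel_left, sub_add_cancel_left, neg_neg, div_one] at hr hl
  simp only [one_mul, norm_eq_abs]
  refine le_trans (abs_le.2 ?_) (le_abs_self _)
  constructor
  · linarith [neg_abs_le (f x - f (x + -1)), abs_nonneg (f (x + 1) - f x)]
  · linarith [le_abs_self (f (x + 1) - f x), abs_nonneg (f x - f (x + -1))]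

lemma isBigO_deriv_of_le_deriv_deriv (hu : ContDiff ℝ 2 u) (hμ : μ ≠ 0) {K : ℝ}
    (hO : u =O[atTop] fun x => exp (-μ * x))
    (h : ∀ᶠ x in atTop, -(K * exp (-μ * x)) ≤ deriv (deriv u) x) :
    deriv u =O[atTop] fun x => exp (-μ * x) := by
  obtain ⟨N, hN⟩ := eventually_atTop.1 h
  have hd : Differentiable ℝ u := hu.differentiable (by norm_num)
  have hdd : Differentiable ℝ (deriv u) := (hu.deriv' (n := 1)).differentiable (by norm_num)
  set f : ℝ → ℝ := fun x => u x + K / μ ^ 2 * exp (-μ * x)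
  have hf' : ∀ x, HasDerivAt f (deriv u x - K / μ * exp (-μ * x)) x := fun x =>
    ((hd x).hasDerivAt.add ((hasDerivAt_exp_neg_mul μ x).const_mul (K / μ ^ 2))).congr_deriv
      (by field_simp; ring)
  have hf'' : ∀ x, HasDerivAt (deriv f) (deriv (deriv u) x + K * exp (-μ * x)) x := fun x => by
    rw [show deriv f = fun x => deriv u x - K / μ * exp (-μ * x) from funext fun x => (hf' x).deriv]
    exact ((hdd x).hasDerivAt.sub ((hasDerivAt_exp_neg_mul μ x).const_mul (K / μ))).congr_deriv
      (by field_simp; ring)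
  have hconv : ConvexOn ℝ (Ici N) f :=
    convexOn_of_deriv2_nonneg (convex_Ici N) (fun x _ => (hf' x).continuousAt.continuousWithinAt)
      (fun x _ => (hf' x).differentiableAt.differentiableWithinAt)
      (fun x _ => (hf'' x).differentiableAt.differentiableWithinAt) fun x hx => by
        rw [Function.iterate_succ, Function.iterate_one, Function.comp_apply, (hf'' x).deriv]
        linarith [hN x (interior_subset hx)]
  have hfO := isBigO_deriv_of_convexOn hconv (fun x => (hf' x).differentiableAt)
    (hO.add ((isBigO_refl _ _).const_mul_left (K / μ ^ 2)))
  refine (hfO.add ((isBigO_refl _ _).const_mul_left (K / μ))).congr_left fun x => ?_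
  rw [(hf' x).deriv]
  ring

lemma DecayingSolution.isBigO_deriv (hu : DecayingSolution k a m n u) (hμ : 0 < μ)
    (hm : μ ^ 2 < m) : deriv u =O[atTop] fun x => exp (-μ * x) := by
  wlog ha : 0 ≤ a generalizing k a n u
  · have h' : deriv (-u) = -deriv u := deriv.neg'
    have hneg := this hu.neg (neg_nonneg.2 (not_le.1 ha).le)
    rw [h'] at hneg
    exact isBigO_neg_left.1 hneg
  have hlin : (fun x => (m - n * u x) / (1 - k * u x) * u x) =O[atTop] fun x => exp (-μ * x) := by
    simpa using (((hu.tendsto_sub_mul m n).div (hu.tendsto_sub_mul 1 k) one_ne_zero).isBigO_one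
      ℝ).mul (hu.isBigO hμ hm)
  obtain ⟨K, hK⟩ := hlin.bound
  refine isBigO_deriv_of_le_deriv_deriv hu.smooth hμ.ne' (hu.isBigO hμ hm) (K := K) ?_
  filter_upwards [hK, (hu.tendsto_sub_mul 1 k).eventually (lt_mem_nhds one_pos)] with x hx hk
  rw [norm_eq_abs, norm_eq_abs, abs_exp] at hx
  have hode : deriv (deriv u) x = a * deriv u x ^ 2 / (1 - k * u x)
      + (m - n * u x) / (1 - k * u x) * u x := by
    have := hu.ode x
    field_simp
    linarith
  have hsq : 0 ≤ a * deriv u x ^ 2 / (1 - k * u x) := by positivity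
  linarith [(abs_le.1 hx).1]

lemma DecayingSolution.isBigO_deriv_deriv (hu : DecayingSolution k a m n u) (hμ : 0 < μ)
    (hm : μ ^ 2 < m) : deriv (deriv u) =O[atTop] fun x => exp (-μ * x) := by
  have hE : (fun x => exp (-μ * x)) =O[atTop] fun _ => (1 : ℝ) :=
    (tendsto_exp_neg_mul_atTop hμ).isBigO_one ℝ
  have hu' := hu.isBigO_deriv hμ hm
  have hsq : (fun x => a * deriv u x ^ 2) =O[atTop] fun x => exp (-μ * x) := by
    simpa [sq] using (hu'.mul (hu'.trans hE)).const_mul_left a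
  have hlin : (fun x => u x * (m - n * u x)) =O[atTop] fun x => exp (-μ * x) := by
    simpa using (hu.isBigO hμ hm).mul ((hu.tendsto_sub_mul m n).isBigO_one ℝ)
  have hinv := ((hu.tendsto_sub_mul 1 k).inv₀ one_ne_zero).isBigO_one ℝ
  have hO : (fun x => (1 - k * u x)⁻¹ * (a * deriv u x ^ 2 + u x * (m - n * u x))) =O[atTop]
      fun x => exp (-μ * x) := by simpa using hinv.mul (hsq.add hlin)
  refine hO.congr' ?_ EventuallyEq.rfl
  filter_upwards [(hu.tendsto_sub_mul 1 k).eventually (lt_mem_nhds one_pos)] with x hk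
  rw [← hu.ode, inv_mul_cancel_left₀ hk.ne']

lemma decaysIn_id_of_isBigO_exp {f : ℝ → ℝ} (hc : Continuous f) (hsymm : ∀ x, |f (-x)| = |f x|)
    (hμ : 0 < μ) (hO : f =O[atTop] fun x => exp (-μ * x)) : DecaysIn id f := by
  intro n
  have hlim : Tendsto (fun x : ℝ => x ^ n * exp (-μ * x)) atTop (𝓝 0) := by
    simpa only [neg_mul, exp_neg, ← div_eq_mul_inv] using
      (isLittleO_pow_exp_pos_mul_atTop n hμ).tendsto_div_nhds_zero
  have hbig : (fun x => x ^ n * f x) =O[atTop] fun _ => (1 : ℝ) :=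
    ((isBigO_refl (fun x : ℝ => x ^ n) atTop).mul hO).trans (hlim.isBigO_one ℝ)
  obtain ⟨C, hC⟩ := hbig.bound
  obtain ⟨N, hN⟩ := eventually_atTop.1 hC
  obtain ⟨D, hD⟩ := isCompact_Icc.exists_bound_of_continuousOn (s := Icc 0 (max N 0))
    (f := fun x => x ^ n * f x) (by fun_prop)
  have hnonneg : ∀ x, 0 ≤ x → |x| ^ n * |f x| ≤ max C D := fun x hx => by
    rw [← abs_pow, ← abs_mul, ← norm_eq_abs]
    rcases le_total x (max N 0) with h | h
    · exact (hD x ⟨hx, h⟩).trans (le_max_right _ _)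
    · exact (by simpa using hN x ((le_max_left _ _).trans h) : _ ≤ C).trans (le_max_left _ _)
  refine ⟨max C D, fun x => ?_⟩
  rcases le_total 0 x with hx | hx
  · exact hnonneg x hx
  · simpa [hsymm] using hnonneg (-x) (neg_nonneg.2 hx)

end ProfileDecay

/-! ### The velocity of a soliton -/

section Velocity

variable {P : Params} {A V g q x : ℝ}

lemma Params.Admissible.β_pos (hP : P.Admissible) : 0 < P.β :=
  Real.sqrt_pos.2 (div_pos hP.2.2.2.1 hP.2.2.2.2.2)

lemma Params.Admissible.r_mem (hP : P.Admissible) : P.r ∈ Ioo (0 : ℝ) 1 := by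
  obtain ⟨-, -, -, -, hc2, hc3⟩ := hP
  exact ⟨div_pos hc3 (by linarith), (div_lt_one (by linarith)).2 (by linarith)⟩

lemma Params.Admissible.γ_add_pos (hP : P.Admissible) (hV : P.c0 < V) :
    0 < P.γ + P.α ^ 2 * V := by
  obtain ⟨hγ, hc0, hα, -⟩ := hP
  have := hc0.trans_lt hV
  positivity

lemma Params.Admissible.hasDerivAt_potential (hP : P.Admissible) (V : ℝ) (hx : 0 < x) :
    HasDerivAt (P.potential V)
      (2 * x ^ (1 - 2 * P.r) * ((1 - x ^ P.r) * (1 - P.q V - x ^ P.r))) x := by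
  have hr := hP.r_mem.2
  have h₂ : 2 - P.r ≠ 0 := by linarith
  have h₁ : 1 - P.r ≠ 0 := by linarith
  have hpow₁ : x ^ (1 - P.r) = x ^ (1 - 2 * P.r) * x ^ P.r := by
    rw [← Real.rpow_add hx]; ring_nf
  have hpow₂ : x = x ^ (1 - 2 * P.r) * x ^ P.r * x ^ P.r := by
    rw [← hpow₁, ← Real.rpow_add hx]; simp
  have hd₁ := (Real.hasDerivAt_rpow_const (p := 2 - P.r) (Or.inl hx.ne')).const_mul
    (2 * ((2 - P.q V) / (2 - P.r)))
  have hd₂ := (Real.hasDerivAt_rpow_const (p := 2 - 2 * P.r) (Or.inl hx.ne')).const_mul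
    ((1 - P.q V) / (1 - P.r))
  refine (((hasDerivAt_pow 2 x).sub hd₁).add hd₂ |>.sub_const _).congr_deriv ?_
  rw [show 2 - P.r - 1 = 1 - P.r by ring, show 2 - 2 * P.r - 1 = 1 - 2 * P.r by ring, hpow₁]
  field_simp
  push_cast
  linear_combination 2 * hpow₂

lemma Params.Admissible.strictMonoOn_potential (hP : P.Admissible) (hq : P.q V ≤ 0) :
    StrictMonoOn (P.potential V) (Ioc 0 1) := by
  refine strictMonoOn_of_deriv_pos (convex_Ioc 0 1)
    (fun x hx => (hP.hasDerivAt_potential V hx.1).continuousAt.continuousWithinAt) fun x hx => ?_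
  rw [interior_Ioc] at hx
  rw [(hP.hasDerivAt_potential V hx.1).deriv]
  have hpow := Real.rpow_lt_one hx.1.le hx.2 hP.r_mem.1
  have hpos := Real.rpow_pos_of_pos hx.1 (1 - 2 * P.r)
  exact mul_pos (mul_pos two_pos hpos) (mul_pos (by linarith) (by linarith))

lemma Params.potential_one (P : Params) (V : ℝ) : P.potential V 1 = 0 := by
  simp [Params.potential]

lemma Params.IsVelocity.γ_add_pos (h : P.IsVelocity A V g) (hP : P.Admissible) (hA : 0 < A) :
    0 < P.γ + P.α ^ 2 * V := by
  obtain ⟨hg, -, hV⟩ := h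
  have hα := hP.2.2.1.ne'
  have hpow : 0 < 1 - g ^ P.r := sub_pos.2 (Real.rpow_lt_one hg.1.le hg.2 hP.r_mem.1)
  have hΓ : P.γ + P.α ^ 2 * V = P.c3 * A / (1 - g ^ P.r) := by
    rw [hV]
    field_simp
    ring
  rw [hΓ]
  exact div_pos (mul_pos hP.2.2.2.2.2 hA) hpow

/-- If `V ≤ c₀`, then `q ≤ 0` and the potential, being strictly increasing up to its zero at `1`,
has no root in `(0, 1)`. -/
lemma Params.IsVelocity.c0_lt (h : P.IsVelocity A V g) (hP : P.Admissible) (hA : 0 < A) :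
    P.c0 < V := by
  by_contra! hV
  have hc1 := hP.2.2.2.1
  have hΓ := h.γ_add_pos hP hA
  have hq : P.q V ≤ 0 := div_nonpos_of_nonpos_of_nonneg
    (mul_nonpos_of_nonneg_of_nonpos hP.2.2.2.2.2.le (sub_nonpos.2 hV)) (by positivity)
  have hneg := hP.strictMonoOn_potential hq ⟨h.1.1, h.1.2.le⟩ ⟨one_pos, le_rfl⟩ h.1.2
  rw [P.potential_one, h.2.1] at hneg
  exact hneg.false

end Velocity

/-! ### The densities -/

section Densities

variable {X : Type*} {ρ f g : X → ℝ} (P : Params)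

lemma DecaysIn.p1 (hf : DecaysIn ρ f) (hg : DecaysIn ρ g) :
    DecaysIn ρ fun z => P.p1 (f z) (g z) :=
  ((hf.const_mul _).add ((hf.pow_succ 1).const_mul _)).sub ((hg.pow_succ 1).const_mul _)

lemma DecaysIn.q2 (hf : DecaysIn ρ f) (hg : DecaysIn ρ g) :
    DecaysIn ρ fun z => P.q2 (f z) (g z) :=
  (hf.pow_succ 1).add ((hg.pow_succ 1).const_mul _)

lemma DecaysIn.pp2 (hf : DecaysIn ρ f) (hg : DecaysIn ρ g) :
    DecaysIn ρ fun z => P.pp2 (f z) (g z) := by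
  refine (((hf.pow_succ 1).const_mul _).add ((hf.pow_succ 2).const_mul _)).sub
    ((hg.pow_succ 1).bdd_mul ?_)
  obtain ⟨C, hC⟩ := hf.bounded
  refine ⟨|3 * P.γ| + |2 * P.c2 - 5 * P.c3| * C, fun z => (abs_add_le _ _).trans ?_⟩
  rw [abs_mul (2 * P.c2 - 5 * P.c3)]
  gcongr
  exact hC z

lemma DecaysIn.k2 (hg : DecaysIn ρ g) : DecaysIn ρ fun z => P.k2 (f z) (g z) :=
  (hg.pow_succ 2).const_mul _

variable [TopologicalSpace X]

@[fun_prop]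
lemma Params.continuous_p1 (hf : Continuous f) (hg : Continuous g) :
    Continuous fun z => P.p1 (f z) (g z) := by
  unfold Params.p1; fun_prop

@[fun_prop]
lemma Params.continuous_q2 (hf : Continuous f) (hg : Continuous g) :
    Continuous fun z => P.q2 (f z) (g z) := by
  unfold Params.q2; fun_prop

@[fun_prop]
lemma Params.continuous_pp2 (hf : Continuous f) (hg : Continuous g) :
    Continuous fun z => P.pp2 (f z) (g z) := by
  unfold Params.pp2; fun_prop

@[fun_prop]
lemma Params.continuous_k2 (hg : Continuous g) : Continuous fun z => P.k2 (f z) (g z) := by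
  unfold Params.k2; fun_prop

end Densities

/-! ### Decay and moments of a soliton profile -/

section Parity

variable {f : ℝ → ℝ}

lemma integral_eq_zero_of_odd (hf : ∀ x, f (-x) = -f x) : ∫ x, f x = 0 := by
  have h := integral_neg_eq_self f volume
  simp only [hf, integral_neg] at h
  linarith

lemma deriv_odd_of_even (hf : ∀ x, f (-x) = f x) (x : ℝ) : deriv f (-x) = -deriv f x := by
  have h := deriv_comp_neg f x
  simp only [hf] at h
  linarith

lemma deriv_even_of_odd (hf : ∀ x, f (-x) = -f x) (x : ℝ) : deriv f (-x) = deriv f x := by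
  have h := deriv_comp_neg f x
  simp only [hf, deriv.fun_neg] at h
  linarith

end Parity

section Profile

variable {P : Params} {A V : ℝ} {w : ℝ → ℝ}

lemma hasDerivAt_of_smooth (hw : ContDiff ℝ ∞ w) (η : ℝ) : HasDerivAt w (deriv w η) η :=
  (hw.differentiable (by simp) η).hasDerivAt

lemma contDiff_deriv (hw : ContDiff ℝ ∞ w) : ContDiff ℝ ∞ (deriv w) :=
  (contDiff_infty_iff_deriv.1 hw).2

lemma Params.IsProfile.decayingSolution (hw : P.IsProfile A V w) :
    DecayingSolution (P.c3 * A / (P.γ + P.α ^ 2 * V)) (P.c2 * A / (P.γ + P.α ^ 2 * V))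
      (1 / (P.β ^ 2 * (P.γ + P.α ^ 2 * V)) * (V - P.c0))
      (1 / (P.β ^ 2 * (P.γ + P.α ^ 2 * V)) * (P.c1 * A)) w where
  smooth := by exact_mod_cast contDiff_infty.1 hw.smooth 2
  top := hw.top
  ode η := by rw [hw.ode η]; ring

lemma Params.IsProfile.exists_decay_rate (hP : P.Admissible) (hV : P.c0 < V) :
    ∃ μ > 0, μ ^ 2 < 1 / (P.β ^ 2 * (P.γ + P.α ^ 2 * V)) * (V - P.c0) := by
  have hβ := hP.β_pos
  have hΓ := hP.γ_add_pos hV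
  have hm : 0 < 1 / (P.β ^ 2 * (P.γ + P.α ^ 2 * V)) * (V - P.c0) :=
    mul_pos (by positivity) (sub_pos.2 hV)
  exact ⟨_, Real.sqrt_pos.2 (half_pos hm), by rw [Real.sq_sqrt (half_pos hm).le]; linarith⟩

lemma Params.IsProfile.decays (hw : P.IsProfile A V w) (hP : P.Admissible) (hV : P.c0 < V) :
    DecaysIn id w := by
  obtain ⟨μ, hμ, hm⟩ := exists_decay_rate hP hV
  exact decaysIn_id_of_isBigO_exp hw.smooth.continuous (fun η => by rw [hw.even]) hμ
    (hw.decayingSolution.isBigO hμ hm)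

lemma Params.IsProfile.decays_deriv (hw : P.IsProfile A V w) (hP : P.Admissible)
    (hV : P.c0 < V) : DecaysIn id (deriv w) := by
  obtain ⟨μ, hμ, hm⟩ := exists_decay_rate hP hV
  exact decaysIn_id_of_isBigO_exp (contDiff_deriv hw.smooth).continuous
    (fun η => by rw [deriv_odd_of_even hw.even, abs_neg]) hμ
    (hw.decayingSolution.isBigO_deriv hμ hm)

lemma Params.IsProfile.decays_deriv_deriv (hw : P.IsProfile A V w) (hP : P.Admissible)
    (hV : P.c0 < V) : DecaysIn id (deriv (deriv w)) := by
  obtain ⟨μ, hμ, hm⟩ := exists_decay_rate hP hV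
  exact decaysIn_id_of_isBigO_exp (contDiff_deriv (contDiff_deriv hw.smooth)).continuous
    (fun η => by rw [deriv_even_of_odd (deriv_odd_of_even hw.even)]) hμ
    (hw.decayingSolution.isBigO_deriv_deriv hμ hm)

lemma Params.IsProfile.ode_mul (hw : P.IsProfile A V w) (hP : P.Admissible) (hV : P.c0 < V)
    (η : ℝ) : (P.γ + P.α ^ 2 * V - P.c3 * A * w η) * P.β ^ 2 * deriv (deriv w) η
      = P.c2 * A * P.β ^ 2 * deriv w η ^ 2 + (V - P.c0) * w η - P.c1 * A * w η ^ 2 := by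
  have hβ := hP.β_pos
  have hΓ := hP.γ_add_pos hV
  have h := hw.ode η
  field_simp at h
  linarith

lemma Params.IsProfile.hasDerivAt_primitive_p1 (hw : P.IsProfile A V w) (hP : P.Admissible)
    (hV : P.c0 < V) (η : ℝ) :
    HasDerivAt (fun η => -A * ((P.γ + P.α ^ 2 * V - P.c3 * A * w η) * P.β ^ 2 * deriv w η))
      (P.p1 (A * w η) (P.β * (A * deriv w η)) - V * A * w η) η := by
  have hΓw := (((hasDerivAt_of_smooth hw.smooth η).const_mul (P.c3 * A)).const_sub
    (P.γ + P.α ^ 2 * V)).mul_const (P.β ^ 2)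
  refine ((hΓw.mul (hasDerivAt_of_smooth (contDiff_deriv hw.smooth) η)).const_mul
    (-A)).congr_deriv ?_
  simp only [Params.p1]
  linear_combination (-A) * hw.ode_mul hP hV η

lemma Params.IsProfile.integral_p1 (hw : P.IsProfile A V w) (hP : P.Admissible)
    (hV : P.c0 < V) :
    ∫ η, P.p1 (A * w η) (P.β * (A * deriv w η)) = V * A * ∫ η, w η := by
  have hc := hw.smooth.continuous
  have hc' := (contDiff_deriv hw.smooth).continuous
  have hd := hw.decays hP hV
  have hd' := hw.decays_deriv hP hV
  have hp1 : Integrable fun η => P.p1 (A * w η) (P.β * (A * deriv w η)) :=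
    ((hd.const_mul A).p1 P ((hd'.const_mul A).const_mul P.β)).integrable (by fun_prop)
  have hV : Integrable fun η => V * A * w η := (hd.integrable hc).const_mul _
  have hprim : Integrable fun η =>
      -A * ((P.γ + P.α ^ 2 * V - P.c3 * A * w η) * P.β ^ 2 * deriv w η) := by
    have : DecaysIn id fun η => -A * ((P.γ + P.α ^ 2 * V) * P.β ^ 2 * deriv w η
        - P.c3 * A * P.β ^ 2 * (w η * deriv w η)) :=
      ((hd'.const_mul _).sub ((hd.mul hd').const_mul _)).const_mul _
    exact (this.integrable (by fun_prop)).congr (ae_of_all _ fun η => by ring)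
  have hzero := integral_eq_zero_of_hasDerivAt_of_integrable
    (hw.hasDerivAt_primitive_p1 hP ‹_›) (hp1.sub hV) hprim
  rw [integral_sub hp1 hV, integral_const_mul] at hzero
  linarith

lemma Params.IsProfile.hasDerivAt_primitive_p2 (hw : P.IsProfile A V w) (hP : P.Admissible)
    (hV : P.c0 < V) (η : ℝ) :
    HasDerivAt (fun η => A ^ 2 * (2 * ((P.γ + P.α ^ 2 * V - P.c3 * A * w η) * P.β ^ 2 * w η
        * deriv w η) + η * ((P.γ + P.α ^ 2 * V - P.c3 * A * w η) * P.β ^ 2 * deriv w η ^ 2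
        - ((V - P.c0) * w η ^ 2 - 2 / 3 * P.c1 * A * w η ^ 3))))
      (V * P.q2 (A * w η) (P.β * (A * deriv w η)) - P.pp2 (A * w η) (P.β * (A * deriv w η))
        + 2 * P.α ^ 2 * P.β ^ 2 * A ^ 2 * V * deriv w η ^ 2
        + P.β⁻¹ * (η * P.k2 (A * w η) (P.β * (A * deriv w η)))) η := by
  have := hP.β_pos.ne'
  have hw₀ := hasDerivAt_of_smooth hw.smooth η
  have hw₁ := hasDerivAt_of_smooth (contDiff_deriv hw.smooth) η
  have hΓw := ((hw₀.const_mul (P.c3 * A)).const_sub (P.γ + P.α ^ 2 * V)).mul_const (P.β ^ 2)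
  refine (((((hΓw.mul hw₀).mul hw₁).const_mul 2).add ((hasDerivAt_id η).mul
    ((hΓw.mul (hw₁.pow 2)).sub (((hw₀.pow 2).const_mul (V - P.c0)).sub
      ((hw₀.pow 3).const_mul (2 / 3 * P.c1 * A)))))).const_mul (A ^ 2)).congr_deriv ?_
  simp only [Params.q2, Params.pp2, Params.k2, Pi.mul_apply, Pi.pow_apply, Pi.sub_apply, id]
  field_simp
  push_cast
  linear_combination 6 * A ^ 2 * (w η + η * deriv w η) * hw.ode_mul hP hV η

lemma Params.IsProfile.integrable_primitive_p2 (hw : P.IsProfile A V w) (hP : P.Admissible)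
    (hV : P.c0 < V) :
    Integrable fun η => A ^ 2 * (2 * ((P.γ + P.α ^ 2 * V - P.c3 * A * w η) * P.β ^ 2 * w η
        * deriv w η) + η * ((P.γ + P.α ^ 2 * V - P.c3 * A * w η) * P.β ^ 2 * deriv w η ^ 2
        - ((V - P.c0) * w η ^ 2 - 2 / 3 * P.c1 * A * w η ^ 3))) := by
  have hc := hw.smooth.continuous
  have hc' := (contDiff_deriv hw.smooth).continuous
  have hd := hw.decays hP hV
  have hd' := hw.decays_deriv hP hV
  have hΓw : ∃ C, ∀ η, |(P.γ + P.α ^ 2 * V - P.c3 * A * w η) * P.β ^ 2| ≤ C := by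
    obtain ⟨C, hC⟩ := (hd.const_mul (P.c3 * A)).bounded
    refine ⟨(|P.γ + P.α ^ 2 * V| + C) * P.β ^ 2, fun η => ?_⟩
    rw [abs_mul, abs_of_nonneg (sq_nonneg P.β)]
    gcongr
    exact (abs_sub _ _).trans (by gcongr; exact hC η)
  have hfst := ((hd.mul hd').bdd_mul hΓw).const_mul 2
  have hsnd := ((hd'.pow_succ 1).bdd_mul hΓw).sub
    (((hd.pow_succ 1).const_mul (V - P.c0)).sub ((hd.pow_succ 2).const_mul (2 / 3 * P.c1 * A)))
  refine (((hfst.integrable (by fun_prop)).add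
    (hsnd.integrable_pow_mul (by fun_prop) 1)).const_mul (A ^ 2)).congr (ae_of_all _ fun η => ?_)
  simp only [Pi.add_apply]
  ring

lemma Params.IsProfile.moment_p2 (hw : P.IsProfile A V w) (hP : P.Admissible)
    (hV : P.c0 < V) :
    V * (∫ η, P.q2 (A * w η) (P.β * (A * deriv w η)))
      - (∫ η, P.pp2 (A * w η) (P.β * (A * deriv w η)))
      + 2 * P.α ^ 2 * P.β ^ 2 * A ^ 2 * V * (∫ η, deriv w η ^ 2)
      + P.β⁻¹ * (∫ η, η * P.k2 (A * w η) (P.β * (A * deriv w η))) = 0 := by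
  have hc := hw.smooth.continuous
  have hc' := (contDiff_deriv hw.smooth).continuous
  have hd := (hw.decays hP hV).const_mul A
  have hd' := hw.decays_deriv hP hV
  have hwave := (hd'.const_mul A).const_mul P.β
  have hq2 := ((hd.q2 P hwave).integrable (by fun_prop)).const_mul V
  have hpp2 := (hd.pp2 P hwave).integrable (by fun_prop)
  have hsq := ((hd'.pow_succ 1).integrable (by fun_prop)).const_mul
    (2 * P.α ^ 2 * P.β ^ 2 * A ^ 2 * V)
  have hk2 := ((hwave.k2 (f := fun η => A * w η) P).integrable_pow_mul (by fun_prop) 1).const_mul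
    P.β⁻¹
  simp only [pow_one] at hk2
  have hzero := (integral_add' ((hq2.sub hpp2).add hsq) hk2).symm.trans
    (integral_eq_zero_of_hasDerivAt_of_integrable (hw.hasDerivAt_primitive_p2 hP hV)
      (((hq2.sub hpp2).add hsq).add hk2) (hw.integrable_primitive_p2 hP hV))
  rw [integral_add' (hq2.sub hpp2) hsq, integral_sub' hq2 hpp2] at hzero
  simpa only [integral_const_mul] using hzero

end Profile

/-! ### Pairings with test functions in the fast variables -/

section Pairing

variable {T δ : ℝ} {ψ : ℝ → ℝ}

lemma contDiffOn_integral_mul_test {E : Type*} [NormedAddCommGroup E] [NormedSpace ℝ E]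
    {s : Set E} (hs : IsOpen s) {g : E → ℝ → ℝ}
    (hg : ContDiffOn ℝ ∞ (fun z : E × ℝ => g z.1 z.2) (s ×ˢ univ)) (hψ : IsTest ψ) :
    ContDiffOn ℝ ∞ (fun p => ∫ x, g p x * ψ x) s := by
  -- The integral is the convolution of `1` with `g p * ψ` at the point `0`.
  have hconv := contDiffOn_convolution_right_with_param (𝕜 := ℝ) (μ := (volume : Measure ℝ))
    (f := fun _ : ℝ => (1 : ℝ)) (n := ⊤) (ContinuousLinearMap.mul ℝ ℝ)
    (g := fun p x => g p x * ψ x) (s := s) (k := tsupport ψ) hs hψ.2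
    (fun p x _ hx => by simp [image_eq_zero_of_notMem_tsupport hx])
    continuous_const.locallyIntegrable (hg.mul (hψ.1.comp_contDiffOn contDiffOn_snd))
  have hzero := hconv.comp (f := fun p : E => (p, (0 : ℝ)))
    ((contDiff_id.prodMk contDiff_const).contDiffOn (s := s)) (fun p hp => ⟨hp, mem_univ _⟩)
  refine hzero.congr fun p _ => ?_
  simp only [Function.comp, MeasureTheory.convolution, ContinuousLinearMap.mul_apply', one_mul,
    zero_sub]
  exact (integral_neg_eq_self (fun x => g p x * ψ x) volume).symm

/-- For small `ε` both values are small; the remaining `ε` form a compact set. -/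
lemma equicontinuous_of_continuousOn {f : ℝ → ℝ → ℝ} {C : ℝ}
    (hf : ContinuousOn (fun z : ℝ × ℝ => f z.1 z.2) (Ioi 0 ×ˢ univ))
    (hC : ∀ ε ∈ Ioc (0 : ℝ) 1, ∀ t, |f ε t| ≤ C * ε) (hδ : 0 < δ) :
    ∃ h > 0, ∀ ε ∈ Ioc (0 : ℝ) 1, ∀ t ∈ Ioo 0 T, ∀ t' ∈ Ioo 0 T,
      |t - t'| < h → |f ε t - f ε t'| < δ := by
  have hC0 : 0 ≤ C := by simpa using (abs_nonneg _).trans (hC 1 (by simp) 0)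
  have hε₁ : 0 < δ / (2 * (C + 1)) := by positivity
  have hK : IsCompact (Icc (δ / (2 * (C + 1))) 1 ×ˢ Icc 0 T) := isCompact_Icc.prod isCompact_Icc
  have hunif := hK.uniformContinuousOn_of_continuous (hf.mono (prod_mono
    (fun x hx => hε₁.trans_le hx.1) (subset_univ _)))
  obtain ⟨h, hh, H⟩ := Metric.uniformContinuousOn_iff.1 hunif δ hδ
  refine ⟨h, hh, fun ε hε t ht t' ht' htt => ?_⟩
  rcases lt_or_ge ε (δ / (2 * (C + 1))) with hlt | hge
  · have hsmall : 2 * (C * ε) < δ := by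
      rw [lt_div_iff₀ (by positivity)] at hlt
      linarith [hε.1]
    calc |f ε t - f ε t'| ≤ |f ε t| + |f ε t'| := abs_sub _ _
      _ < δ := by linarith [hC ε hε t, hC ε hε t']
  · have hdist : dist (ε, t) (ε, t') < h := by
      rw [dist_prod_same_left]; simpa [Real.dist_eq] using htt
    simpa [Real.dist_eq] using H (ε, t) ⟨⟨hge, hε.2⟩, Ioo_subset_Icc_self ht⟩ (ε, t')
      ⟨⟨hge, hε.2⟩, Ioo_subset_Icc_self ht'⟩ hdist

variable {l : ℝ → ℝ → ℝ} {a b x₀ t₀ ε τ M : ℝ} {v : ℝ → ℝ → ℝ → ℝ}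

lemma contDiffOn_scaled (hl : ContDiff ℝ ∞ (fun z : ℝ × ℝ => l z.1 z.2)) :
    ContDiffOn ℝ ∞ (fun z : (ℝ × ℝ) × ℝ => l (a / z.1.1 * (z.1.2 - t₀)) (b / z.1.1 * (z.2 - x₀)))
      ((Ioi 0 ×ˢ univ) ×ˢ univ) := by
  refine hl.comp_contDiffOn (f := fun z : (ℝ × ℝ) × ℝ =>
    (a / z.1.1 * (z.1.2 - t₀), b / z.1.1 * (z.2 - x₀))) ?_
  have hfst : ContDiffOn ℝ ∞ (fun z : (ℝ × ℝ) × ℝ => z.1.1) ((Ioi 0 ×ˢ univ) ×ˢ univ) := by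
    fun_prop
  have hne : ∀ z ∈ (Ioi (0 : ℝ) ×ˢ (univ : Set ℝ)) ×ˢ (univ : Set ℝ), z.1.1 ≠ 0 :=
    fun z hz => (mem_Ioi.1 hz.1.1).ne'
  exact ((contDiffOn_const.div hfst hne).mul (by fun_prop)).prodMk
    ((contDiffOn_const.div hfst hne).mul (by fun_prop))

lemma contDiffOn_scaled_pairing (hl : ContDiff ℝ ∞ (fun z : ℝ × ℝ => l z.1 z.2))
    (hψ : IsTest ψ) :
    ContDiffOn ℝ ∞ (fun z : ℝ × ℝ => ∫ x, l (a / z.1 * (z.2 - t₀)) (b / z.1 * (x - x₀)) * ψ x)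
      (Ioi 0 ×ˢ univ) :=
  contDiffOn_integral_mul_test (isOpen_Ioi.prod isOpen_univ)
    (g := fun (z : ℝ × ℝ) x => l (a / z.1 * (z.2 - t₀)) (b / z.1 * (x - x₀)))
    (contDiffOn_scaled hl) hψ

lemma scaled_pairing_eq (hb : 0 < b) (hε : 0 < ε) (τ : ℝ) (ψ : ℝ → ℝ) :
    ∫ x, l τ (b / ε * (x - x₀)) * ψ x
      = ε * (b⁻¹ * ∫ ζ, l τ ζ * ψ (x₀ + ε * (b⁻¹ * ζ))) := by
  have hdilate := Measure.integral_comp_mul_left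
    (fun ζ => l τ ζ * ψ (x₀ + ε * (b⁻¹ * ζ))) (b / ε)
  have htranslate := integral_sub_right_eq_self
    (μ := (volume : Measure ℝ)) (fun y => l τ (b / ε * y) * ψ (x₀ + y)) x₀
  have hcancel : ∀ y, ε * (b⁻¹ * (b / ε * y)) = y := fun y => by field_simp
  simp only [hcancel, add_sub_cancel] at hdilate htranslate
  rw [htranslate, hdilate, abs_of_pos (inv_pos.2 (div_pos hb hε)), smul_eq_mul, inv_div]
  ring

lemma abs_scaled_pairing_le (hb : 0 < b) (hε : 0 < ε)
    (hM : |∫ ζ, l τ ζ * ψ (x₀ + ε * (b⁻¹ * ζ))| ≤ M) :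
    |∫ x, l τ (b / ε * (x - x₀)) * ψ x| ≤ b⁻¹ * M * ε := by
  rw [scaled_pairing_eq hb hε, abs_mul, abs_mul, abs_of_pos hε, abs_of_pos (inv_pos.2 hb), mul_comm]
  gcongr

lemma isOD_of_scaled (T : ℝ) (hb : 0 < b) (hl : ContDiff ℝ ∞ (fun z : ℝ × ℝ => l z.1 z.2))
    (hv : ∀ ε > 0, ∀ t x, v ε t x = ε⁻¹ * l (a / ε * (t - t₀)) (b / ε * (x - x₀)))
    (hbound : ∀ ψ, IsTest ψ → ∃ C, ∀ ε τ : ℝ,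
      |∫ ζ, l τ ζ * ψ (x₀ + ε * (b⁻¹ * ζ))| ≤ C * ε ^ 2) :
    IsOD T 2 v := by
  intro ψ hψ
  have hs := contDiffOn_scaled_pairing (a := a) (b := b) (x₀ := x₀) (t₀ := t₀) hl hψ
  have heq : ∀ ε > 0, ∀ t, ∫ x, v ε t x * ψ x
      = ε⁻¹ * ∫ x, l (a / ε * (t - t₀)) (b / ε * (x - x₀)) * ψ x := fun ε hε t => by
    simp only [hv ε hε, mul_assoc, integral_const_mul]
  obtain ⟨C, hC⟩ := hbound ψ hψ
  have hC0 : 0 ≤ C := by simpa using (abs_nonneg _).trans (hC 1 0)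
  have hle : ∀ ε > 0, ∀ t, |∫ x, v ε t x * ψ x| ≤ b⁻¹ * C * ε ^ 2 := fun ε hε t => by
    rw [heq ε hε, abs_mul, abs_of_pos (inv_pos.2 hε), inv_mul_le_iff₀ hε]
    exact (abs_scaled_pairing_le hb hε (hC ε _)).trans_eq (by ring)
  refine ⟨fun ε hε => ?_, 1, one_pos, ⟨b⁻¹ * C, fun ε hε t _ => ?_⟩, ∅, fun δ hδ => ?_⟩
  · have hslice := hs.comp (f := fun t : ℝ => (ε, t)) (s := Ioo 0 T)
      (contDiff_const.prodMk contDiff_id).contDiffOn (fun t _ => ⟨hε, mem_univ _⟩)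
    exact (contDiffOn_const.mul hslice).congr fun t _ => heq ε hε t
  · rw [Real.rpow_two]
    exact hle ε hε.1 t
  · have hcont : ContinuousOn (fun z : ℝ × ℝ => ∫ x, v z.1 z.2 x * ψ x) (Ioi 0 ×ˢ univ) :=
      ((continuousOn_fst.inv₀ fun z hz => (mem_Ioi.1 hz.1).ne').mul hs.continuousOn).congr
        fun z hz => heq z.1 hz.1 z.2
    have hlin : ∀ ε ∈ Ioc (0 : ℝ) 1, ∀ t, |∫ x, v ε t x * ψ x| ≤ b⁻¹ * C * ε := fun ε hε t =>
      (hle ε hε.1 t).trans (mul_le_mul_of_nonneg_left (pow_le_of_le_one hε.1.le hε.2 two_ne_zero)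
        (by positivity))
    obtain ⟨h, hh, H⟩ := equicontinuous_of_continuousOn (T := T)
      (f := fun ε t => ∫ x, v ε t x * ψ x) hcont hlin hδ
    exact ⟨h, hh, fun ε hε t ht t' ht' htt _ => H ε hε t ht t' ht' htt⟩

lemma contInDistribUnif_of_scaled (T : ℝ) (hb : 0 < b)
    (hl : ContDiff ℝ ∞ (fun z : ℝ × ℝ => l z.1 z.2))
    (hv : ∀ ε > 0, ∀ t x, v ε t x = l (a / ε * (t - t₀)) (b / ε * (x - x₀)))
    (hbound : ∀ ψ, IsTest ψ → ∃ C, ∀ ε τ : ℝ,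
      |∫ ζ, l τ ζ * ψ (x₀ + ε * (b⁻¹ * ζ))| ≤ C) :
    ContInDistribUnif T v := by
  intro ψ hψ
  have hs := contDiffOn_scaled_pairing (a := a) (b := b) (x₀ := x₀) (t₀ := t₀) hl hψ
  have heq : ∀ ε > 0, ∀ t, ∫ x, v ε t x * ψ x
      = ∫ x, l (a / ε * (t - t₀)) (b / ε * (x - x₀)) * ψ x := fun ε hε t => by
    simp only [hv ε hε]
  obtain ⟨C, hC⟩ := hbound ψ hψ
  have hle : ∀ ε > 0, ∀ t, |∫ x, v ε t x * ψ x| ≤ b⁻¹ * C * ε := fun ε hε t => by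
    rw [heq ε hε]
    exact abs_scaled_pairing_le hb hε (hC ε _)
  refine ⟨1, one_pos, fun t ht δ hδ => ?_, 0, ?_⟩
  · obtain ⟨h, hh, H⟩ := equicontinuous_of_continuousOn (T := T)
      (f := fun ε t => ∫ x, v ε t x * ψ x)
      (hs.continuousOn.congr fun z hz => heq z.1 hz.1 z.2) (fun ε hε t => hle ε hε.1 t) hδ
    exact ⟨h, hh, fun ε hε t' ht' htt => H ε hε t ht t' ht' htt⟩
  · have hlim : Tendsto (fun ε : ℝ => b⁻¹ * C * ε) (𝓝[>] 0) (𝓝 0) :=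
      ((continuous_const_mul (b⁻¹ * C)).tendsto' 0 0 (mul_zero _)).mono_left nhdsWithin_le_nhds
    rw [Metric.tendstoUniformlyOn_iff]
    intro δ hδ
    filter_upwards [hlim.eventually (gt_mem_nhds hδ), self_mem_nhdsWithin] with ε hε hε0 t _
    rw [dist_comm, Real.dist_eq, Pi.zero_apply, sub_zero]
    exact (hle ε hε0 t).trans_lt hε

end Pairing

/-! ### The laws in the fast variables -/

section FastLaws

variable (P : Params) (U : ℝ → ℝ → ℝ) {ε : ℝ}

lemma dx_scaled (p q t₀ x₀ t x : ℝ) :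
    dx (fun t x => U (p * (t - t₀)) (q * (x - x₀))) t x
      = q * dx U (p * (t - t₀)) (q * (x - x₀)) :=
  (deriv_comp_sub_const (f := fun y => U (p * (t - t₀)) (q * y)) x₀ x).trans
    (deriv_comp_mul_left q (U (p * (t - t₀))) (x - x₀))

lemma dt_scaled (p q t₀ x₀ t x : ℝ) :
    dt (fun t x => U (p * (t - t₀)) (q * (x - x₀))) t x
      = p * dt U (p * (t - t₀)) (q * (x - x₀)) :=
  (deriv_comp_sub_const (f := fun y => U (p * y) (q * (x - x₀))) t₀ t).trans
    (deriv_comp_mul_left p (fun τ => U τ (q * (x - x₀))) (t - t₀))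

/-- The left-hand side of the conservation law in the fast variables `τ = a (t - t₀) / ε` and
`ζ = β (x - x₀) / ε`, multiplied by `ε`. -/
def Params.fastLaw1 (a : ℝ) : ℝ → ℝ → ℝ := fun τ ζ =>
  a * dt U τ ζ + P.β * dx (fun τ ζ => P.p1 (U τ ζ) (P.β * dx U τ ζ)) τ ζ

/-- The left-hand side of the balance law in the fast variables `τ = a (t - t₀) / ε` and
`ζ = β (x - x₀) / ε`, multiplied by `ε`. -/
def Params.fastLaw2 (a : ℝ) : ℝ → ℝ → ℝ := fun τ ζ =>
  a * dt (fun τ ζ => P.q2 (U τ ζ) (P.β * dx U τ ζ)) τ ζ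
    + P.β * dx (fun τ ζ => P.pp2 (U τ ζ) (P.β * dx U τ ζ)
        + 2 * P.α ^ 2 * (P.β * dx U τ ζ) * (a * dt U τ ζ)) τ ζ
    + P.k2 (U τ ζ) (P.β * dx U τ ζ)

lemma Params.law1_scaled (hε : 0 < ε) (a t₀ x₀ t x : ℝ) :
    P.law1 ε (fun t x => U (a / ε * (t - t₀)) (P.β / ε * (x - x₀))) t x
      = ε⁻¹ * P.fastLaw1 U a (a / ε * (t - t₀)) (P.β / ε * (x - x₀)) := by
  have hcancel : ∀ y, ε * (P.β / ε * y) = P.β * y := fun y => by field_simp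
  simp only [Params.law1, Params.fastLaw1, dx_scaled, dt_scaled, hcancel]
  rw [dx_scaled (fun τ ζ => P.p1 (U τ ζ) (P.β * dx U τ ζ))]
  field_simp

lemma Params.law2_scaled (hε : 0 < ε) (a t₀ x₀ t x : ℝ) :
    P.law2 ε (fun t x => U (a / ε * (t - t₀)) (P.β / ε * (x - x₀))) t x
      = ε⁻¹ * P.fastLaw2 U a (a / ε * (t - t₀)) (P.β / ε * (x - x₀)) := by
  have hcancel : ∀ y, ε * (P.β / ε * y) = P.β * y := fun y => by field_simp
  have hcancel₂ : ∀ y z, 2 * P.α ^ 2 * ε ^ 2 * (P.β / ε * y) * (a / ε * z)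
      = 2 * P.α ^ 2 * (P.β * y) * (a * z) := fun y z => by field_simp
  simp only [Params.law2, Params.fastLaw2, dx_scaled, dt_scaled, hcancel, hcancel₂]
  rw [dt_scaled (fun τ ζ => P.q2 (U τ ζ) (P.β * dx U τ ζ)),
    dx_scaled (fun τ ζ => P.pp2 (U τ ζ) (P.β * dx U τ ζ)
        + 2 * P.α ^ 2 * (P.β * dx U τ ζ) * (a * dt U τ ζ))]
  ring

end FastLaws

/-! ### Pairings of travelling waves -/

section TestPairing

variable {g ψ : ℝ → ℝ} {B : ℝ}

lemma integrable_mul_test (hg : Integrable g) (hψ : IsTest ψ) (x₀ s : ℝ) :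
    Integrable fun ζ => g ζ * ψ (x₀ + s * ζ) := by
  obtain ⟨B, hB⟩ := hψ.2.exists_bound_of_continuous hψ.1.continuous
  have hcont := hψ.1.continuous
  exact hg.mul_bdd (c := B) (by fun_prop) (ae_of_all _ fun ζ => hB _)

lemma IsTest.exists_taylor_le (hψ : IsTest ψ) :
    ∃ B, 0 ≤ B ∧ ∀ x h, |ψ (x + h) - ψ x - h * deriv ψ x| ≤ B * h ^ 2 := by
  have hd := hasDerivAt_of_smooth hψ.1
  have hdd := hasDerivAt_of_smooth (contDiff_deriv hψ.1)
  obtain ⟨B, hB⟩ := hψ.2.deriv.deriv.exists_bound_of_continuous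
    (contDiff_deriv (contDiff_deriv hψ.1)).continuous
  have hB0 : 0 ≤ B := (norm_nonneg _).trans (hB 0)
  refine ⟨B, hB0, fun x h => ?_⟩
  have hlip : ∀ y z, |deriv ψ z - deriv ψ y| ≤ B * |z - y| := fun y z => by
    simpa [Real.norm_eq_abs] using convex_univ.norm_image_sub_le_of_norm_deriv_le
      (fun x _ => (hdd x).differentiableAt) (fun x _ => hB x) (mem_univ y) (mem_univ z)
  have hmean := (convex_uIcc x (x + h)).norm_image_sub_le_of_norm_hasDerivWithin_le
    (f := fun y => ψ y - y * deriv ψ x) (f' := fun y => deriv ψ y - deriv ψ x) (C := B * |h|)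
    (fun y _ => (((hd y).sub ((hasDerivAt_id y).mul_const _)).congr_deriv
      (by ring)).hasDerivWithinAt)
    (fun y hy => (hlip x y).trans (mul_le_mul_of_nonneg_left
      (by simpa using abs_sub_left_of_mem_uIcc hy) hB0))
    left_mem_uIcc right_mem_uIcc
  rw [Real.norm_eq_abs, Real.norm_eq_abs, add_sub_cancel_left] at hmean
  calc |ψ (x + h) - ψ x - h * deriv ψ x|
      = |ψ (x + h) - (x + h) * deriv ψ x - (ψ x - x * deriv ψ x)| := by ring_nf
    _ ≤ B * |h| * |h| := hmean
    _ = B * h ^ 2 := by rw [← sq_abs]; ring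

lemma abs_pairing_le (hg : DecaysIn id g) (hc : Continuous g) (hint : ∫ ζ, g ζ = 0)
    (hmoment : ∫ ζ, g ζ * ζ = 0) (hψ : IsTest ψ)
    (hB : ∀ x h, |ψ (x + h) - ψ x - h * deriv ψ x| ≤ B * h ^ 2) (x₀ s : ℝ) :
    |∫ ζ, g ζ * ψ (x₀ + s * ζ)| ≤ B * s ^ 2 * ∫ ζ, |ζ ^ 2 * g ζ| := by
  have hg₀ : Integrable g := hg.integrable hc
  have hg₁ : Integrable fun ζ => g ζ * ζ := by
    simpa [mul_comm] using hg.integrable_pow_mul hc 1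
  have hlin : Integrable fun ζ => ψ x₀ * g ζ + s * deriv ψ x₀ * (g ζ * ζ) :=
    (hg₀.const_mul _).add (hg₁.const_mul _)
  have hlin_zero : ∫ ζ, (ψ x₀ * g ζ + s * deriv ψ x₀ * (g ζ * ζ)) = 0 := by
    rw [integral_add (hg₀.const_mul _) (hg₁.const_mul _), integral_const_mul,
      integral_const_mul, hint, hmoment, mul_zero, mul_zero, add_zero]
  have hremainder : ∫ ζ, g ζ * ψ (x₀ + s * ζ)
      = ∫ ζ, g ζ * (ψ (x₀ + s * ζ) - ψ x₀ - s * ζ * deriv ψ x₀) := by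
    rw [← sub_zero (∫ ζ, g ζ * ψ (x₀ + s * ζ)), ← hlin_zero,
      ← integral_sub (integrable_mul_test hg₀ hψ x₀ s) hlin]
    congr 1 with ζ
    ring
  rw [hremainder, ← integral_const_mul]
  refine (norm_integral_le_integral_norm _).trans (integral_mono_of_nonneg
    (ae_of_all _ fun ζ => norm_nonneg (g ζ * _))
    ((hg.integrable_pow_mul hc 2).abs.const_mul _) (ae_of_all _ fun ζ => ?_))
  calc |g ζ * (ψ (x₀ + s * ζ) - ψ x₀ - s * ζ * deriv ψ x₀)|
      = |g ζ| * |ψ (x₀ + s * ζ) - ψ x₀ - s * ζ * deriv ψ x₀| := abs_mul _ _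
    _ ≤ |g ζ| * (B * (s * ζ) ^ 2) := by gcongr; exact hB x₀ (s * ζ)
    _ = B * s ^ 2 * |ζ ^ 2 * g ζ| := by rw [abs_mul, abs_pow, sq_abs]; ring

lemma IsTest.exists_abs_pairing_le (hψ : IsTest ψ) :
    ∃ B, 0 ≤ B ∧ ∀ g, Integrable g → ∀ x₀ s, |∫ ζ, g ζ * ψ (x₀ + s * ζ)| ≤ B * ∫ ζ, |g ζ| := by
  obtain ⟨B, hB⟩ := hψ.2.exists_bound_of_continuous hψ.1.continuous
  refine ⟨B, (norm_nonneg _).trans (hB 0), fun g hg x₀ s => ?_⟩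
  rw [← integral_const_mul]
  refine (norm_integral_le_integral_norm _).trans (integral_mono_of_nonneg
    (ae_of_all _ fun ζ => norm_nonneg (g ζ * _)) (hg.abs.const_mul B) (ae_of_all _ fun ζ => ?_))
  calc ‖g ζ * ψ (x₀ + s * ζ)‖ = ‖ψ (x₀ + s * ζ)‖ * |g ζ| := by rw [norm_mul, mul_comm]; rfl
    _ ≤ B * |g ζ| := by gcongr; exact hB _

end TestPairing

section WaveSplit

variable {c c₁ c₂ l l₁ l₂ φ ψ : ℝ → ℝ} {f : ℝ × ℝ → ℝ} {z : ℝ × ℝ}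

lemma DecaysIn.comp_sub (hl : DecaysIn id l) (y : ℝ) : DecaysIn id fun ζ => l (ζ - y) := by
  intro n
  obtain ⟨C, hC⟩ := hl.one_add_pow n
  refine ⟨(1 + |y|) ^ n * C, fun ζ => ?_⟩
  calc |ζ| ^ n * |l (ζ - y)| ≤ ((1 + |y|) * (1 + |ζ - y|)) ^ n * |l (ζ - y)| := by
        gcongr
        exact (le_add_of_nonneg_left zero_le_one).trans (one_add_abs_le_mul ζ y)
    _ = (1 + |y|) ^ n * ((1 + |ζ - y|) ^ n * |l (ζ - y)|) := by rw [mul_pow, mul_assoc]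
    _ ≤ (1 + |y|) ^ n * C := by gcongr; exact hC _

/-- What remains of a function of the fast variables `(τ, ζ)` after the waves of shapes `l₁` and
`l₂` travelling along `c₁` and `c₂` are removed. -/
def interaction (c₁ c₂ : ℝ → ℝ) (f : ℝ × ℝ → ℝ) (l₁ l₂ : ℝ → ℝ) : ℝ × ℝ → ℝ := fun z =>
  f z - l₁ (z.2 - c₁ z.1) - l₂ (z.2 - c₂ z.1)

/-- A continuous function of the fast variables `(τ, ζ)` which is the sum of waves of rapidly
decaying shapes `l₁` and `l₂` travelling along `c₁` and `c₂`, up to an interaction decaying rapidly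
in `ζ`, uniformly in `τ`. -/
structure WaveSplit (c₁ c₂ : ℝ → ℝ) (f : ℝ × ℝ → ℝ) (l₁ l₂ : ℝ → ℝ) : Prop where
  split : Split (fun z => z.2 - c₁ z.1) (fun z => z.2 - c₂ z.1) Prod.snd f
    (fun z => l₁ (z.2 - c₁ z.1)) (fun z => l₂ (z.2 - c₂ z.1))
  continuous : Continuous f
  continuous_left : Continuous l₁
  continuous_right : Continuous l₂

namespace WaveSplit

lemma decays_left (h : WaveSplit c₁ c₂ f l₁ l₂) : DecaysIn id l₁ := by
  simpa [Function.id_def] using h.split.left.comp fun ζ => (0, ζ + c₁ 0)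

lemma decays_right (h : WaveSplit c₁ c₂ f l₁ l₂) : DecaysIn id l₂ := by
  simpa [Function.id_def] using h.split.right.comp fun ζ => (0, ζ + c₂ 0)

lemma decays_interaction (h : WaveSplit c₁ c₂ f l₁ l₂) :
    DecaysIn Prod.snd (interaction c₁ c₂ f l₁ l₂) := h.split.rest

lemma continuous_interaction (h : WaveSplit c₁ c₂ f l₁ l₂) (τ : ℝ) :
    Continuous fun ζ => interaction c₁ c₂ f l₁ l₂ (τ, ζ) := by
  have hf := h.continuous
  have h₁ := h.continuous_left
  have h₂ := h.continuous_right
  simp only [interaction]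
  fun_prop

lemma continuous_section (h : WaveSplit c₁ c₂ f l₁ l₂) (τ : ℝ) : Continuous fun ζ => f (τ, ζ) :=
  h.continuous.comp (by fun_prop)

lemma decays_section (h : WaveSplit c₁ c₂ f l₁ l₂) (τ : ℝ) :
    DecaysIn id fun ζ => f (τ, ζ) := by
  convert ((h.decays_interaction.section_right τ).add (h.decays_left.comp_sub (c₁ τ))).add
    (h.decays_right.comp_sub (c₂ τ)) using 2
  simp only [interaction]
  ring

lemma integrable_section (h : WaveSplit c₁ c₂ f l₁ l₂) (τ : ℝ) :
    Integrable fun ζ => f (τ, ζ) :=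
  (h.decays_section τ).integrable (h.continuous_section τ)

lemma integral_mul (h : WaveSplit c₁ c₂ f l₁ l₂)
    (hφ : ∀ ⦃g : ℝ → ℝ⦄, DecaysIn id g → Continuous g → Integrable fun ζ => g ζ * φ ζ) (τ : ℝ) :
    ∫ ζ, f (τ, ζ) * φ ζ = (∫ ζ, interaction c₁ c₂ f l₁ l₂ (τ, ζ) * φ ζ)
      + (∫ ζ, l₁ ζ * φ (ζ + c₁ τ)) + ∫ ζ, l₂ ζ * φ (ζ + c₂ τ) := by
  have h₁ := h.continuous_left
  have h₂ := h.continuous_right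
  have hI := hφ (h.decays_interaction.section_right τ) (h.continuous_interaction τ)
  have hl₁ := hφ (h.decays_left.comp_sub (c₁ τ)) (by fun_prop)
  have hl₂ := hφ (h.decays_right.comp_sub (c₂ τ)) (by fun_prop)
  have hshift : ∀ (l : ℝ → ℝ) (y : ℝ), ∫ ζ, l (ζ - y) * φ ζ = ∫ ζ, l ζ * φ (ζ + y) := fun l y => by
    simpa using integral_sub_right_eq_self (μ := volume) (fun ζ => l ζ * φ (ζ + y)) y
  have hIl₁ : Integrable fun ζ =>
      interaction c₁ c₂ f l₁ l₂ (τ, ζ) * φ ζ + l₁ (ζ - c₁ τ) * φ ζ := hI.add hl₁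
  rw [← hshift, ← hshift, ← integral_add hI hl₁, ← integral_add hIl₁ hl₂]
  congr 1 with ζ
  simp only [interaction]
  ring

lemma integral_eq (h : WaveSplit c₁ c₂ f l₁ l₂) (τ : ℝ) :
    ∫ ζ, f (τ, ζ) = (∫ ζ, interaction c₁ c₂ f l₁ l₂ (τ, ζ)) + (∫ ζ, l₁ ζ) + ∫ ζ, l₂ ζ := by
  simpa using h.integral_mul (φ := fun _ => 1)
    (fun _ hg hc => by simpa using hg.integrable hc) τ

lemma integral_mul_id_eq (h : WaveSplit c₁ c₂ f l₁ l₂) (τ : ℝ) :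
    ∫ ζ, f (τ, ζ) * ζ = (∫ ζ, interaction c₁ c₂ f l₁ l₂ (τ, ζ) * ζ)
      + ((∫ ζ, l₁ ζ * ζ) + c₁ τ * ∫ ζ, l₁ ζ) + ((∫ ζ, l₂ ζ * ζ) + c₂ τ * ∫ ζ, l₂ ζ) := by
  have hint : ∀ ⦃g : ℝ → ℝ⦄, DecaysIn id g → Continuous g → Integrable fun ζ => g ζ * ζ :=
    fun g hg hc => by simpa [mul_comm] using hg.integrable_pow_mul hc 1
  have hshift : ∀ ⦃l : ℝ → ℝ⦄, DecaysIn id l → Continuous l → ∀ y,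
      ∫ ζ, l ζ * (ζ + y) = (∫ ζ, l ζ * ζ) + y * ∫ ζ, l ζ := fun l hl hc y => by
    rw [← integral_const_mul, ← integral_add (hint hl hc) ((hl.integrable hc).const_mul y)]
    congr 1 with ζ
    ring
  rw [h.integral_mul hint, hshift h.decays_left h.continuous_left,
    hshift h.decays_right h.continuous_right]

lemma pairing_bounded (h : WaveSplit c₁ c₂ f l₁ l₂) (x₀ b : ℝ) (hψ : IsTest ψ) :
    ∃ C, ∀ ε τ : ℝ, |∫ ζ, f (τ, ζ) * ψ (x₀ + ε * (b⁻¹ * ζ))| ≤ C := by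
  obtain ⟨B, hB0, hB⟩ := hψ.exists_abs_pairing_le
  obtain ⟨C, hC⟩ := h.decays_interaction.exists_integral_abs_le h.continuous_interaction 0
  refine ⟨B * C + B * (∫ ζ, |l₁ ζ|) + B * ∫ ζ, |l₂ ζ|, fun ε τ => ?_⟩
  have hcentre : ∀ ζ y, x₀ + ε * b⁻¹ * (ζ + y) = x₀ + ε * b⁻¹ * y + ε * b⁻¹ * ζ :=
    fun ζ y => by ring
  simp only [← mul_assoc]
  rw [h.integral_mul fun g hg hc => integrable_mul_test (hg.integrable hc) hψ x₀ (ε * b⁻¹)]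
  have hI := hB _ ((h.decays_interaction.section_right τ).integrable (h.continuous_interaction τ))
    x₀ (ε * b⁻¹)
  have hCτ : ∫ ζ, |interaction c₁ c₂ f l₁ l₂ (τ, ζ)| ≤ C := by simpa using hC τ
  simp only [hcentre]
  refine (abs_add_three _ _ _).trans (add_le_add_three ?_ ?_ ?_)
  · exact hI.trans (mul_le_mul_of_nonneg_left hCτ hB0)
  · exact hB _ (h.decays_left.integrable h.continuous_left) _ _
  · exact hB _ (h.decays_right.integrable h.continuous_right) _ _

/-- The moments of the interaction vanish as well, so the three parts of `f` can be paired
separately, each one expanded about its own centre. -/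
lemma pairing_quadratic (h : WaveSplit c₁ c₂ f l₁ l₂)
    (hl₁ : ∫ ζ, l₁ ζ = 0) (hl₁' : ∫ ζ, l₁ ζ * ζ = 0) (hl₂ : ∫ ζ, l₂ ζ = 0)
    (hl₂' : ∫ ζ, l₂ ζ * ζ = 0) (hf : ∀ τ, ∫ ζ, f (τ, ζ) = 0) (hf' : ∀ τ, ∫ ζ, f (τ, ζ) * ζ = 0)
    (x₀ b : ℝ) (hψ : IsTest ψ) :
    ∃ C, ∀ ε τ : ℝ, |∫ ζ, f (τ, ζ) * ψ (x₀ + ε * (b⁻¹ * ζ))| ≤ C * ε ^ 2 := by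
  obtain ⟨B, hB0, hB⟩ := hψ.exists_taylor_le
  obtain ⟨C, hC⟩ := h.decays_interaction.exists_integral_abs_le h.continuous_interaction 2
  refine ⟨B * b⁻¹ ^ 2 * (C + (∫ ζ, |ζ ^ 2 * l₁ ζ|) + ∫ ζ, |ζ ^ 2 * l₂ ζ|), fun ε τ => ?_⟩
  have hI : ∫ ζ, interaction c₁ c₂ f l₁ l₂ (τ, ζ) = 0 := by
    simpa [hf, hl₁, hl₂] using (h.integral_eq τ).symm
  have hI' : ∫ ζ, interaction c₁ c₂ f l₁ l₂ (τ, ζ) * ζ = 0 := by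
    simpa [hf', hl₁, hl₂, hl₁', hl₂'] using (h.integral_mul_id_eq τ).symm
  have hcentre : ∀ ζ y, x₀ + ε * b⁻¹ * (ζ + y) = x₀ + ε * b⁻¹ * y + ε * b⁻¹ * ζ :=
    fun ζ y => by ring
  simp only [← mul_assoc]
  rw [h.integral_mul fun g hg hc => integrable_mul_test (hg.integrable hc) hψ x₀ (ε * b⁻¹)]
  simp only [hcentre]
  refine (abs_add_three _ _ _).trans <| (add_le_add_three
    ((abs_pairing_le (h.decays_interaction.section_right τ) (h.continuous_interaction τ) hI hI'
      hψ hB _ _).trans (mul_le_mul_of_nonneg_left (hC τ) (by positivity)))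
    (abs_pairing_le h.decays_left h.continuous_left hl₁ hl₁' hψ hB _ _)
    (abs_pairing_le h.decays_right h.continuous_right hl₂ hl₂' hψ hB _ _)).trans_eq ?_
  ring

end WaveSplit

end WaveSplit

/-! ### Rapidly attained limits -/

section RapidLimits

variable {f : ℝ → ℝ} {L : ℝ}

/-- For `0 ≤ τ` the weight `τ ^ n` may be moved under the integral `L - f τ = ∫_τ^∞ f'`. -/
lemma exists_pow_mul_abs_sub_le_atTop (hf : ContDiff ℝ ∞ f) (hd : DecaysIn id (deriv f))
    (hlim : Tendsto f atTop (𝓝 L)) (n : ℕ) : ∃ C, ∀ τ ≥ 0, |τ| ^ n * |f τ - L| ≤ C := by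
  have hcont := (contDiff_deriv hf).continuous
  have hint := hd.integrable hcont
  have hpow := (hd.integrable_pow_mul hcont n).abs
  refine ⟨∫ t, |t ^ n * deriv f t|, fun τ hτ => ?_⟩
  have hFTC : ∫ t in Ioi τ, deriv f t = L - f τ := integral_Ioi_of_hasDerivAt_of_tendsto
    hf.continuous.continuousWithinAt (fun t _ => hasDerivAt_of_smooth hf t)
    hint.integrableOn hlim
  calc |τ| ^ n * |f τ - L| = |τ| ^ n * |∫ t in Ioi τ, deriv f t| := by rw [hFTC, abs_sub_comm]
    _ ≤ |τ| ^ n * ∫ t in Ioi τ, |deriv f t| := by gcongr; exact abs_integral_le_integral_abs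
    _ = ∫ t in Ioi τ, |τ| ^ n * |deriv f t| := (integral_const_mul _ _).symm
    _ ≤ ∫ t in Ioi τ, |t ^ n * deriv f t| := by
        refine setIntegral_mono_on (hint.abs.const_mul _).integrableOn hpow.integrableOn
          measurableSet_Ioi fun t ht => ?_
        rw [abs_mul, abs_pow]
        gcongr
        exact (mem_Ioi.1 ht).le
    _ ≤ ∫ t, |t ^ n * deriv f t| :=
        setIntegral_le_integral hpow (ae_of_all _ fun t => abs_nonneg _)

lemma exists_pow_mul_abs_sub_le_atBot (hf : ContDiff ℝ ∞ f) (hd : DecaysIn id (deriv f))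
    (hlim : Tendsto f atBot (𝓝 L)) (n : ℕ) : ∃ C, ∀ τ ≤ 0, |τ| ^ n * |f τ - L| ≤ C := by
  have hd' : DecaysIn id (deriv fun t => f (-t)) := fun n => (hd n).imp fun C hC τ => by
    simpa [deriv_comp_neg] using hC (-τ)
  obtain ⟨C, hC⟩ := exists_pow_mul_abs_sub_le_atTop (f := fun t => f (-t))
    (hf.comp contDiff_neg) hd' (hlim.comp tendsto_neg_atTop_atBot) n
  exact ⟨C, fun τ hτ => by simpa using hC (-τ) (neg_nonneg.2 hτ)⟩

lemma decaysIn_sub_of_tendsto (hf : ContDiff ℝ ∞ f) (hd : DecaysIn id (deriv f))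
    (hbot : Tendsto f atBot (𝓝 L)) (htop : Tendsto f atTop (𝓝 L)) :
    DecaysIn id fun τ => f τ - L := by
  intro n
  obtain ⟨C, hC⟩ := exists_pow_mul_abs_sub_le_atBot hf hd hbot n
  obtain ⟨D, hD⟩ := exists_pow_mul_abs_sub_le_atTop hf hd htop n
  refine ⟨max C D, fun τ => ?_⟩
  rcases le_total τ 0 with h | h
  exacts [(hC τ h).trans (le_max_left _ _), (hD τ h).trans (le_max_right _ _)]

end RapidLimits

/-! ### Superpositions of two waves -/

/-- The superposition `g₀ w₀(ζ - c₀) + g₁ w₁(ζ - c₁)` of waves of shapes `wᵢ`, with amplitudes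
`gᵢ` and trajectories `cᵢ` depending on `τ`. -/
def waves (c g w : Fin 2 → ℝ → ℝ) (τ ζ : ℝ) : ℝ :=
  g 0 τ * w 0 (ζ - c 0 τ) + g 1 τ * w 1 (ζ - c 1 τ)

section Waves

variable {c g w : Fin 2 → ℝ → ℝ} {A : Fin 2 → ℝ}

lemma hasDerivAt_waves_right (hw : ∀ i, ContDiff ℝ ∞ (w i)) (τ ζ : ℝ) :
    HasDerivAt (fun ζ => waves c g w τ ζ) (waves c g (fun i => deriv (w i)) τ ζ) ζ := by
  have hwave : ∀ i, HasDerivAt (fun ζ => g i τ * w i (ζ - c i τ))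
      (g i τ * deriv (w i) (ζ - c i τ)) ζ := fun i =>
    (((hasDerivAt_of_smooth (hw i) _).comp ζ ((hasDerivAt_id ζ).sub_const (c i τ))).const_mul
      (g i τ)).congr_deriv (by simp)
  exact (hwave 0).add (hwave 1)

lemma hasDerivAt_waves_left (hw : ∀ i, ContDiff ℝ ∞ (w i)) {g' c' : Fin 2 → ℝ → ℝ}
    (hc : ∀ i τ, HasDerivAt (c i) (c' i τ) τ) (hg : ∀ i τ, HasDerivAt (g i) (g' i τ) τ)
    (τ ζ : ℝ) :
    HasDerivAt (fun τ => waves c g w τ ζ) (waves c g' w τ ζ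
      - waves c (fun i τ => g i τ * c' i τ) (fun i => deriv (w i)) τ ζ) τ := by
  have hwave : ∀ i, HasDerivAt (fun τ => g i τ * w i (ζ - c i τ))
      (g' i τ * w i (ζ - c i τ) - g i τ * c' i τ * deriv (w i) (ζ - c i τ)) τ := fun i =>
    ((hg i τ).mul ((hasDerivAt_of_smooth (hw i) _).comp τ ((hc i τ).const_sub ζ))).congr_deriv
      (by simp only [Function.comp]; ring)
  exact ((hwave 0).add (hwave 1)).congr_deriv (by simp only [waves]; ring)

lemma contDiff_waves (hw : ∀ i, ContDiff ℝ ∞ (w i)) (hc : ∀ i, ContDiff ℝ ∞ (c i))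
    (hg : ∀ i, ContDiff ℝ ∞ (g i)) : ContDiff ℝ ∞ (fun z : ℝ × ℝ => waves c g w z.1 z.2) := by
  have hwave : ∀ i, ContDiff ℝ ∞ (fun z : ℝ × ℝ => g i z.1 * w i (z.2 - c i z.1)) := fun i =>
    ((hg i).comp contDiff_fst).mul ((hw i).comp (contDiff_snd.sub ((hc i).comp contDiff_fst)))
  exact (hwave 0).add (hwave 1)

lemma WaveSplit.of_waves (h : Separating (c 0) (c 1)) (hc : ∀ i, Continuous (c i))
    (hg : ∀ i, Continuous (g i)) (hw : ∀ i, Continuous (w i))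
    (hgA : ∀ i, DecaysIn id fun τ => g i τ - A i) (hwd : ∀ i, DecaysIn id (w i)) :
    WaveSplit (c 0) (c 1) (fun z => waves c g w z.1 z.2)
      (fun ζ => A 0 * w 0 ζ) (fun ζ => A 1 * w 1 ζ) := by
  have hwave : ∀ i, DecaysIn (X := ℝ × ℝ) (fun z => z.2 - c i z.1)
      (fun z => w i (z.2 - c i z.1)) := fun i => (hwd i).comp fun z : ℝ × ℝ => z.2 - c i z.1
  have hamp : ∀ i, DecaysIn (X := ℝ × ℝ) Prod.fst (fun z => g i z.1 - A i) := fun i =>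
    (hgA i).comp Prod.fst
  refine ⟨⟨(hwave 0).const_mul _, (hwave 1).const_mul _, ?_⟩, ?_, (hw 0).const_mul _,
    (hw 1).const_mul _⟩
  · convert ((hamp 0).mul_of_polyDominated (hwave 0) (polyDominated_of_linear_growth h.left)).add
      ((hamp 1).mul_of_polyDominated (hwave 1) (polyDominated_of_linear_growth h.right)) using 2
    simp only [waves]
    ring
  · simp only [waves]
    fun_prop

end Waves

namespace WaveSplit

variable {c₁ c₂ a b a' b' : ℝ → ℝ} {f g : ℝ × ℝ → ℝ}

lemma add (hf : WaveSplit c₁ c₂ f a b) (hg : WaveSplit c₁ c₂ g a' b') :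
    WaveSplit c₁ c₂ (fun z => f z + g z) (fun ζ => a ζ + a' ζ) (fun ζ => b ζ + b' ζ) :=
  ⟨hf.split.add hg.split, hf.continuous.add hg.continuous,
    hf.continuous_left.add hg.continuous_left, hf.continuous_right.add hg.continuous_right⟩

lemma const_mul (hf : WaveSplit c₁ c₂ f a b) (k : ℝ) :
    WaveSplit c₁ c₂ (fun z => k * f z) (fun ζ => k * a ζ) (fun ζ => k * b ζ) :=
  ⟨hf.split.const_mul k, hf.continuous.const_mul k, hf.continuous_left.const_mul k,
    hf.continuous_right.const_mul k⟩

lemma mul (h : Separating c₁ c₂) (hf : WaveSplit c₁ c₂ f a b) (hg : WaveSplit c₁ c₂ g a' b') :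
    WaveSplit c₁ c₂ (fun z => f z * g z) (fun ζ => a ζ * a' ζ) (fun ζ => b ζ * b' ζ) :=
  ⟨hf.split.mul h.polyDominated hg.split, hf.continuous.mul hg.continuous,
    hf.continuous_left.mul hg.continuous_left, hf.continuous_right.mul hg.continuous_right⟩

end WaveSplit

/-! ### The laws as polynomials in the derivatives -/

/-- The conservation law in terms of `u`, `p = εuₓ`, `q = ε²uₓₓ`, `s = εuₜ`. -/
def Params.poly1 (P : Params) (u p q s : ℝ) : ℝ :=
  s + P.c0 * p + 2 * P.c1 * (u * p) + -2 * (P.c2 - P.c3) * (p * q)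

/-- The time derivative `2us + 2α²pz` of the density `u² + α²p²`, where `s = uₜ` and `z = pₜ`. -/
def Params.rate2 (P : Params) (u p s z : ℝ) : ℝ := 2 * (u * s) + 2 * P.α ^ 2 * (p * z)

/-- The balance law in terms of `u`, `p = εuₓ`, `q = ε²uₓₓ`, `s = εuₜ`, `z = ε²uₓₜ`. -/
def Params.poly2 (P : Params) (u p q s z : ℝ) : ℝ :=
  P.rate2 u p s z + (2 * P.c0 * (u * p) + 4 * P.c1 * (u * (u * p))
    + -(2 * P.c2 - 5 * P.c3) * (p * (p * p)) + -6 * P.γ * (p * q)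
    + -2 * (2 * P.c2 - 5 * P.c3) * (u * (p * q)) + 2 * P.α ^ 2 * (q * s + p * z))
    + (2 * P.c2 - P.c3) * (p * (p * p))

section Densities

variable (P : Params) {u p : ℝ → ℝ} {u' p' x : ℝ}

lemma Params.hasDerivAt_p1 (hu : HasDerivAt u u' x) (hp : HasDerivAt p p' x) :
    HasDerivAt (fun x => P.p1 (u x) (p x))
      (P.c0 * u' + 2 * P.c1 * (u x * u') + -2 * (P.c2 - P.c3) * (p x * p')) x := by
  refine (((hu.const_mul P.c0).add ((hu.pow 2).const_mul P.c1)).sub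
    ((hp.pow 2).const_mul (P.c2 - P.c3))).congr_deriv ?_
  push_cast; ring

lemma Params.hasDerivAt_q2 (hu : HasDerivAt u u' x) (hp : HasDerivAt p p' x) :
    HasDerivAt (fun x => P.q2 (u x) (p x)) (P.rate2 (u x) (p x) u' p') x := by
  refine ((hu.pow 2).add ((hp.pow 2).const_mul (P.α ^ 2))).congr_deriv ?_
  simp only [Params.rate2]
  push_cast; ring

lemma Params.hasDerivAt_pp2 (hu : HasDerivAt u u' x) (hp : HasDerivAt p p' x) :
    HasDerivAt (fun x => P.pp2 (u x) (p x))
      (2 * P.c0 * (u x * u') + 4 * P.c1 * (u x * (u x * u'))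
        + -(2 * P.c2 - 5 * P.c3) * (u' * (p x * p x)) + -6 * P.γ * (p x * p')
        + -2 * (2 * P.c2 - 5 * P.c3) * (u x * (p x * p'))) x := by
  refine ((((hu.pow 2).const_mul P.c0).add ((hu.pow 3).const_mul (4 / 3 * P.c1))).sub
    (((hu.const_mul (2 * P.c2 - 5 * P.c3)).const_add (3 * P.γ)).mul (hp.pow 2))).congr_deriv ?_
  simp only [Pi.pow_apply]
  push_cast; ring

end Densities

section FastLaws

variable {P : Params} {a : ℝ} {U Ux Uxx Us Usx : ℝ → ℝ → ℝ}

lemma Params.fastLaw1_eq (hβ : P.β ≠ 0) (ha : a ≠ 0)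
    (hx : ∀ τ ζ, HasDerivAt (fun ζ => U τ ζ) (P.β⁻¹ * Ux τ ζ) ζ)
    (hxx : ∀ τ ζ, HasDerivAt (fun ζ => Ux τ ζ) (P.β⁻¹ * Uxx τ ζ) ζ)
    (ht : ∀ τ ζ, HasDerivAt (fun τ => U τ ζ) (a⁻¹ * Us τ ζ) τ) (τ ζ : ℝ) :
    P.fastLaw1 U a τ ζ = P.poly1 (U τ ζ) (Ux τ ζ) (Uxx τ ζ) (Us τ ζ) := by
  have hdx : ∀ τ ζ, P.β * dx U τ ζ = Ux τ ζ := fun τ ζ => by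
    rw [dx, (hx τ ζ).deriv, mul_inv_cancel_left₀ hβ]
  simp only [Params.fastLaw1, hdx]
  rw [dt, (ht τ ζ).deriv, dx, (P.hasDerivAt_p1 (hx τ ζ) (hxx τ ζ)).deriv]
  simp only [Params.poly1]
  field_simp
  ring

lemma Params.fastLaw2_eq (hβ : P.β ≠ 0) (ha : a ≠ 0)
    (hx : ∀ τ ζ, HasDerivAt (fun ζ => U τ ζ) (P.β⁻¹ * Ux τ ζ) ζ)
    (hxx : ∀ τ ζ, HasDerivAt (fun ζ => Ux τ ζ) (P.β⁻¹ * Uxx τ ζ) ζ)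
    (ht : ∀ τ ζ, HasDerivAt (fun τ => U τ ζ) (a⁻¹ * Us τ ζ) τ)
    (hxt : ∀ τ ζ, HasDerivAt (fun τ => Ux τ ζ) (a⁻¹ * Usx τ ζ) τ)
    (htx : ∀ τ ζ, HasDerivAt (fun ζ => Us τ ζ) (P.β⁻¹ * Usx τ ζ) ζ) (τ ζ : ℝ) :
    P.fastLaw2 U a τ ζ = P.poly2 (U τ ζ) (Ux τ ζ) (Uxx τ ζ) (Us τ ζ) (Usx τ ζ) := by
  have hdx : ∀ τ ζ, P.β * dx U τ ζ = Ux τ ζ := fun τ ζ => by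
    rw [dx, (hx τ ζ).deriv, mul_inv_cancel_left₀ hβ]
  have hdt : ∀ τ ζ, a * dt U τ ζ = Us τ ζ := fun τ ζ => by
    rw [dt, (ht τ ζ).deriv, mul_inv_cancel_left₀ ha]
  have hflux : HasDerivAt (fun ζ => P.pp2 (U τ ζ) (Ux τ ζ) + 2 * P.α ^ 2 * Ux τ ζ * Us τ ζ) _ ζ :=
    (P.hasDerivAt_pp2 (hx τ ζ) (hxx τ ζ)).add
      (((hxx τ ζ).const_mul (2 * P.α ^ 2)).mul (htx τ ζ))
  simp only [Params.fastLaw2, hdx, hdt]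
  rw [dt, (P.hasDerivAt_q2 (ht τ ζ) (hxt τ ζ)).deriv, dx, hflux.deriv]
  simp only [Params.poly2, Params.rate2, Params.k2]
  field_simp

end FastLaws

namespace WaveSplit

variable {c₁ c₂ a₀ a₁ a₂ a₃ a₄ b₀ b₁ b₂ b₃ b₄ : ℝ → ℝ} {u p q s z : ℝ × ℝ → ℝ}

lemma p1 (h : Separating c₁ c₂) (P : Params) (hu : WaveSplit c₁ c₂ u a₀ b₀)
    (hp : WaveSplit c₁ c₂ p a₁ b₁) :
    WaveSplit c₁ c₂ (fun x => P.p1 (u x) (p x)) (fun ζ => P.p1 (a₀ ζ) (a₁ ζ))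
      (fun ζ => P.p1 (b₀ ζ) (b₁ ζ)) := by
  convert ((hu.const_mul P.c0).add ((hu.mul h hu).const_mul P.c1)).add
    ((hp.mul h hp).const_mul (-(P.c2 - P.c3))) using 2 <;> simp only [Params.p1] <;> ring

lemma q2 (h : Separating c₁ c₂) (P : Params) (hu : WaveSplit c₁ c₂ u a₀ b₀)
    (hp : WaveSplit c₁ c₂ p a₁ b₁) :
    WaveSplit c₁ c₂ (fun x => P.q2 (u x) (p x)) (fun ζ => P.q2 (a₀ ζ) (a₁ ζ))
      (fun ζ => P.q2 (b₀ ζ) (b₁ ζ)) := by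
  convert (hu.mul h hu).add ((hp.mul h hp).const_mul (P.α ^ 2)) using 2 <;>
    simp only [Params.q2] <;> ring

lemma pp2 (h : Separating c₁ c₂) (P : Params) (hu : WaveSplit c₁ c₂ u a₀ b₀)
    (hp : WaveSplit c₁ c₂ p a₁ b₁) :
    WaveSplit c₁ c₂ (fun x => P.pp2 (u x) (p x)) (fun ζ => P.pp2 (a₀ ζ) (a₁ ζ))
      (fun ζ => P.pp2 (b₀ ζ) (b₁ ζ)) := by
  convert ((((hu.mul h hu).const_mul P.c0).add
    ((hu.mul h (hu.mul h hu)).const_mul (4 / 3 * P.c1))).add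
    ((hp.mul h hp).const_mul (-3 * P.γ))).add
    ((hu.mul h (hp.mul h hp)).const_mul (-(2 * P.c2 - 5 * P.c3))) using 2 <;>
    simp only [Params.pp2] <;> ring

lemma k2 (h : Separating c₁ c₂) (P : Params) (hp : WaveSplit c₁ c₂ p a₁ b₁) :
    WaveSplit c₁ c₂ (fun x => P.k2 (u x) (p x)) (fun ζ => P.k2 (a₀ ζ) (a₁ ζ))
      (fun ζ => P.k2 (b₀ ζ) (b₁ ζ)) := by
  convert (hp.mul h (hp.mul h hp)).const_mul (2 * P.c2 - P.c3) using 2 <;>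
    simp only [Params.k2] <;> ring

lemma poly1 (h : Separating c₁ c₂) (P : Params) (hu : WaveSplit c₁ c₂ u a₀ b₀)
    (hp : WaveSplit c₁ c₂ p a₁ b₁) (hq : WaveSplit c₁ c₂ q a₂ b₂)
    (hs : WaveSplit c₁ c₂ s a₃ b₃) :
    WaveSplit c₁ c₂ (fun x => P.poly1 (u x) (p x) (q x) (s x))
      (fun ζ => P.poly1 (a₀ ζ) (a₁ ζ) (a₂ ζ) (a₃ ζ))
      (fun ζ => P.poly1 (b₀ ζ) (b₁ ζ) (b₂ ζ) (b₃ ζ)) :=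
  ((hs.add (hp.const_mul P.c0)).add ((hu.mul h hp).const_mul (2 * P.c1))).add
    ((hp.mul h hq).const_mul (-2 * (P.c2 - P.c3)))

lemma rate2 (h : Separating c₁ c₂) (P : Params) (hu : WaveSplit c₁ c₂ u a₀ b₀)
    (hp : WaveSplit c₁ c₂ p a₁ b₁) (hs : WaveSplit c₁ c₂ s a₃ b₃)
    (hz : WaveSplit c₁ c₂ z a₄ b₄) :
    WaveSplit c₁ c₂ (fun x => P.rate2 (u x) (p x) (s x) (z x))
      (fun ζ => P.rate2 (a₀ ζ) (a₁ ζ) (a₃ ζ) (a₄ ζ))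
      (fun ζ => P.rate2 (b₀ ζ) (b₁ ζ) (b₃ ζ) (b₄ ζ)) :=
  ((hu.mul h hs).const_mul 2).add ((hp.mul h hz).const_mul (2 * P.α ^ 2))

lemma poly2 (h : Separating c₁ c₂) (P : Params) (hu : WaveSplit c₁ c₂ u a₀ b₀)
    (hp : WaveSplit c₁ c₂ p a₁ b₁) (hq : WaveSplit c₁ c₂ q a₂ b₂)
    (hs : WaveSplit c₁ c₂ s a₃ b₃) (hz : WaveSplit c₁ c₂ z a₄ b₄) :
    WaveSplit c₁ c₂ (fun x => P.poly2 (u x) (p x) (q x) (s x) (z x))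
      (fun ζ => P.poly2 (a₀ ζ) (a₁ ζ) (a₂ ζ) (a₃ ζ) (a₄ ζ))
      (fun ζ => P.poly2 (b₀ ζ) (b₁ ζ) (b₂ ζ) (b₃ ζ) (b₄ ζ)) :=
  ((hu.rate2 h P hp hs hz).add
    (((((((hu.mul h hp).const_mul (2 * P.c0)).add
    ((hu.mul h (hu.mul h hp)).const_mul (4 * P.c1))).add
    ((hp.mul h (hp.mul h hp)).const_mul (-(2 * P.c2 - 5 * P.c3)))).add
    ((hp.mul h hq).const_mul (-6 * P.γ))).add
    ((hu.mul h (hp.mul h hq)).const_mul (-2 * (2 * P.c2 - 5 * P.c3)))).add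
    (((hq.mul h hs).add (hp.mul h hz)).const_mul (2 * P.α ^ 2)))).add
    ((hp.mul h (hp.mul h hp)).const_mul (2 * P.c2 - P.c3))

end WaveSplit

/-! ### The ansatz in the fast variables -/

/-- The standing assumptions on the two solitons and on the corrections. -/
structure Pair.Regular (D : Pair) (P : Params) (c : Corr) (φlim : Fin 2 → ℝ) : Prop where
  adm : P.Admissible
  profile : ∀ i, P.IsProfile (D.A i) (D.V i) (D.w i)
  c0_lt : ∀ i, P.c0 < D.V i
  psi : 0 < D.psiDot P
  lim : c.HasLimits φlim

/-- The trajectory `β χᵢ` of the `i`-th wave in the fast variables `τ` and `ζ = β (x - x*) / ε`. -/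
def Pair.center (D : Pair) (P : Params) (c : Corr) (i : Fin 2) (τ : ℝ) : ℝ := P.β * D.χ P c i τ

/-- `ε dGᵢ/dt`, the rate of change of the `i`-th amplitude. -/
def Pair.ampRate (D : Pair) (P : Params) (c : Corr) (i : Fin 2) (τ : ℝ) : ℝ :=
  D.psiDot P * deriv (c.S i) τ

/-- `Gᵢ φ̇ᵢ`, the amplitude of the `i`-th wave in the transport part of `εuₜ`. -/
def Pair.flow (D : Pair) (P : Params) (c : Corr) (i : Fin 2) (τ : ℝ) : ℝ :=
  D.G c i τ * D.phiDot P c i τ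

/-- The ansatz `u` in the fast variables. -/
def Pair.fast (D : Pair) (P : Params) (c : Corr) (τ ζ : ℝ) : ℝ :=
  waves (D.center P c) (D.G c) D.w τ ζ

/-- `εuₓ` in the fast variables. -/
def Pair.fastX (D : Pair) (P : Params) (c : Corr) (τ ζ : ℝ) : ℝ :=
  P.β * waves (D.center P c) (D.G c) (fun i => deriv (D.w i)) τ ζ

/-- `ε²uₓₓ` in the fast variables. -/
def Pair.fastXX (D : Pair) (P : Params) (c : Corr) (τ ζ : ℝ) : ℝ :=
  P.β ^ 2 * waves (D.center P c) (D.G c) (fun i => deriv (deriv (D.w i))) τ ζ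

/-- `εuₜ` in the fast variables. -/
def Pair.fastT (D : Pair) (P : Params) (c : Corr) (τ ζ : ℝ) : ℝ :=
  waves (D.center P c) (D.ampRate P c) D.w τ ζ
    - P.β * waves (D.center P c) (D.flow P c) (fun i => deriv (D.w i)) τ ζ

/-- `ε²uₓₜ` in the fast variables. -/
def Pair.fastXT (D : Pair) (P : Params) (c : Corr) (τ ζ : ℝ) : ℝ :=
  P.β * waves (D.center P c) (D.ampRate P c) (fun i => deriv (D.w i)) τ ζ
    - P.β ^ 2 * waves (D.center P c) (D.flow P c) (fun i => deriv (deriv (D.w i))) τ ζ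

namespace Pair.Regular

variable {D : Pair} {P : Params} {c : Corr} {φlim : Fin 2 → ℝ}

lemma smooth_w (h : D.Regular P c φlim) (i : Fin 2) : ContDiff ℝ ∞ (D.w i) := (h.profile i).smooth

lemma smooth_deriv_w (h : D.Regular P c φlim) (i : Fin 2) : ContDiff ℝ ∞ (deriv (D.w i)) :=
  contDiff_deriv (h.smooth_w i)

lemma smooth_deriv_deriv_w (h : D.Regular P c φlim) (i : Fin 2) :
    ContDiff ℝ ∞ (deriv (deriv (D.w i))) := contDiff_deriv (h.smooth_deriv_w i)

lemma smooth_G (h : D.Regular P c φlim) (i : Fin 2) : ContDiff ℝ ∞ (D.G c i) :=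
  contDiff_const.add (h.lim.smooth_S i)

lemma smooth_χ (h : D.Regular P c φlim) (i : Fin 2) : ContDiff ℝ ∞ (D.χ P c i) :=
  ((contDiff_const.mul contDiff_id).div_const _).add (h.lim.smooth_φ i)

lemma smooth_center (h : D.Regular P c φlim) (i : Fin 2) : ContDiff ℝ ∞ (D.center P c i) :=
  contDiff_const.mul (h.smooth_χ i)

lemma smooth_ampRate (h : D.Regular P c φlim) (i : Fin 2) : ContDiff ℝ ∞ (D.ampRate P c i) :=
  contDiff_const.mul (contDiff_deriv (h.lim.smooth_S i))

lemma smooth_flow (h : D.Regular P c φlim) (i : Fin 2) : ContDiff ℝ ∞ (D.flow P c i) :=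
  (h.smooth_G i).mul (contDiff_const.add (contDiff_const.mul (contDiff_deriv (h.lim.smooth_φ i))))

lemma hasDerivAt_G (h : D.Regular P c φlim) (i : Fin 2) (τ : ℝ) :
    HasDerivAt (D.G c i) ((D.psiDot P)⁻¹ * D.ampRate P c i τ) τ := by
  refine ((hasDerivAt_of_smooth (h.lim.smooth_S i) τ).const_add (D.A i)).congr_deriv ?_
  rw [Pair.ampRate, inv_mul_cancel_left₀ h.psi.ne']

lemma hasDerivAt_χ (h : D.Regular P c φlim) (i : Fin 2) (τ : ℝ) :
    HasDerivAt (D.χ P c i) ((D.psiDot P)⁻¹ * D.phiDot P c i τ) τ := by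
  refine ((((hasDerivAt_id τ).const_mul (D.V i)).div_const (D.psiDot P)).add
    (hasDerivAt_of_smooth (h.lim.smooth_φ i) τ)).congr_deriv ?_
  have := h.psi.ne'
  rw [Pair.phiDot]
  field_simp

lemma hasDerivAt_fast_right (h : D.Regular P c φlim) (τ ζ : ℝ) :
    HasDerivAt (fun ζ => D.fast P c τ ζ) (P.β⁻¹ * D.fastX P c τ ζ) ζ :=
  (hasDerivAt_waves_right h.smooth_w τ ζ).congr_deriv (by
    rw [Pair.fastX, inv_mul_cancel_left₀ h.adm.β_pos.ne'])

lemma hasDerivAt_fastX_right (h : D.Regular P c φlim) (τ ζ : ℝ) :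
    HasDerivAt (fun ζ => D.fastX P c τ ζ) (P.β⁻¹ * D.fastXX P c τ ζ) ζ :=
  ((hasDerivAt_waves_right h.smooth_deriv_w τ ζ).const_mul P.β).congr_deriv (by
    rw [Pair.fastXX, pow_two, mul_assoc, inv_mul_cancel_left₀ h.adm.β_pos.ne'])

lemma hasDerivAt_fastT_right (h : D.Regular P c φlim) (τ ζ : ℝ) :
    HasDerivAt (fun ζ => D.fastT P c τ ζ) (P.β⁻¹ * D.fastXT P c τ ζ) ζ :=
  ((hasDerivAt_waves_right h.smooth_w τ ζ).sub
    ((hasDerivAt_waves_right h.smooth_deriv_w τ ζ).const_mul P.β)).congr_deriv (by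
      have := h.adm.β_pos.ne'
      rw [Pair.fastXT]
      field_simp)

lemma hasDerivAt_waves_G_left {w : Fin 2 → ℝ → ℝ} (h : D.Regular P c φlim)
    (hw : ∀ i, ContDiff ℝ ∞ (w i)) (τ ζ : ℝ) :
    HasDerivAt (fun τ => waves (D.center P c) (D.G c) w τ ζ)
      ((D.psiDot P)⁻¹ * (waves (D.center P c) (D.ampRate P c) w τ ζ
        - P.β * waves (D.center P c) (D.flow P c) (fun i => deriv (w i)) τ ζ)) τ := by
  refine (hasDerivAt_waves_left hw (fun i τ => (h.hasDerivAt_χ i τ).const_mul P.β)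
    h.hasDerivAt_G τ ζ).congr_deriv ?_
  simp only [waves, Pair.flow, Pair.center]
  ring

lemma hasDerivAt_fast_left (h : D.Regular P c φlim) (τ ζ : ℝ) :
    HasDerivAt (fun τ => D.fast P c τ ζ) ((D.psiDot P)⁻¹ * D.fastT P c τ ζ) τ :=
  h.hasDerivAt_waves_G_left h.smooth_w τ ζ

lemma hasDerivAt_fastX_left (h : D.Regular P c φlim) (τ ζ : ℝ) :
    HasDerivAt (fun τ => D.fastX P c τ ζ) ((D.psiDot P)⁻¹ * D.fastXT P c τ ζ) τ :=
  ((h.hasDerivAt_waves_G_left h.smooth_deriv_w τ ζ).const_mul P.β).congr_deriv (by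
    rw [Pair.fastXT]; ring)

lemma fastLaw1_eq (h : D.Regular P c φlim) (τ ζ : ℝ) :
    P.fastLaw1 (D.fast P c) (D.psiDot P) τ ζ
      = P.poly1 (D.fast P c τ ζ) (D.fastX P c τ ζ) (D.fastXX P c τ ζ) (D.fastT P c τ ζ) :=
  Params.fastLaw1_eq h.adm.β_pos.ne' h.psi.ne' h.hasDerivAt_fast_right h.hasDerivAt_fastX_right
    h.hasDerivAt_fast_left τ ζ

lemma fastLaw2_eq (h : D.Regular P c φlim) (τ ζ : ℝ) :
    P.fastLaw2 (D.fast P c) (D.psiDot P) τ ζ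
      = P.poly2 (D.fast P c τ ζ) (D.fastX P c τ ζ) (D.fastXX P c τ ζ) (D.fastT P c τ ζ)
          (D.fastXT P c τ ζ) :=
  Params.fastLaw2_eq h.adm.β_pos.ne' h.psi.ne' h.hasDerivAt_fast_right h.hasDerivAt_fastX_right
    h.hasDerivAt_fast_left h.hasDerivAt_fastX_left h.hasDerivAt_fastT_right τ ζ

lemma contDiff_fast (h : D.Regular P c φlim) :
    ContDiff ℝ ∞ (fun z : ℝ × ℝ => D.fast P c z.1 z.2) :=
  contDiff_waves h.smooth_w h.smooth_center h.smooth_G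

lemma contDiff_fastX (h : D.Regular P c φlim) :
    ContDiff ℝ ∞ (fun z : ℝ × ℝ => D.fastX P c z.1 z.2) :=
  contDiff_const.mul (contDiff_waves h.smooth_deriv_w h.smooth_center h.smooth_G)

lemma contDiff_fastXX (h : D.Regular P c φlim) :
    ContDiff ℝ ∞ (fun z : ℝ × ℝ => D.fastXX P c z.1 z.2) :=
  contDiff_const.mul (contDiff_waves h.smooth_deriv_deriv_w h.smooth_center h.smooth_G)

lemma contDiff_fastT (h : D.Regular P c φlim) :
    ContDiff ℝ ∞ (fun z : ℝ × ℝ => D.fastT P c z.1 z.2) :=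
  (contDiff_waves h.smooth_w h.smooth_center h.smooth_ampRate).sub
    (contDiff_const.mul (contDiff_waves h.smooth_deriv_w h.smooth_center h.smooth_flow))

lemma contDiff_fastXT (h : D.Regular P c φlim) :
    ContDiff ℝ ∞ (fun z : ℝ × ℝ => D.fastXT P c z.1 z.2) :=
  (contDiff_const.mul (contDiff_waves h.smooth_deriv_w h.smooth_center h.smooth_ampRate)).sub
    (contDiff_const.mul (contDiff_waves h.smooth_deriv_deriv_w h.smooth_center h.smooth_flow))

lemma contDiff_fastLaw1 (h : D.Regular P c φlim) :
    ContDiff ℝ ∞ (fun z : ℝ × ℝ => P.fastLaw1 (D.fast P c) (D.psiDot P) z.1 z.2) := by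
  simp only [h.fastLaw1_eq, Params.poly1]
  have := h.contDiff_fast
  have := h.contDiff_fastX
  have := h.contDiff_fastXX
  have := h.contDiff_fastT
  fun_prop

lemma contDiff_fastLaw2 (h : D.Regular P c φlim) :
    ContDiff ℝ ∞ (fun z : ℝ × ℝ => P.fastLaw2 (D.fast P c) (D.psiDot P) z.1 z.2) := by
  simp only [h.fastLaw2_eq, Params.poly2, Params.rate2]
  have := h.contDiff_fast
  have := h.contDiff_fastX
  have := h.contDiff_fastXX
  have := h.contDiff_fastT
  have := h.contDiff_fastXT
  fun_prop

lemma bounded_φ (h : D.Regular P c φlim) (i : Fin 2) : ∃ B, ∀ τ, |c.φ i τ| ≤ B := by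
  obtain ⟨B, hB⟩ :=
    exists_pow_mul_abs_sub_le_atBot (h.lim.smooth_φ i) (h.lim.rapid_φ i) (h.lim.φ_bot i) 0
  obtain ⟨E, hE⟩ :=
    exists_pow_mul_abs_sub_le_atTop (h.lim.smooth_φ i) (h.lim.rapid_φ i) (h.lim.φ_top i) 0
  simp only [pow_zero, one_mul, sub_zero] at hB hE
  refine ⟨max B (E + |φlim i|), fun τ => ?_⟩
  rcases le_total τ 0 with hτ | hτ
  · exact (hB τ hτ).trans (le_max_left _ _)
  · refine le_trans ?_ (le_max_right _ _)
    calc |c.φ i τ| = |(c.φ i τ - φlim i) + φlim i| := by rw [sub_add_cancel]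
      _ ≤ |c.φ i τ - φlim i| + |φlim i| := abs_add_le _ _
      _ ≤ E + |φlim i| := by gcongr; exact hE τ hτ

lemma center_growth (h : D.Regular P c φlim) (i : Fin 2) :
    ∃ K, ∀ τ, 1 + |D.center P c i τ| ≤ K * (1 + |τ|) := by
  obtain ⟨B, hB⟩ := h.bounded_φ i
  have hB0 : 0 ≤ B := (abs_nonneg _).trans (hB 0)
  have hβ := h.adm.β_pos
  set k := |D.V i / D.psiDot P|
  refine ⟨1 + P.β * (k + B), fun τ => ?_⟩
  have hχ : |D.χ P c i τ| ≤ k * |τ| + B := by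
    refine (abs_add_le _ _).trans (add_le_add (le_of_eq ?_) (hB τ))
    rw [mul_div_right_comm, abs_mul]
  calc 1 + |D.center P c i τ| = 1 + P.β * |D.χ P c i τ| := by
        rw [Pair.center, abs_mul, abs_of_pos hβ]
    _ ≤ 1 + P.β * (k * |τ| + B) := by gcongr
    _ ≤ 1 + P.β * (k * |τ| + B) + (|τ| + P.β * k + P.β * B * |τ|) :=
        le_add_of_nonneg_right (by positivity)
    _ = (1 + P.β * (k + B)) * (1 + |τ|) := by ring

lemma center_sub (h : D.Regular P c φlim) (τ : ℝ) :
    D.center P c 0 τ - D.center P c 1 τ = P.β * (c.φ 0 τ - c.φ 1 τ) - τ := by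
  have hτ : D.psiDot P * τ / D.psiDot P = τ := mul_div_cancel_left₀ τ h.psi.ne'
  calc D.center P c 0 τ - D.center P c 1 τ
      = P.β * (c.φ 0 τ - c.φ 1 τ) - D.psiDot P * τ / D.psiDot P := by
        simp only [Pair.center, Pair.χ, Pair.psiDot]; ring
    _ = _ := by rw [hτ]

lemma separating (h : D.Regular P c φlim) : Separating (D.center P c 0) (D.center P c 1) := by
  refine ⟨h.center_growth 0, h.center_growth 1, ?_⟩
  obtain ⟨B, hB⟩ := h.bounded_φ 0
  obtain ⟨E, hE⟩ := h.bounded_φ 1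
  have hβ := h.adm.β_pos
  have hsum : 0 ≤ B + E := add_nonneg ((abs_nonneg _).trans (hB 0)) ((abs_nonneg _).trans (hE 0))
  refine ⟨1 + P.β * (B + E), fun τ => ?_⟩
  have hd := h.center_sub τ
  set d := D.center P c 0 τ - D.center P c 1 τ
  calc |τ| = |P.β * (c.φ 0 τ - c.φ 1 τ) - d| := by rw [hd, sub_sub_cancel]
    _ ≤ P.β * |c.φ 0 τ - c.φ 1 τ| + |d| :=
        (abs_sub _ _).trans_eq (by rw [abs_mul, abs_of_pos hβ])
    _ ≤ P.β * (B + E) + |d| := by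
        gcongr
        exact (abs_sub _ _).trans (add_le_add (hB τ) (hE τ))
    _ ≤ P.β * (B + E) + |d| + (1 + P.β * (B + E) * |d|) :=
        le_add_of_nonneg_right (by positivity)
    _ = (1 + P.β * (B + E)) * (1 + |d|) := by ring

lemma decays_G_sub (h : D.Regular P c φlim) (i : Fin 2) :
    DecaysIn id fun τ => D.G c i τ - D.A i := by
  simpa [Pair.G] using decaysIn_sub_of_tendsto (h.lim.smooth_S i) (h.lim.rapid_S i)
    (h.lim.S_bot i) (h.lim.S_top i)

lemma decays_ampRate (h : D.Regular P c φlim) (i : Fin 2) : DecaysIn id (D.ampRate P c i) :=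
  DecaysIn.const_mul (h.lim.rapid_S i) (D.psiDot P)

lemma decays_flow_sub (h : D.Regular P c φlim) (i : Fin 2) :
    DecaysIn id fun τ => D.flow P c i τ - D.A i * D.V i := by
  have hφ' : DecaysIn id fun τ => D.psiDot P * deriv (c.φ i) τ :=
    DecaysIn.const_mul (h.lim.rapid_φ i) (D.psiDot P)
  convert (((h.decays_G_sub i).mul hφ').add (hφ'.const_mul (D.A i))).add
    ((h.decays_G_sub i).const_mul (D.V i)) using 2
  simp only [Pair.flow, Pair.phiDot]
  ring

section Split

variable (h : D.Regular P c φlim)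
include h

lemma split_waves_G {w : Fin 2 → ℝ → ℝ} (hw : ∀ i, ContDiff ℝ ∞ (w i))
    (hwd : ∀ i, DecaysIn id (w i)) :
    WaveSplit (D.center P c 0) (D.center P c 1)
      (fun z => waves (D.center P c) (D.G c) w z.1 z.2)
      (fun ζ => D.A 0 * w 0 ζ) (fun ζ => D.A 1 * w 1 ζ) :=
  .of_waves h.separating (fun i => (h.smooth_center i).continuous)
    (fun i => (h.smooth_G i).continuous) (fun i => (hw i).continuous) h.decays_G_sub hwd

lemma split_waves_rate {w : Fin 2 → ℝ → ℝ} (hw : ∀ i, ContDiff ℝ ∞ (w i))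
    (hwd : ∀ i, DecaysIn id (w i)) (hwd' : ∀ i, DecaysIn id (deriv (w i))) :
    WaveSplit (D.center P c 0) (D.center P c 1)
      (fun z => waves (D.center P c) (D.ampRate P c) w z.1 z.2
        - P.β * waves (D.center P c) (D.flow P c) (fun i => deriv (w i)) z.1 z.2)
      (fun ζ => -D.V 0 * (P.β * (D.A 0 * deriv (w 0) ζ)))
      (fun ζ => -D.V 1 * (P.β * (D.A 1 * deriv (w 1) ζ))) := by
  have hamp := WaveSplit.of_waves (A := fun _ => 0) h.separating
    (fun i => (h.smooth_center i).continuous) (fun i => (h.smooth_ampRate i).continuous)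
    (fun i => (hw i).continuous) (fun i => by simpa using h.decays_ampRate i) hwd
  have hflow := WaveSplit.of_waves h.separating
    (fun i => (h.smooth_center i).continuous) (fun i => (h.smooth_flow i).continuous)
    (fun i => (contDiff_deriv (hw i)).continuous) h.decays_flow_sub hwd'
  convert hamp.add (hflow.const_mul (-P.β)) using 2 <;> ring

lemma decays_w (i : Fin 2) : DecaysIn id (D.w i) := (h.profile i).decays h.adm (h.c0_lt i)

lemma decays_deriv_w (i : Fin 2) : DecaysIn id (deriv (D.w i)) :=
  (h.profile i).decays_deriv h.adm (h.c0_lt i)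

lemma decays_deriv_deriv_w (i : Fin 2) : DecaysIn id (deriv (deriv (D.w i))) :=
  (h.profile i).decays_deriv_deriv h.adm (h.c0_lt i)

lemma split_fast :
    WaveSplit (D.center P c 0) (D.center P c 1) (fun z => D.fast P c z.1 z.2)
      (fun ζ => D.A 0 * D.w 0 ζ) (fun ζ => D.A 1 * D.w 1 ζ) :=
  h.split_waves_G h.smooth_w h.decays_w

lemma split_fastX :
    WaveSplit (D.center P c 0) (D.center P c 1) (fun z => D.fastX P c z.1 z.2)
      (fun ζ => P.β * (D.A 0 * deriv (D.w 0) ζ)) (fun ζ => P.β * (D.A 1 * deriv (D.w 1) ζ)) :=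
  (h.split_waves_G h.smooth_deriv_w h.decays_deriv_w).const_mul P.β

lemma split_fastXX :
    WaveSplit (D.center P c 0) (D.center P c 1) (fun z => D.fastXX P c z.1 z.2)
      (fun ζ => P.β ^ 2 * (D.A 0 * deriv (deriv (D.w 0)) ζ))
      (fun ζ => P.β ^ 2 * (D.A 1 * deriv (deriv (D.w 1)) ζ)) :=
  (h.split_waves_G h.smooth_deriv_deriv_w h.decays_deriv_deriv_w).const_mul (P.β ^ 2)

lemma split_fastT :
    WaveSplit (D.center P c 0) (D.center P c 1) (fun z => D.fastT P c z.1 z.2)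
      (fun ζ => -D.V 0 * (P.β * (D.A 0 * deriv (D.w 0) ζ)))
      (fun ζ => -D.V 1 * (P.β * (D.A 1 * deriv (D.w 1) ζ))) :=
  h.split_waves_rate h.smooth_w h.decays_w h.decays_deriv_w

lemma split_fastXT :
    WaveSplit (D.center P c 0) (D.center P c 1) (fun z => D.fastXT P c z.1 z.2)
      (fun ζ => -D.V 0 * (P.β ^ 2 * (D.A 0 * deriv (deriv (D.w 0)) ζ)))
      (fun ζ => -D.V 1 * (P.β ^ 2 * (D.A 1 * deriv (deriv (D.w 1)) ζ))) := by
  convert (h.split_waves_rate h.smooth_deriv_w h.decays_deriv_w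
    h.decays_deriv_deriv_w).const_mul P.β using 2 <;>
    [simp only [Pair.fastXT]; skip; skip] <;> ring

end Split

end Pair.Regular

/-! ### Moments of a single soliton -/

section Moments

variable {F F' L M : ℝ → ℝ}

lemma DecaysIn.integrable_mul_id (hF : DecaysIn id F) (hc : Continuous F) :
    Integrable fun ζ => F ζ * ζ := by
  simpa [mul_comm] using hF.integrable_pow_mul hc 1

lemma DecaysIn.integral_deriv_eq_zero (hF : DecaysIn id F) (hF' : DecaysIn id F')
    (hc : Continuous F') (hd : ∀ x, HasDerivAt F (F' x) x) : ∫ x, F' x = 0 :=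
  integral_eq_zero_of_hasDerivAt_of_integrable hd (hF'.integrable hc)
    (hF.integrable (continuous_iff_continuousAt.2 fun x => (hd x).continuousAt))

lemma DecaysIn.integral_deriv_mul_id (hF : DecaysIn id F) (hF' : DecaysIn id F')
    (hc : Continuous F') (hd : ∀ x, HasDerivAt F (F' x) x) :
    ∫ x, F' x * x = -∫ x, F x := by
  have hcF : Continuous F := continuous_iff_continuousAt.2 fun x => (hd x).continuousAt
  have hparts := integral_eq_zero_of_hasDerivAt_of_integrable
    (fun x => ((hd x).mul (hasDerivAt_id x)).congr_deriv
      (show _ = F' x * x + F x by simp))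
    ((hF'.integrable_mul_id hc).add (hF.integrable hcF)) (hF.integrable_mul_id hcF)
  rw [integral_add (hF'.integrable_mul_id hc) (hF.integrable hcF)] at hparts
  exact eq_neg_of_add_eq_zero_left hparts

lemma DecaysIn.integral_eq_of_hasDerivAt_sub (hF : DecaysIn id F) (hL : DecaysIn id L)
    (hM : DecaysIn id M) (hLc : Continuous L) (hMc : Continuous M)
    (hd : ∀ x, HasDerivAt F (L x - M x) x) : ∫ x, L x = ∫ x, M x := by
  have hzero := hF.integral_deriv_eq_zero (hL.sub hM) (hLc.sub hMc) hd
  rw [integral_sub (hL.integrable hLc) (hM.integrable hMc)] at hzero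
  exact sub_eq_zero.1 hzero

lemma DecaysIn.integral_mul_id_eq_of_hasDerivAt_sub (hF : DecaysIn id F) (hL : DecaysIn id L)
    (hM : DecaysIn id M) (hLc : Continuous L) (hMc : Continuous M)
    (hd : ∀ x, HasDerivAt F (L x - M x) x) :
    ∫ x, L x * x = (∫ x, M x * x) - ∫ x, F x := by
  have hparts := hF.integral_deriv_mul_id (hL.sub hM) (hLc.sub hMc) hd
  simp only [sub_mul] at hparts
  rw [integral_sub (hL.integrable_mul_id hLc) (hM.integrable_mul_id hMc)] at hparts
  linarith

end Moments

section DecayOfLaws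

variable {X : Type*} {ρ u p q s z : X → ℝ} (P : Params)

lemma DecaysIn.poly1 (hu : DecaysIn ρ u) (hp : DecaysIn ρ p) (hq : DecaysIn ρ q)
    (hs : DecaysIn ρ s) : DecaysIn ρ fun x => P.poly1 (u x) (p x) (q x) (s x) :=
  ((hs.add (hp.const_mul P.c0)).add ((hu.mul hp).const_mul (2 * P.c1))).add
    ((hp.mul hq).const_mul (-2 * (P.c2 - P.c3)))

lemma DecaysIn.poly2 (hu : DecaysIn ρ u) (hp : DecaysIn ρ p) (hq : DecaysIn ρ q)
    (hs : DecaysIn ρ s) (hz : DecaysIn ρ z) :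
    DecaysIn ρ fun x => P.poly2 (u x) (p x) (q x) (s x) (z x) :=
  ((((hu.mul hs).const_mul 2).add ((hp.mul hz).const_mul (2 * P.α ^ 2))).add
    (((((((hu.mul hp).const_mul (2 * P.c0)).add ((hu.mul (hu.mul hp)).const_mul (4 * P.c1))).add
    ((hp.mul (hp.mul hp)).const_mul (-(2 * P.c2 - 5 * P.c3)))).add
    ((hp.mul hq).const_mul (-6 * P.γ))).add
    ((hu.mul (hp.mul hq)).const_mul (-2 * (2 * P.c2 - 5 * P.c3)))).add
    (((hq.mul hs).add (hp.mul hz)).const_mul (2 * P.α ^ 2)))).add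
    ((hp.mul (hp.mul hp)).const_mul (2 * P.c2 - P.c3))

end DecayOfLaws

/-- The conservation law evaluated on the single wave `A w(β (x - V t) / ε)`. -/
def Params.single1 (P : Params) (A V : ℝ) (w : ℝ → ℝ) (η : ℝ) : ℝ :=
  P.poly1 (A * w η) (P.β * (A * deriv w η)) (P.β ^ 2 * (A * deriv (deriv w) η))
    (-V * (P.β * (A * deriv w η)))

/-- The balance law evaluated on the single wave `A w(β (x - V t) / ε)`. -/
def Params.single2 (P : Params) (A V : ℝ) (w : ℝ → ℝ) (η : ℝ) : ℝ :=
  P.poly2 (A * w η) (P.β * (A * deriv w η)) (P.β ^ 2 * (A * deriv (deriv w) η))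
    (-V * (P.β * (A * deriv w η))) (-V * (P.β ^ 2 * (A * deriv (deriv w) η)))

/-- The flux of the balance law, in the variable `β (x - V t) / ε`, on the single wave
`A w(β (x - V t) / ε)`. -/
def Params.flux2 (P : Params) (A V : ℝ) (w : ℝ → ℝ) (η : ℝ) : ℝ :=
  P.β * (P.pp2 (A * w η) (P.β * (A * deriv w η)) - V * P.q2 (A * w η) (P.β * (A * deriv w η))
    - 2 * P.α ^ 2 * P.β ^ 2 * A ^ 2 * V * deriv w η ^ 2)

namespace Params.IsProfile

variable {P : Params} {A V : ℝ} {w : ℝ → ℝ}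

lemma integral_mul_id (hw : P.IsProfile A V w) : ∫ η, w η * η = 0 :=
  integral_eq_zero_of_odd fun η => by rw [hw.even, mul_neg]

lemma integral_q2_mul_id (hw : P.IsProfile A V w) :
    ∫ η, P.q2 (A * w η) (P.β * (A * deriv w η)) * η = 0 :=
  integral_eq_zero_of_odd fun η => by
    rw [deriv_odd_of_even hw.even, hw.even]
    simp only [Params.q2]
    ring

lemma integral_k2 (hw : P.IsProfile A V w) :
    ∫ η, P.k2 (A * w η) (P.β * (A * deriv w η)) = 0 :=
  integral_eq_zero_of_odd fun η => by
    rw [deriv_odd_of_even hw.even]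
    simp only [Params.k2]
    ring

lemma continuous_single1 (hw : P.IsProfile A V w) : Continuous (P.single1 A V w) := by
  have h := hw.smooth.continuous
  have h' := (contDiff_deriv hw.smooth).continuous
  have h'' := (contDiff_deriv (contDiff_deriv hw.smooth)).continuous
  unfold Params.single1 Params.poly1
  fun_prop

lemma continuous_single2 (hw : P.IsProfile A V w) : Continuous (P.single2 A V w) := by
  have h := hw.smooth.continuous
  have h' := (contDiff_deriv hw.smooth).continuous
  have h'' := (contDiff_deriv (contDiff_deriv hw.smooth)).continuous
  unfold Params.single2 Params.poly2 Params.rate2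
  fun_prop

lemma hasDerivAt_flux1 (hw : P.IsProfile A V w) (η : ℝ) :
    HasDerivAt (fun η => P.β * (P.p1 (A * w η) (P.β * (A * deriv w η)) - V * A * w η))
      (P.single1 A V w η) η := by
  have hu := hasDerivAt_of_smooth hw.smooth η
  have hp := hasDerivAt_of_smooth (contDiff_deriv hw.smooth) η
  refine (((P.hasDerivAt_p1 (hu.const_mul A) ((hp.const_mul A).const_mul P.β)).sub
    (hu.const_mul (V * A))).const_mul P.β).congr_deriv ?_
  simp only [Params.single1, Params.poly1]
  ring

lemma hasDerivAt_flux2 (hw : P.IsProfile A V w) (η : ℝ) :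
    HasDerivAt (P.flux2 A V w)
      (P.single2 A V w η - P.k2 (A * w η) (P.β * (A * deriv w η))) η := by
  have hu := (hasDerivAt_of_smooth hw.smooth η).const_mul A
  have hw' := hasDerivAt_of_smooth (contDiff_deriv hw.smooth) η
  have hp := (hw'.const_mul A).const_mul P.β
  refine ((((P.hasDerivAt_pp2 hu hp).sub ((P.hasDerivAt_q2 hu hp).const_mul V)).sub
    ((hw'.pow 2).const_mul (2 * P.α ^ 2 * P.β ^ 2 * A ^ 2 * V))).const_mul P.β).congr_deriv ?_
  simp only [Params.single2, Params.poly2, Params.rate2, Params.k2]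
  push_cast
  ring

section Admissible

variable (hw : P.IsProfile A V w) (hP : P.Admissible) (hV : P.c0 < V)
include hw hP hV

lemma decays_flux1 :
    DecaysIn id fun η => P.β * (P.p1 (A * w η) (P.β * (A * deriv w η)) - V * A * w η) :=
  ((((hw.decays hP hV).const_mul A).p1 P (((hw.decays_deriv hP hV).const_mul A).const_mul P.β)).sub
    ((hw.decays hP hV).const_mul (V * A))).const_mul P.β

lemma decays_single1 : DecaysIn id (P.single1 A V w) := by
  have hp := ((hw.decays_deriv hP hV).const_mul A).const_mul P.β
  exact ((hw.decays hP hV).const_mul A).poly1 P hp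
    (((hw.decays_deriv_deriv hP hV).const_mul A).const_mul (P.β ^ 2)) (hp.const_mul (-V))

lemma decays_k2 : DecaysIn id fun η => P.k2 (A * w η) (P.β * (A * deriv w η)) :=
  (((hw.decays_deriv hP hV).const_mul A).const_mul P.β).k2 P

lemma decays_flux2 : DecaysIn id (P.flux2 A V w) := by
  have hu := (hw.decays hP hV).const_mul A
  have hp := ((hw.decays_deriv hP hV).const_mul A).const_mul P.β
  exact (((hu.pp2 P hp).sub ((hu.q2 P hp).const_mul V)).sub
    (((hw.decays_deriv hP hV).pow_succ 1).const_mul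
      (2 * P.α ^ 2 * P.β ^ 2 * A ^ 2 * V))).const_mul P.β

lemma decays_single2 : DecaysIn id (P.single2 A V w) := by
  have hp := ((hw.decays_deriv hP hV).const_mul A).const_mul P.β
  have hq := ((hw.decays_deriv_deriv hP hV).const_mul A).const_mul (P.β ^ 2)
  exact ((hw.decays hP hV).const_mul A).poly2 P hp hq (hp.const_mul (-V)) (hq.const_mul (-V))

lemma integral_single1 : ∫ η, P.single1 A V w η = 0 :=
  (hw.decays_flux1 hP hV).integral_deriv_eq_zero (hw.decays_single1 hP hV) hw.continuous_single1
    hw.hasDerivAt_flux1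

lemma integral_single1_mul_id : ∫ η, P.single1 A V w η * η = 0 := by
  have hc := hw.smooth.continuous
  have hc' := (contDiff_deriv hw.smooth).continuous
  have hd := hw.decays hP hV
  rw [(hw.decays_flux1 hP hV).integral_deriv_mul_id (hw.decays_single1 hP hV)
    hw.continuous_single1 hw.hasDerivAt_flux1, integral_const_mul,
    integral_sub (((hd.const_mul A).p1 P
      (((hw.decays_deriv hP hV).const_mul A).const_mul P.β)).integrable (by fun_prop))
      ((hd.integrable hc).const_mul _),
    integral_const_mul, hw.integral_p1 hP hV, sub_self, mul_zero, neg_zero]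

lemma integral_single2 : ∫ η, P.single2 A V w η = 0 := by
  have hc' := (contDiff_deriv hw.smooth).continuous
  rw [(hw.decays_flux2 hP hV).integral_eq_of_hasDerivAt_sub (hw.decays_single2 hP hV)
    (hw.decays_k2 hP hV) hw.continuous_single2 (by fun_prop) hw.hasDerivAt_flux2, hw.integral_k2]

lemma integral_flux2 :
    ∫ η, P.flux2 A V w η = P.β * ((∫ η, P.pp2 (A * w η) (P.β * (A * deriv w η)))
      - V * (∫ η, P.q2 (A * w η) (P.β * (A * deriv w η)))
      - 2 * P.α ^ 2 * P.β ^ 2 * A ^ 2 * V * ∫ η, deriv w η ^ 2) := by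
  have hc := hw.smooth.continuous
  have hc' := (contDiff_deriv hw.smooth).continuous
  have hu := (hw.decays hP hV).const_mul A
  have hp := ((hw.decays_deriv hP hV).const_mul A).const_mul P.β
  have hpp2 : Integrable fun η => P.pp2 (A * w η) (P.β * (A * deriv w η)) :=
    (hu.pp2 P hp).integrable (by fun_prop)
  have hq2 : Integrable fun η => V * P.q2 (A * w η) (P.β * (A * deriv w η)) :=
    ((hu.q2 P hp).integrable (by fun_prop)).const_mul V
  have hsq : Integrable fun η => 2 * P.α ^ 2 * P.β ^ 2 * A ^ 2 * V * deriv w η ^ 2 :=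
    (((hw.decays_deriv hP hV).pow_succ 1).integrable (by fun_prop)).const_mul _
  have hdiff : Integrable fun η => P.pp2 (A * w η) (P.β * (A * deriv w η))
      - V * P.q2 (A * w η) (P.β * (A * deriv w η)) := hpp2.sub hq2
  simp only [Params.flux2]
  rw [integral_const_mul, integral_sub hdiff hsq, integral_sub hpp2 hq2,
    integral_const_mul, integral_const_mul]

lemma integral_single2_mul_id : ∫ η, P.single2 A V w η * η = 0 := by
  have hc' := (contDiff_deriv hw.smooth).continuous
  have hmoment := hw.moment_p2 hP hV
  simp only [mul_comm _ (P.k2 _ _)] at hmoment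
  rw [(hw.decays_flux2 hP hV).integral_mul_id_eq_of_hasDerivAt_sub (hw.decays_single2 hP hV)
    (hw.decays_k2 hP hV) hw.continuous_single2 (by fun_prop) hw.hasDerivAt_flux2,
    hw.integral_flux2 hP hV]
  linear_combination P.β * hmoment
    - (∫ η, P.k2 (A * w η) (P.β * (A * deriv w η)) * η) * mul_inv_cancel₀ hP.β_pos.ne'

end Admissible

end Params.IsProfile

/-! ### Differentiation of moments in the fast time -/

section MomentDerivative

variable {c₁ c₂ l₁ l₂ m₁ m₂ : ℝ → ℝ} {f f' : ℝ × ℝ → ℝ}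

lemma WaveSplit.exists_abs_le (hc : Separating c₁ c₂) (hf : WaveSplit c₁ c₂ f l₁ l₂) (n : ℕ) :
    ∃ C, 0 ≤ C ∧ ∀ τ ζ, |f (τ, ζ)| * |ζ| ^ n * (1 + ζ ^ 2) ≤ C * (1 + |τ|) ^ (n + 2) := by
  obtain ⟨K₁, hK₁⟩ := hc.left
  obtain ⟨K₂, hK₂⟩ := hc.right
  have hgrowth := hf.split.exists_growth_le (σ := Prod.fst) (abs_le_of_linear_growth hK₁)
    (abs_le_of_linear_growth hK₂)
  obtain ⟨C, hC⟩ := hgrowth n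
  obtain ⟨E, hE⟩ := hgrowth (n + 2)
  have hC0 : 0 ≤ C := by
    simpa using (by positivity : (0 : ℝ) ≤ _).trans (hC (0, 0))
  have hE0 : 0 ≤ E := by
    simpa using (by positivity : (0 : ℝ) ≤ _).trans (hE (0, 0))
  refine ⟨C + E, add_nonneg hC0 hE0, fun τ ζ => ?_⟩
  calc |f (τ, ζ)| * |ζ| ^ n * (1 + ζ ^ 2)
      = |ζ| ^ n * |f (τ, ζ)| + |ζ| ^ (n + 2) * |f (τ, ζ)| := by
        rw [pow_add, sq_abs]; ring
    _ ≤ C * (1 + |τ|) ^ n + E * (1 + |τ|) ^ (n + 2) := add_le_add (hC (τ, ζ)) (hE (τ, ζ))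
    _ ≤ C * (1 + |τ|) ^ (n + 2) + E * (1 + |τ|) ^ (n + 2) := by
        gcongr
        · exact le_add_of_nonneg_right (abs_nonneg τ)
        · omega
    _ = (C + E) * (1 + |τ|) ^ (n + 2) := by ring

lemma WaveSplit.hasDerivAt_moment (hc : Separating c₁ c₂) (hf : WaveSplit c₁ c₂ f l₁ l₂)
    (hf' : WaveSplit c₁ c₂ f' m₁ m₂)
    (hd : ∀ τ ζ, HasDerivAt (fun τ => f (τ, ζ)) (f' (τ, ζ)) τ) (n : ℕ) (τ : ℝ) :
    HasDerivAt (fun τ => ∫ ζ, f (τ, ζ) * ζ ^ n) (∫ ζ, f' (τ, ζ) * ζ ^ n) τ := by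
  obtain ⟨C, hC0, hC⟩ := hf'.exists_abs_le hc n
  have hcont := hf.continuous
  have hcont' := hf'.continuous
  have hsection : Integrable fun ζ => f (τ, ζ) * ζ ^ n := by
    simpa only [mul_comm] using (hf.decays_section τ).integrable_pow_mul (by fun_prop) n
  refine (hasDerivAt_integral_of_dominated_loc_of_deriv_le
    (bound := fun ζ => C * (2 + |τ|) ^ (n + 2) * (1 + ζ ^ 2)⁻¹)
    (Metric.ball_mem_nhds τ one_pos)
    (Eventually.of_forall fun τ => Continuous.aestronglyMeasurable (by fun_prop)) hsection
    (Continuous.aestronglyMeasurable (by fun_prop)) (ae_of_all _ fun ζ t ht => ?_)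
    (integrable_inv_one_add_sq.const_mul _)
    (ae_of_all _ fun ζ t _ => (hd t ζ).mul_const _)).2
  have hτ : 1 + |t| ≤ 2 + |τ| := by
    rw [Metric.mem_ball, Real.dist_eq] at ht
    linarith [abs_sub_abs_le_abs_sub t τ]
  rw [← div_eq_mul_inv, le_div_iff₀ (by positivity), Real.norm_eq_abs, abs_mul, abs_pow]
  exact (hC t ζ).trans (by gcongr)

end MomentDerivative

/-! ### Moments of the ansatz -/

section Superpositions

variable {v w : ℝ → ℝ}

/-- The overlap `∫ v(η - s) w(η) dη` of two shapes at distance `s`. -/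
def overlap (v w : ℝ → ℝ) (s : ℝ) : ℝ := ∫ η, v (η - s) * w η

lemma integral_comp_sub_mul_comp_sub (v w : ℝ → ℝ) (x y : ℝ) :
    ∫ ζ, v (ζ - x) * w (ζ - y) = overlap v w (x - y) := by
  rw [← integral_add_right_eq_self _ y, overlap]
  simp only [add_sub_cancel_right, add_sub_assoc, sub_sub_eq_add_sub]

lemma overlap_comm (v w : ℝ → ℝ) (s : ℝ) : overlap v w s = overlap w v (-s) := by
  rw [overlap, ← integral_add_right_eq_self _ s, overlap]
  simp only [add_sub_cancel_right, sub_neg_eq_add, mul_comm]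

lemma integrable_comp_sub_mul_comp_sub (hvd : DecaysIn id v) (hwd : DecaysIn id w)
    (hv : Continuous v) (hw : Continuous w) (x y : ℝ) :
    Integrable fun ζ => v (ζ - x) * w (ζ - y) :=
  ((hvd.comp_sub x).mul (hwd.comp_sub y)).integrable (by fun_prop)

lemma overlap_deriv_left (hv : ContDiff ℝ ∞ v) (hw : ContDiff ℝ ∞ w) (hvd : DecaysIn id v)
    (hvd' : DecaysIn id (deriv v)) (hwd : DecaysIn id w) (hwd' : DecaysIn id (deriv w)) (s : ℝ) :
    overlap (deriv v) w s = -overlap v (deriv w) s := by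
  have hv' := (contDiff_deriv hv).continuous
  have hw' := (contDiff_deriv hw).continuous
  have hv₀ := hv.continuous
  have hw₀ := hw.continuous
  have hleft := (hvd'.comp_sub s).mul hwd
  have hright := (hvd.comp_sub s).mul hwd'
  have hzero := ((hvd.comp_sub s).mul hwd).integral_deriv_eq_zero (hleft.add hright)
    (by fun_prop) fun η => ((hasDerivAt_of_smooth hv (η - s)).comp_sub_const η s).mul
      (hasDerivAt_of_smooth hw η)
  rw [integral_add (hleft.integrable (by fun_prop)) (hright.integrable (by fun_prop))] at hzero
  exact eq_neg_of_add_eq_zero_left hzero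

lemma overlap_deriv_self (hv : ContDiff ℝ ∞ v) (hvd : DecaysIn id v)
    (hvd' : DecaysIn id (deriv v)) : overlap (deriv v) v 0 = 0 := by
  have hparts := overlap_deriv_left hv hv hvd hvd' hvd hvd' 0
  rw [overlap_comm v, neg_zero] at hparts
  linarith

variable {c f g : Fin 2 → ℝ → ℝ} {v w : Fin 2 → ℝ → ℝ}

lemma integral_waves (hwd : ∀ i, DecaysIn id (w i)) (hw : ∀ i, Continuous (w i)) (τ : ℝ) :
    ∫ ζ, waves c g w τ ζ = ∑ i, g i τ * ∫ η, w i η := by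
  have hwave : ∀ i, Integrable fun ζ => g i τ * w i (ζ - c i τ) := fun i =>
    (((hwd i).comp_sub _).integrable ((hw i).comp (by fun_prop))).const_mul _
  simp only [waves]
  rw [integral_add (hwave 0) (hwave 1)]
  simp only [integral_const_mul, integral_sub_right_eq_self (w _), Fin.sum_univ_two]

lemma waves_mul_waves (c f g v w : Fin 2 → ℝ → ℝ) (τ ζ : ℝ) :
    waves c f v τ ζ * waves c g w τ ζ
      = ∑ i, ∑ j, f i τ * g j τ * (v i (ζ - c i τ) * w j (ζ - c j τ)) := by
  simp only [waves, Fin.sum_univ_two]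
  ring

lemma integrable_waves_mul_waves (hvd : ∀ i, DecaysIn id (v i)) (hwd : ∀ i, DecaysIn id (w i))
    (hv : ∀ i, Continuous (v i)) (hw : ∀ i, Continuous (w i)) (τ : ℝ) :
    Integrable fun ζ => waves c f v τ ζ * waves c g w τ ζ := by
  simp only [waves_mul_waves]
  exact integrable_finsetSum _ fun i _ => integrable_finsetSum _ fun j _ =>
    (integrable_comp_sub_mul_comp_sub (hvd i) (hwd j) (hv i) (hw j) _ _).const_mul _

lemma integral_waves_mul_waves (hvd : ∀ i, DecaysIn id (v i)) (hwd : ∀ i, DecaysIn id (w i))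
    (hv : ∀ i, Continuous (v i)) (hw : ∀ i, Continuous (w i)) (τ : ℝ) :
    ∫ ζ, waves c f v τ ζ * waves c g w τ ζ
      = ∑ i, ∑ j, f i τ * g j τ * overlap (v i) (w j) (c i τ - c j τ) := by
  have hint : ∀ i j, Integrable fun ζ => f i τ * g j τ * (v i (ζ - c i τ) * w j (ζ - c j τ)) :=
    fun i j => (integrable_comp_sub_mul_comp_sub (hvd i) (hwd j) (hv i) (hw j) _ _).const_mul _
  simp only [waves_mul_waves]
  rw [integral_finsetSum _ fun i _ => integrable_finsetSum _ fun j _ => hint i j]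
  simp only [integral_finsetSum _ fun j _ => hint _ j, integral_const_mul,
    integral_comp_sub_mul_comp_sub]

lemma integral_comp_sub_mul_id {w : ℝ → ℝ} (hwd : DecaysIn id w) (hw : Continuous w) (y : ℝ) :
    ∫ ζ, w (ζ - y) * ζ = (∫ η, w η * η) + y * ∫ η, w η := by
  rw [← integral_add_right_eq_self _ y]
  simp only [add_sub_cancel_right, mul_add]
  rw [integral_add (hwd.integrable_mul_id hw) ((hwd.integrable hw).mul_const y),
    integral_mul_const, mul_comm y]

lemma integral_waves_mul_id (hwd : ∀ i, DecaysIn id (w i)) (hw : ∀ i, Continuous (w i)) (τ : ℝ) :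
    ∫ ζ, waves c g w τ ζ * ζ = ∑ i, g i τ * ((∫ η, w i η * η) + c i τ * ∫ η, w i η) := by
  have hwave : ∀ i, Integrable fun ζ => g i τ * (w i (ζ - c i τ) * ζ) := fun i =>
    (((hwd i).comp_sub _).integrable_mul_id ((hw i).comp (by fun_prop))).const_mul _
  simp only [waves, add_mul, mul_assoc]
  rw [integral_add (hwave 0) (hwave 1)]
  simp only [integral_const_mul, integral_comp_sub_mul_id (hwd _) (hw _), Fin.sum_univ_two]

end Superpositions

/-- First moment of a density on the `i`-th free soliton. -/
def Pair.firstMoment (D : Pair) (P : Params) (F : ℝ → ℝ → ℝ) (i : Fin 2) : ℝ :=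
  ∫ η, F (D.A i * D.w i η) (P.β * (D.A i * deriv (D.w i) η)) * η

/-- The decomposition of the density `F(u, εuₓ)` of the ansatz into the densities of the two free
solitons and the interaction measured by `Pair.R`. -/
abbrev Pair.SplitsDensity (D : Pair) (P : Params) (c : Corr) (F : ℝ → ℝ → ℝ) : Prop :=
  WaveSplit (D.center P c 0) (D.center P c 1)
    (fun z => F (D.fast P c z.1 z.2) (D.fastX P c z.1 z.2))
    (fun η => F (D.A 0 * D.w 0 η) (P.β * (D.A 0 * deriv (D.w 0) η)))
    (fun η => F (D.A 1 * D.w 1 η) (P.β * (D.A 1 * deriv (D.w 1) η)))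

namespace Pair.SplitsDensity

variable {D : Pair} {P : Params} {c : Corr} {F : ℝ → ℝ → ℝ}

lemma R_eq (D : Pair) (P : Params) (c : Corr) (F : ℝ → ℝ → ℝ) (n : ℕ) (τ : ℝ) :
    D.R P c F n τ = ∫ ζ, (ζ - D.center P c 1 τ) ^ n * interaction (D.center P c 0) (D.center P c 1)
      (fun z => F (D.fast P c z.1 z.2) (D.fastX P c z.1 z.2))
      (fun η => F (D.A 0 * D.w 0 η) (P.β * (D.A 0 * deriv (D.w 0) η)))
      (fun η => F (D.A 1 * D.w 1 η) (P.β * (D.A 1 * deriv (D.w 1) η))) (τ, ζ) := by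
  have harg : ∀ η, η + D.center P c 1 τ - D.center P c 0 τ = η - D.σ P c τ := fun η => by
    simp only [Pair.center, Pair.σ]
    ring
  rw [← integral_add_right_eq_self _ (D.center P c 1 τ), Pair.R]
  congr 1 with η
  simp only [interaction, Fin.sum_univ_two, Pair.arg, Pair.fast, Pair.fastX, waves, harg,
    add_sub_cancel_right, if_true, one_ne_zero, if_false]
  ring

lemma integral_density (h : D.SplitsDensity P c F) (τ : ℝ) :
    ∫ ζ, F (D.fast P c τ ζ) (D.fastX P c τ ζ) = D.R P c F 0 τ + ∑ i, D.a P F i := by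
  rw [h.integral_eq τ, R_eq, Fin.sum_univ_two, add_assoc]
  simp only [pow_zero, one_mul, Pair.a]

lemma integral_density_mul_id (h : D.SplitsDensity P c F) (τ : ℝ) :
    ∫ ζ, F (D.fast P c τ ζ) (D.fastX P c τ ζ) * ζ
      = D.R P c F 1 τ + D.center P c 1 τ * D.R P c F 0 τ
        + ∑ i, (D.firstMoment P F i + D.center P c i τ * D.a P F i) := by
  have hrest := h.decays_interaction.section_right τ
  have hcont := h.continuous_interaction τ
  rw [h.integral_mul_id_eq τ, R_eq, R_eq, Fin.sum_univ_two]
  simp only [pow_zero, pow_one, one_mul, sub_mul, Pair.a, Pair.firstMoment]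
  simp only [mul_comm _ (interaction _ _ _ _ _ _), mul_comm (D.center P c 1 τ) (∫ _, _)]
  rw [integral_sub (hrest.integrable_mul_id hcont) ((hrest.integrable hcont).mul_const _),
    integral_mul_const]
  ring

end Pair.SplitsDensity

namespace Pair.Regular

variable {D : Pair} {P : Params} {c : Corr} {φlim : Fin 2 → ℝ}

section

variable (h : D.Regular P c φlim) (τ : ℝ)
include h

lemma integral_fast : ∫ ζ, D.fast P c τ ζ = ∑ i, D.G c i τ * D.a1 i :=
  integral_waves h.decays_w (fun i => (h.smooth_w i).continuous) τ

lemma integral_fast_mul_id :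
    ∫ ζ, D.fast P c τ ζ * ζ = ∑ i, D.G c i τ * (D.center P c i τ * D.a1 i) := by
  simpa only [(h.profile _).integral_mul_id, zero_add, Pair.a1, Pair.fast] using
    integral_waves_mul_id h.decays_w (fun i => (h.smooth_w i).continuous) τ

lemma overlap_deriv_comm (i j : Fin 2) (s : ℝ) :
    overlap (deriv (D.w i)) (D.w j) (-s) = -overlap (deriv (D.w j)) (D.w i) s := by
  rw [overlap_deriv_left (h.smooth_w i) (h.smooth_w j) (h.decays_w i) (h.decays_deriv_w i)
    (h.decays_w j) (h.decays_deriv_w j), overlap_comm (D.w i), neg_neg]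

lemma overlap_deriv_self (i : Fin 2) : overlap (deriv (D.w i)) (D.w i) 0 = 0 :=
  DP.overlap_deriv_self (h.smooth_w i) (h.decays_w i) (h.decays_deriv_w i)

lemma integral_fastX_mul_fastT :
    ∫ ζ, D.fastX P c τ ζ * D.fastT P c τ ζ
      = -(P.β * (D.L P c τ + P.β * ∑ i, D.a2' i * (D.A i ^ 2 * D.V i))) := by
  have hw := fun i => (h.smooth_w i).continuous
  have hw' := fun i => (h.smooth_deriv_w i).continuous
  have hσ : D.center P c 0 τ - D.center P c 1 τ = D.σ P c τ := (mul_sub _ _ _).symm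
  have hσ' : D.center P c 1 τ - D.center P c 0 τ = -D.σ P c τ := by rw [← hσ, neg_sub]
  have hsq : ∀ i, overlap (deriv (D.w i)) (deriv (D.w i)) 0 = D.a2' i := fun i => by
    simp only [overlap, sub_zero, Pair.a2', pow_two]
  have hexpand : ∀ ζ, D.fastX P c τ ζ * D.fastT P c τ ζ
      = P.β * (waves (D.center P c) (D.G c) (fun i => deriv (D.w i)) τ ζ
          * waves (D.center P c) (D.ampRate P c) D.w τ ζ)
        - P.β ^ 2 * (waves (D.center P c) (D.G c) (fun i => deriv (D.w i)) τ ζ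
          * waves (D.center P c) (D.flow P c) (fun i => deriv (D.w i)) τ ζ) := fun ζ => by
    rw [Pair.fastX, Pair.fastT]
    ring
  simp only [hexpand]
  rw [integral_sub ((integrable_waves_mul_waves h.decays_deriv_w h.decays_w hw' hw τ).const_mul _)
      ((integrable_waves_mul_waves h.decays_deriv_w h.decays_deriv_w hw' hw' τ).const_mul _),
    integral_const_mul, integral_const_mul,
    integral_waves_mul_waves h.decays_deriv_w h.decays_w hw' hw,
    integral_waves_mul_waves h.decays_deriv_w h.decays_deriv_w hw' hw']
  simp only [Fin.sum_univ_two, sub_self, hσ, hσ', h.overlap_deriv_self, h.overlap_deriv_comm 1 0,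
    overlap_comm _ _ (-D.σ P c τ), neg_neg, hsq]
  have hΛ10 : overlap (deriv (D.w 0)) (D.w 1) (D.σ P c τ) = D.Λ10 P c τ := rfl
  have hΛ11 : overlap (deriv (D.w 0)) (deriv (D.w 1)) (D.σ P c τ) = D.Λ11 P c τ := rfl
  simp only [hΛ10, hΛ11, Pair.L, Fin.sum_univ_two, Pair.ampRate, Pair.flow]
  ring

end

end Pair.Regular

/-! ### The system annihilates the moments of the laws -/

/-- `ε ∂ₜQ₂` in the fast variables. -/
def Pair.fastRate2 (D : Pair) (P : Params) (c : Corr) (τ ζ : ℝ) : ℝ :=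
  P.rate2 (D.fast P c τ ζ) (D.fastX P c τ ζ) (D.fastT P c τ ζ) (D.fastXT P c τ ζ)

namespace Pair.Regular

variable {D : Pair} {P : Params} {c : Corr} {φlim : Fin 2 → ℝ}

section Splits

variable (h : D.Regular P c φlim)
include h

lemma split_p1 : D.SplitsDensity P c P.p1 := h.split_fast.p1 h.separating P h.split_fastX

lemma split_q2 : D.SplitsDensity P c P.q2 := h.split_fast.q2 h.separating P h.split_fastX

lemma split_pp2 : D.SplitsDensity P c P.pp2 := h.split_fast.pp2 h.separating P h.split_fastX

lemma split_k2 : D.SplitsDensity P c P.k2 := h.split_fastX.k2 h.separating P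

lemma split_fastLaw1 :
    WaveSplit (D.center P c 0) (D.center P c 1)
      (fun z => P.fastLaw1 (D.fast P c) (D.psiDot P) z.1 z.2)
      (P.single1 (D.A 0) (D.V 0) (D.w 0)) (P.single1 (D.A 1) (D.V 1) (D.w 1)) := by
  simp only [h.fastLaw1_eq]
  exact h.split_fast.poly1 h.separating P h.split_fastX h.split_fastXX h.split_fastT

lemma split_fastLaw2 :
    WaveSplit (D.center P c 0) (D.center P c 1)
      (fun z => P.fastLaw2 (D.fast P c) (D.psiDot P) z.1 z.2)
      (P.single2 (D.A 0) (D.V 0) (D.w 0)) (P.single2 (D.A 1) (D.V 1) (D.w 1)) := by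
  simp only [h.fastLaw2_eq]
  exact h.split_fast.poly2 h.separating P h.split_fastX h.split_fastXX h.split_fastT h.split_fastXT

lemma split_fastRate2 :
    WaveSplit (D.center P c 0) (D.center P c 1) (fun z => D.fastRate2 P c z.1 z.2)
      (fun ζ => P.rate2 (D.A 0 * D.w 0 ζ) (P.β * (D.A 0 * deriv (D.w 0) ζ))
        (-D.V 0 * (P.β * (D.A 0 * deriv (D.w 0) ζ)))
        (-D.V 0 * (P.β ^ 2 * (D.A 0 * deriv (deriv (D.w 0)) ζ))))
      (fun ζ => P.rate2 (D.A 1 * D.w 1 ζ) (P.β * (D.A 1 * deriv (D.w 1) ζ))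
        (-D.V 1 * (P.β * (D.A 1 * deriv (D.w 1) ζ)))
        (-D.V 1 * (P.β ^ 2 * (D.A 1 * deriv (deriv (D.w 1)) ζ)))) :=
  h.split_fast.rate2 h.separating P h.split_fastX h.split_fastT h.split_fastXT

end Splits

section ConservationLaw

variable (h : D.Regular P c φlim)
include h

lemma hasDerivAt_fastFlux1 (τ ζ : ℝ) :
    HasDerivAt (fun ζ => P.β * P.p1 (D.fast P c τ ζ) (D.fastX P c τ ζ))
      (P.fastLaw1 (D.fast P c) (D.psiDot P) τ ζ - D.fastT P c τ ζ) ζ := by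
  refine ((P.hasDerivAt_p1 (h.hasDerivAt_fast_right τ ζ)
    (h.hasDerivAt_fastX_right τ ζ)).const_mul P.β).congr_deriv ?_
  have := h.adm.β_pos.ne'
  rw [h.fastLaw1_eq, Params.poly1]
  field_simp
  ring

lemma hasDerivAt_moment_fast (n : ℕ) (τ : ℝ) :
    HasDerivAt (fun τ => ∫ ζ, D.fast P c τ ζ * ζ ^ n)
      ((D.psiDot P)⁻¹ * ∫ ζ, D.fastT P c τ ζ * ζ ^ n) τ := by
  simpa only [mul_assoc, integral_const_mul] using h.split_fast.hasDerivAt_moment h.separating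
    (h.split_fastT.const_mul (D.psiDot P)⁻¹) h.hasDerivAt_fast_left n τ

variable (hsys : D.SolvesSystem P c) (τ : ℝ)
include hsys

lemma integral_fastT : ∫ ζ, D.fastT P c τ ζ = 0 := by
  have hconst : ∀ τ, ∫ ζ, D.fast P c τ ζ = ∑ i, D.A i * D.a1 i := fun τ => by
    have hmass := hsys.mass τ
    simp only [h.integral_fast, Fin.sum_univ_two, Pair.G] at hmass ⊢
    linear_combination hmass
  have hd := h.hasDerivAt_moment_fast 0 τ
  simp only [pow_zero, mul_one, hconst] at hd
  exact (mul_eq_zero.1 (hd.unique (hasDerivAt_const τ _))).resolve_left (inv_ne_zero h.psi.ne')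

lemma integral_fastT_mul_id :
    ∫ ζ, D.fastT P c τ ζ * ζ = P.β * (D.R P c P.p1 0 τ + ∑ i, D.a P P.p1 i) := by
  have hβ := h.adm.β_pos.ne'
  have hψ := h.psi.ne'
  have hfun : (fun s => ∑ i, D.a1 i * (D.A i * c.φ i s + D.χ P c i s * c.S i s))
      = fun s => P.β⁻¹ * (∫ ζ, D.fast P c s ζ * ζ)
        - (∑ i, D.V i * D.A i * D.a1 i) / D.psiDot P * s := funext fun s => by
    simp only [h.integral_fast_mul_id, Fin.sum_univ_two, Pair.G, Pair.center, Pair.χ]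
    field_simp
    ring
  have hd := h.hasDerivAt_moment_fast 1 τ
  simp only [pow_one] at hd
  have hphase := hsys.phase1 τ
  rw [hfun, ((hd.const_mul P.β⁻¹).fun_sub ((hasDerivAt_id' τ).const_mul _)).deriv] at hphase
  rw [← hphase, Finset.sum_congr rfl fun i _ =>
    show D.a P P.p1 i = D.V i * D.A i * D.a1 i from
      (h.profile i).integral_p1 h.adm (h.c0_lt i)]
  field_simp
  ring

lemma integral_fastLaw1 : ∫ ζ, P.fastLaw1 (D.fast P c) (D.psiDot P) τ ζ = 0 := by
  rw [← h.integral_fastT hsys τ]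
  exact ((h.split_p1.decays_section τ).const_mul P.β).integral_eq_of_hasDerivAt_sub
    (h.split_fastLaw1.decays_section τ) (h.split_fastT.decays_section τ)
    (h.split_fastLaw1.continuous_section τ) (h.split_fastT.continuous_section τ)
    (h.hasDerivAt_fastFlux1 τ)

lemma integral_fastLaw1_mul_id :
    ∫ ζ, P.fastLaw1 (D.fast P c) (D.psiDot P) τ ζ * ζ = 0 := by
  rw [((h.split_p1.decays_section τ).const_mul P.β).integral_mul_id_eq_of_hasDerivAt_sub
    (h.split_fastLaw1.decays_section τ) (h.split_fastT.decays_section τ)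
    (h.split_fastLaw1.continuous_section τ) (h.split_fastT.continuous_section τ)
    (h.hasDerivAt_fastFlux1 τ),
    h.integral_fastT_mul_id hsys, integral_const_mul, h.split_p1.integral_density, sub_self]

end ConservationLaw

section BalanceLaw

variable (h : D.Regular P c φlim)
include h

lemma hasDerivAt_fastFlux2 (τ ζ : ℝ) :
    HasDerivAt (fun ζ => P.β * P.pp2 (D.fast P c τ ζ) (D.fastX P c τ ζ)
        + 2 * P.α ^ 2 * P.β * (D.fastX P c τ ζ * D.fastT P c τ ζ))
      (P.fastLaw2 (D.fast P c) (D.psiDot P) τ ζ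
        - (D.fastRate2 P c τ ζ + P.k2 (D.fast P c τ ζ) (D.fastX P c τ ζ))) ζ := by
  refine (((P.hasDerivAt_pp2 (h.hasDerivAt_fast_right τ ζ)
    (h.hasDerivAt_fastX_right τ ζ)).const_mul P.β).add (((h.hasDerivAt_fastX_right τ ζ).mul
      (h.hasDerivAt_fastT_right τ ζ)).const_mul (2 * P.α ^ 2 * P.β))).congr_deriv ?_
  have := h.adm.β_pos.ne'
  rw [h.fastLaw2_eq]
  simp only [Params.poly2, Params.k2, Pair.fastRate2]
  field_simp
  ring

lemma hasDerivAt_moment_q2 (n : ℕ) (τ : ℝ) :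
    HasDerivAt (fun τ => ∫ ζ, P.q2 (D.fast P c τ ζ) (D.fastX P c τ ζ) * ζ ^ n)
      ((D.psiDot P)⁻¹ * ∫ ζ, D.fastRate2 P c τ ζ * ζ ^ n) τ := by
  simpa only [mul_assoc, integral_const_mul] using h.split_q2.hasDerivAt_moment h.separating
    (h.split_fastRate2.const_mul (D.psiDot P)⁻¹) (fun τ ζ =>
      (P.hasDerivAt_q2 (h.hasDerivAt_fast_left τ ζ) (h.hasDerivAt_fastX_left τ ζ)).congr_deriv (by
        simp only [Pair.fastRate2, Params.rate2]
        ring)) n τ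

lemma a_k2 (i : Fin 2) : D.a P P.k2 i = 0 := (h.profile i).integral_k2

lemma firstMoment_q2 (i : Fin 2) : D.firstMoment P P.q2 i = 0 := (h.profile i).integral_q2_mul_id

lemma a_pp2 (i : Fin 2) :
    D.a P P.pp2 i = D.V i * D.a P P.q2 i + 2 * P.α ^ 2 * P.β ^ 2 * D.A i ^ 2 * D.V i * D.a2' i
      + P.β⁻¹ * D.firstMoment P P.k2 i := by
  have hmoment := (h.profile i).moment_p2 h.adm (h.c0_lt i)
  simp only [mul_comm _ (P.k2 _ _)] at hmoment
  simp only [Pair.a, Pair.a2', Pair.firstMoment]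
  linear_combination -hmoment

lemma decays_fastFlux2 (τ : ℝ) :
    DecaysIn id fun ζ => P.β * P.pp2 (D.fast P c τ ζ) (D.fastX P c τ ζ)
      + 2 * P.α ^ 2 * P.β * (D.fastX P c τ ζ * D.fastT P c τ ζ) :=
  ((h.split_pp2.const_mul P.β).add ((h.split_fastX.mul h.separating h.split_fastT).const_mul
    (2 * P.α ^ 2 * P.β))).decays_section τ

variable (hsys : D.SolvesSystem P c) (τ : ℝ)
include hsys

lemma integral_fastRate2 : ∫ ζ, D.fastRate2 P c τ ζ = -D.R P c P.k2 0 τ := by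
  have hfun : D.R P c P.q2 0 = fun s =>
      (∫ ζ, P.q2 (D.fast P c s ζ) (D.fastX P c s ζ)) - ∑ i, D.a P P.q2 i := funext fun s => by
    rw [h.split_q2.integral_density, add_sub_cancel_right]
  have hd := h.hasDerivAt_moment_q2 0 τ
  simp only [pow_zero, mul_one] at hd
  have henergy := hsys.energy τ
  rw [hfun, (hd.sub_const _).deriv, mul_inv_cancel_left₀ h.psi.ne'] at henergy
  exact eq_neg_of_add_eq_zero_left henergy

lemma integral_fastRate2_mul_id :
    ∫ ζ, D.fastRate2 P c τ ζ * ζ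
      = P.β * (D.R P c P.pp2 0 τ - 2 * P.α ^ 2 * P.β * D.L P c τ + ∑ i, D.V i * D.a P P.q2 i)
        - D.center P c 1 τ * D.R P c P.k2 0 τ - D.R P c P.k2 1 τ := by
  have hβ := h.adm.β_pos.ne'
  have hψ := h.psi.ne'
  have hfun : (fun s => (∑ i, D.a P P.q2 i * c.φ i s) + D.χ P c 1 s * D.R P c P.q2 0 s
        + (P.β)⁻¹ * D.R P c P.q2 1 s)
      = fun s => P.β⁻¹ * (∫ ζ, P.q2 (D.fast P c s ζ) (D.fastX P c s ζ) * ζ)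
        - (∑ i, D.V i * D.a P P.q2 i) / D.psiDot P * s := funext fun s => by
    simp only [h.split_q2.integral_density_mul_id, h.firstMoment_q2, Fin.sum_univ_two,
      Pair.center, Pair.χ]
    field_simp
    ring
  have hd := h.hasDerivAt_moment_q2 1 τ
  simp only [pow_one] at hd
  have hphase := hsys.phase2 τ
  rw [hfun, ((hd.const_mul P.β⁻¹).fun_sub ((hasDerivAt_id' τ).const_mul _)).deriv] at hphase
  rw [Pair.center]
  field_simp at hphase
  linear_combination hphase

lemma integral_fastLaw2 : ∫ ζ, P.fastLaw2 (D.fast P c) (D.psiDot P) τ ζ = 0 := by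
  have hrate := h.split_fastRate2.add h.split_k2
  rw [(h.decays_fastFlux2 τ).integral_eq_of_hasDerivAt_sub
    (h.split_fastLaw2.decays_section τ) (hrate.decays_section τ)
    (h.split_fastLaw2.continuous_section τ) (hrate.continuous_section τ)
    (h.hasDerivAt_fastFlux2 τ), integral_add (h.split_fastRate2.integrable_section τ)
    (h.split_k2.integrable_section τ), h.integral_fastRate2 hsys, h.split_k2.integral_density]
  simp only [h.a_k2, Finset.sum_const_zero]
  ring

lemma integral_fastLaw2_mul_id :
    ∫ ζ, P.fastLaw2 (D.fast P c) (D.psiDot P) τ ζ * ζ = 0 := by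
  have hβ := mul_inv_cancel₀ h.adm.β_pos.ne'
  have hrate := h.split_fastRate2.add h.split_k2
  rw [(h.decays_fastFlux2 τ).integral_mul_id_eq_of_hasDerivAt_sub
    (h.split_fastLaw2.decays_section τ) (hrate.decays_section τ)
    (h.split_fastLaw2.continuous_section τ) (hrate.continuous_section τ)
    (h.hasDerivAt_fastFlux2 τ)]
  simp only [add_mul]
  rw [integral_add ((h.split_fastRate2.decays_section τ).integrable_mul_id
      (h.split_fastRate2.continuous_section τ)) ((h.split_k2.decays_section τ).integrable_mul_id
      (h.split_k2.continuous_section τ)),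
    integral_add ((h.split_pp2.integrable_section τ).const_mul _)
      (((h.split_fastX.mul h.separating h.split_fastT).integrable_section τ).const_mul _),
    integral_const_mul, integral_const_mul, h.integral_fastRate2_mul_id hsys,
    h.split_k2.integral_density_mul_id, h.split_pp2.integral_density, h.integral_fastX_mul_fastT]
  simp only [h.a_k2, h.a_pp2, Fin.sum_univ_two]
  linear_combination -(D.firstMoment P P.k2 0 + D.firstMoment P P.k2 1) * hβ

end BalanceLaw

end Pair.Regular

/-! ### The ansatz as a weak asymptotic solution -/

namespace Pair

variable {D : Pair} {P : Params} {c : Corr} {φlim : Fin 2 → ℝ} {tstar xstar : ℝ}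

lemma V_sub_pos (hx : D.x0 1 < D.x0 0) (htstar : 0 < tstar)
    (hmeet : ∀ i, D.traj i tstar = xstar) : 0 < D.V 1 - D.V 0 := by
  have hdiff : (D.V 1 - D.V 0) * tstar = D.x0 0 - D.x0 1 := by
    have h0 := hmeet 0
    have h1 := hmeet 1
    simp only [Pair.traj] at h0 h1
    linarith
  exact pos_of_mul_pos_left (hdiff ▸ sub_pos.2 hx) htstar.le

lemma traj_eq (hmeet : ∀ i, D.traj i tstar = xstar) (i : Fin 2) (t : ℝ) :
    D.traj i t = xstar + D.V i * (t - tstar) := by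
  rw [← hmeet i, Pair.traj, Pair.traj]
  ring

lemma tau_eq (hmeet : ∀ i, D.traj i tstar = xstar) (ε t : ℝ) :
    D.tau P ε t = D.psiDot P / ε * (t - tstar) := by
  rw [Pair.tau, traj_eq hmeet, traj_eq hmeet, Pair.psiDot]
  ring

namespace Regular

lemma ansatz_eq (h : D.Regular P c φlim) (hmeet : ∀ i, D.traj i tstar = xstar) {ε : ℝ}
    (hε : 0 < ε) : D.ansatz P c ε = fun t x =>
      D.fast P c (D.psiDot P / ε * (t - tstar)) (P.β / ε * (x - xstar)) := by
  funext t x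
  have harg : ∀ i, P.β * (x - (D.traj i t + ε * c.φ i (D.psiDot P / ε * (t - tstar)))) / ε
      = P.β / ε * (x - xstar) - D.center P c i (D.psiDot P / ε * (t - tstar)) := fun i => by
    have := h.psi.ne'
    rw [traj_eq hmeet, Pair.center, Pair.χ]
    field_simp
    ring
  simp only [Pair.ansatz, tau_eq hmeet, harg, Fin.sum_univ_two]
  rfl

theorem isWeakAsymptoticSolution (h : D.Regular P c φlim) (hsys : D.SolvesSystem P c)
    (hmeet : ∀ i, D.traj i tstar = xstar) (T : ℝ) :
    P.IsWeakAsymptoticSolution T (D.ansatz P c) where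
  smooth ε hε := by
    rw [h.ansatz_eq hmeet hε]
    exact (h.contDiff_fast.comp (f := fun z : ℝ × ℝ => (D.psiDot P / ε * (z.1 - tstar),
      P.β / ε * (z.2 - xstar))) (by fun_prop)).contDiffOn
  cont := contInDistribUnif_of_scaled T h.adm.β_pos h.contDiff_fast
    (fun ε hε t x => congrFun₂ (h.ansatz_eq hmeet hε) t x)
    fun _ => h.split_fast.pairing_bounded xstar P.β
  law1 := isOD_of_scaled T h.adm.β_pos h.contDiff_fastLaw1
    (fun ε hε t x => by rw [h.ansatz_eq hmeet hε, P.law1_scaled _ hε])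
    fun _ => h.split_fastLaw1.pairing_quadratic
      ((h.profile 0).integral_single1 h.adm (h.c0_lt 0))
      ((h.profile 0).integral_single1_mul_id h.adm (h.c0_lt 0))
      ((h.profile 1).integral_single1 h.adm (h.c0_lt 1))
      ((h.profile 1).integral_single1_mul_id h.adm (h.c0_lt 1))
      (h.integral_fastLaw1 hsys) (h.integral_fastLaw1_mul_id hsys) xstar P.β
  law2 := isOD_of_scaled T h.adm.β_pos h.contDiff_fastLaw2
    (fun ε hε t x => by rw [h.ansatz_eq hmeet hε, P.law2_scaled _ hε])
    fun _ => h.split_fastLaw2.pairing_quadratic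
      ((h.profile 0).integral_single2 h.adm (h.c0_lt 0))
      ((h.profile 0).integral_single2_mul_id h.adm (h.c0_lt 0))
      ((h.profile 1).integral_single2 h.adm (h.c0_lt 1))
      ((h.profile 1).integral_single2_mul_id h.adm (h.c0_lt 1))
      (h.integral_fastLaw2 hsys) (h.integral_fastLaw2_mul_id hsys) xstar P.β

end Regular

end Pair

/-! ### The asymptotics away from the collision -/

lemma abs_le_sq_of_decay {f C κ ε τ : ℝ} (hf : |τ| ^ 2 * |f| ≤ C) (hκ : 0 < κ) (hε : 0 < ε)
    (hτ : κ / ε ≤ |τ|) : |f| ≤ C / κ ^ 2 * ε ^ 2 := by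
  have := div_pos hκ hε
  rw [div_mul_eq_mul_div, le_div_iff₀ (by positivity)]
  calc |f| * κ ^ 2 = (κ / ε) ^ 2 * |f| * ε ^ 2 := by field_simp
    _ ≤ |τ| ^ 2 * |f| * ε ^ 2 := by gcongr
    _ ≤ C * ε ^ 2 := by gcongr

lemma abs_wave_sub_le {w : ℝ → ℝ} {A S B E u v : ℝ} (hw : ContDiff ℝ ∞ w)
    (hB : ∀ z, |w z| ≤ B) (hE : ∀ z, |deriv w z| ≤ E) :
    |(A + S) * w u - A * w v| ≤ B * |S| + |A| * E * |u - v| := by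
  have hlip : |w u - w v| ≤ E * |u - v| :=
    convex_univ.norm_image_sub_le_of_norm_deriv_le
      (fun z _ => (hasDerivAt_of_smooth hw z).differentiableAt) (fun z _ => hE z)
      (mem_univ v) (mem_univ u)
  calc |(A + S) * w u - A * w v| = |w u * S + A * (w u - w v)| := by ring_nf
    _ ≤ |w u| * |S| + |A| * |w u - w v| := by
        rw [← abs_mul, ← abs_mul]; exact abs_add_le _ _
    _ ≤ B * |S| + |A| * (E * |u - v|) := by
        gcongr
        exact hB u
    _ = B * |S| + |A| * E * |u - v| := by ring

namespace Pair.Regular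

variable {D : Pair} {P : Params} {c : Corr} {φlim s : Fin 2 → ℝ} {tstar xstar δ : ℝ}

lemma exists_abs_ansatz_sub_free_le (h : D.Regular P c φlim) (s : Fin 2 → ℝ) :
    ∃ M N : Fin 2 → ℝ, (∀ i, 0 ≤ M i ∧ 0 ≤ N i) ∧ ∀ ε > 0, ∀ t x,
      |D.ansatz P c ε t x - D.free P s ε t x|
        ≤ ∑ i, (M i * |c.S i (D.tau P ε t)| + N i * |c.φ i (D.tau P ε t) - s i|) := by
  choose B hB using fun i => (h.decays_w i).bounded
  choose E hE using fun i => (h.decays_deriv_w i).bounded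
  have hβ := h.adm.β_pos
  have hE0 : ∀ i, 0 ≤ E i := fun i => (abs_nonneg _).trans (hE i 0)
  refine ⟨B, fun i => |D.A i| * E i * P.β, fun i =>
    ⟨(abs_nonneg _).trans (hB i 0), mul_nonneg (mul_nonneg (abs_nonneg _) (hE0 i)) hβ.le⟩,
    fun ε hε t x => ?_⟩
  rw [Pair.ansatz, Pair.free, ← Finset.sum_sub_distrib]
  refine (Finset.abs_sum_le_sum_abs _ _).trans (Finset.sum_le_sum fun i _ =>
    (abs_wave_sub_le (h.smooth_w i) (hB i) (hE i)).trans_eq ?_)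
  set a := c.φ i (D.tau P ε t)
  have hshift : P.β * (x - (D.traj i t + ε * a)) / ε - P.β * (x - (D.traj i t + ε * s i)) / ε
      = -(P.β * (a - s i)) := by
    field_simp
    ring
  rw [hshift, abs_neg, abs_mul, abs_of_pos hβ, mul_assoc (|D.A i| * E i)]

/-- Uniformly in `t` with `δ ≤ |t - t*|`, `|τ|` exceeds a multiple of `ε⁻¹`. -/
lemma away_from_collision (h : D.Regular P c φlim) (hmeet : ∀ i, D.traj i tstar = xstar)
    {I : Set ℝ} (hS : ∀ i, ∃ C, ∀ τ ∈ I, |τ| ^ 2 * |c.S i τ| ≤ C)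
    (hφ : ∀ i, ∃ C, ∀ τ ∈ I, |τ| ^ 2 * |c.φ i τ - s i| ≤ C) (hδ : 0 < δ) :
    ∃ C, ∀ ε > 0, ∀ t, δ ≤ |t - tstar| → D.tau P ε t ∈ I → ∀ x,
      |D.ansatz P c ε t x - D.free P s ε t x| ≤ C * ε ^ 2 := by
  obtain ⟨M, N, hMN, hle⟩ := h.exists_abs_ansatz_sub_free_le s
  choose C hC using hS
  choose E hE using hφ
  set κ := D.psiDot P * δ
  have hκ : 0 < κ := mul_pos h.psi hδ
  refine ⟨∑ i, (M i * (C i / κ ^ 2) + N i * (E i / κ ^ 2)), fun ε hε t ht hI x => ?_⟩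
  have hτ : κ / ε ≤ |D.tau P ε t| := by
    rw [tau_eq hmeet, abs_mul, abs_of_pos (div_pos h.psi hε), mul_div_right_comm]
    exact mul_le_mul_of_nonneg_left ht (div_pos h.psi hε).le
  refine (hle ε hε t x).trans ?_
  rw [Finset.sum_mul]
  refine Finset.sum_le_sum fun i _ => ?_
  rw [add_mul, mul_assoc, mul_assoc (N i)]
  exact add_le_add
    (mul_le_mul_of_nonneg_left (abs_le_sq_of_decay (hC i _ hI) hκ hε hτ) (hMN i).1)
    (mul_le_mul_of_nonneg_left (abs_le_sq_of_decay (hE i _ hI) hκ hε hτ) (hMN i).2)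

theorem before_collision (h : D.Regular P c φlim) (hmeet : ∀ i, D.traj i tstar = xstar)
    (hδ : 0 < δ) : ∃ C, ∀ ε > 0, ∀ t ≤ tstar - δ, ∀ x,
      |D.ansatz P c ε t x - D.free P 0 ε t x| ≤ C * ε ^ 2 := by
  obtain ⟨C, hC⟩ := h.away_from_collision (I := Iic 0) (s := 0) hmeet
    (fun i => by
      simpa using exists_pow_mul_abs_sub_le_atBot (h.lim.smooth_S i) (h.lim.rapid_S i)
        (h.lim.S_bot i) 2)
    (fun i => exists_pow_mul_abs_sub_le_atBot (h.lim.smooth_φ i) (h.lim.rapid_φ i)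
      (h.lim.φ_bot i) 2) hδ
  refine ⟨C, fun ε hε t ht => hC ε hε t ?_ ?_⟩
  · rw [abs_of_nonpos (by linarith)]; linarith
  · rw [tau_eq hmeet]
    exact mul_nonpos_of_nonneg_of_nonpos (div_pos h.psi hε).le (by linarith)

theorem after_collision (h : D.Regular P c φlim) (hmeet : ∀ i, D.traj i tstar = xstar)
    (hδ : 0 < δ) : ∃ C, ∀ ε > 0, ∀ t ≥ tstar + δ, ∀ x,
      |D.ansatz P c ε t x - D.free P φlim ε t x| ≤ C * ε ^ 2 := by
  obtain ⟨C, hC⟩ := h.away_from_collision (I := Ici 0) hmeet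
    (fun i => by
      simpa using exists_pow_mul_abs_sub_le_atTop (h.lim.smooth_S i) (h.lim.rapid_S i)
        (h.lim.S_top i) 2)
    (fun i => exists_pow_mul_abs_sub_le_atTop (h.lim.smooth_φ i) (h.lim.rapid_φ i)
      (h.lim.φ_top i) 2) hδ
  refine ⟨C, fun ε hε t ht => hC ε hε t ?_ ?_⟩
  · rw [abs_of_nonneg (by linarith)]; linarith
  · rw [tau_eq hmeet]
    exact mul_nonneg (div_pos h.psi hε).le (by linarith)

theorem elastic (h : D.Regular P c φlim) (hmeet : ∀ i, D.traj i tstar = xstar) (T : ℝ) :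
    D.Elastic P T tstar φlim (D.ansatz P c) := fun δ hδ => by
  obtain ⟨C, hC⟩ := h.before_collision hmeet hδ
  obtain ⟨E, hE⟩ := h.after_collision hmeet hδ
  refine ⟨max C E, 1, one_pos, fun ε hε t _ x => ⟨fun ht => ?_, fun ht => ?_⟩⟩
  · exact (hC ε hε.1 t ht x).trans (by gcongr; exact le_max_left C E)
  · exact (hE ε hε.1 t ht x).trans (by gcongr; exact le_max_right C E)

end Pair.Regular

end DP

end

theorem theorem2_general (P : DP.Params) (hP : P.Admissible) (D : DP.Pair) (tstar xstar T : ℝ)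
    (hV : ∀ i, P.c0 < D.V i) (hw : ∀ i, P.IsProfile (D.A i) (D.V i) (D.w i))
    (hx : D.x0 1 < D.x0 0) (htstar : 0 < tstar) (hmeet : ∀ i, D.traj i tstar = xstar)
    (c : DP.Corr) (φlim : Fin 2 → ℝ)
    (hsys : D.SolvesSystem P c) (hlim : c.HasLimits φlim) :
    P.IsWeakAsymptoticSolution T (D.ansatz P c) ∧
    (∃ C, ∃ ε₀ > 0, ∀ ε ∈ Set.Ioc 0 ε₀, ∀ x,
      |D.ansatz P c ε 0 x - D.initial P ε x| ≤ C * ε ^ 2) ∧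
    D.Elastic P T tstar φlim (D.ansatz P c) := by
  have h : D.Regular P c φlim :=
    ⟨hP, hw, hV, mul_pos hP.β_pos (DP.Pair.V_sub_pos hx htstar hmeet), hlim⟩
  refine ⟨h.isWeakAsymptoticSolution hsys hmeet T, ?_, h.elastic hmeet T⟩
  obtain ⟨C, hC⟩ := h.before_collision hmeet htstar
  refine ⟨C, 1, one_pos, fun ε hε x => ?_⟩
  simpa [DP.Pair.free, DP.Pair.initial, DP.Pair.traj] using hC ε hε.1 0 (sub_self tstar).ge x

theorem theorem2 (P : DP.Params) (hP : P.Admissible)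
    (D : DP.Pair) (g : Fin 2 → ℝ) (tstar xstar T : ℝ) (hT : 0 < T)
    (hA : 0 < D.A 0 ∧ D.A 0 < D.A 1)
    (hV : ∀ i, P.IsVelocity (D.A i) (D.V i) (g i))
    (hcrit : ∀ i, P.SolitonCriterion (D.A i) (g i))
    (hw : ∀ i, P.IsProfile (D.A i) (D.V i) (D.w i))
    (hx : D.x0 1 < D.x0 0)
    (htstar : 0 < tstar) (hmeet : ∀ i, D.traj i tstar = xstar)
    (c : DP.Corr) (φlim : Fin 2 → ℝ)
    (hsys : D.SolvesSystem P c) (hlim : c.HasLimits φlim) :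
    P.IsWeakAsymptoticSolution T (D.ansatz P c) ∧
    (∃ C, ∃ ε₀ > 0, ∀ ε ∈ Set.Ioc 0 ε₀, ∀ x,
      |D.ansatz P c ε 0 x - D.initial P ε x| ≤ C * ε ^ 2) ∧
    D.Elastic P T tstar φlim (D.ansatz P c) :=
  have hA' : ∀ i, 0 < D.A i := Fin.forall_fin_two.2 ⟨hA.1, hA.1.trans hA.2⟩
  theorem2_general P hP D tstar xstar T (fun i => (hV i).c0_lt hP (hA' i)) hw hx htstar hmeet c
    φlim hsys hlim
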